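/- All alphabets are finite (input alphabets non-empty), entropies are in bits, and $X\leftrightarrow Y\leftrightarrow Z$ denotes a Markov chain. A discrete memoryless broadcast channel (DMBC) $X\to(Y,Z)$ is given by $P_{Y,Z|X}$. It is obversely degraded if $X\leftrightarrow Y\leftrightarrow Z$ and reversely degraded if $X\leftrightarrow Z\leftrightarrow Y$, for every input law. It is degraded if, after relabelling the alphabets, $X=[X_O,X_R]$, $Y=[Y_O,Y_R]$, $Z=[Z_O,Z_R]$ with $P_{Y,Z|X}=P_{Y_O,Z_O|X_O}\,P_{Y_R,Z_R|X_R}$, where $X_O\to(Y_O,Z_O)$ is obversely and $X_R\to(Y_R,Z_R)$ is reversely degraded. A 2DMBC is a pair of independent DMBCs: a forward one $X_f\to(Y_f,Z_f)$ from Alice to Bob and a backward one $X_b\to(Y_b,Z_b)$ from Bob to Alice; Eve receives $Z_f$ and $Z_b$. In a secret-key establishment protocol, over finitely many rounds of fixed lengths, Alice and Bob alternately send sequences over their channel, each computed from the sender's own independent local randomness and everything the sender received in earlier rounds. At the end one party computes a key $S$ in a finite set $\mathcal S$ and the other an estimate $\hat S\in\mathcal S$, each from the local randomness and the received symbols. With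 $n_f,n_b$ the numbers of uses of the two channels ($n_f+n_b>0$) and $\mathrm{View}_E$ all that Eve receives, the protocol is $(R,\delta)$-secure if $$\frac{H(S)}{n_f+n_b}>R-\delta,\qquad \frac{H(S)}{n_f+n_b}>\frac{\log_2|\mathcal S|}{n_f+n_b}-\delta,\qquad \Pr(\hat S\ne S)<\delta,\qquad \frac{H(S|\mathrm{View}_E)}{H(S)}>1-\delta .$$ The secret-key capacity $C_{sk}$ is the largest $R\ge 0$ such that for every $\delta\in(0,1]$ there is an $(R,\delta)$-secure protocol. Theorem 3. Let both DMBCs of a 2DMBC be degraded, with $X_f=[X_{f,O},X_{f,R}]$, $X_b=[X_{b,O},X_{b,R}]$, and likewise for the outputs. Then the secret-key capacity exists and $$C_{sk}=\max_{P_{X_{f,O}},P_{X_{b,O}}}\max\{I(X_{f,O};Y_{f,O}|Z_{f,O}),\,I(X_{b,O};Y_{b,O}|Z_{b,O})\}.$$ It coincides with the general upper bound $$\max_{P_{X_f},P_{X_b}}\max\{I(X_f;Y_f|Z_f),\,I(X_b;Y_b|Z_b)\}$$ and with the general lower bound $\max\{0,L_A,L_B\}$. Here $L_A$ is the supremum (ignored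 if there is no admissible choice) of $$\frac{n_f\,[I(V;X_f)-I(V;Z_f)]+n_b\,\max\{0,\;I(W_1;Y_b|W_2)-I(W_1;Z_b|W_2)\}}{n_f+n_b}$$ over integers $n_f,n_b\ge 0$ and finite-valued $V,W_1,W_2$ with $V\leftrightarrow Y_f\leftrightarrow(X_f,Z_f)$, $W_2\leftrightarrow W_1\leftrightarrow X_b\leftrightarrow(Y_b,Z_b)$ and $n_f I(V;Y_f|X_f)<n_b I(W_1;Y_b)$, and $L_B$ is $L_A$ with $f$ and $b$ exchanged. Moreover, the capacity is achieved by one-round key transport: for every $\delta\in(0,1]$ there is a $(C_{sk},\delta)$-secure protocol with a single round, in which the key is a function of the sender's local randomness alone. -/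

import Mathlib

namespace TwoWaySKE

/-! ### Finite probability, entropy and mutual information (in bits)

A law on a finite set `Ω` is a point of `stdSimplex ℝ Ω`; a random variable is a function on `Ω`. -/

section Info

variable {Ω : Type*} [Fintype Ω] {α β γ : Type*}

/-- Probability of an event under the mass function `p`. -/
noncomputable def prob (p : Ω → ℝ) (A : Set Ω) : ℝ := ∑ ω, A.indicator p ω

/-- The distribution `u ↦ P(U = u)` of the random variable `U`. -/
noncomputable def law (p : Ω → ℝ) (U : Ω → α) (u : α) : ℝ := prob p {ω | U ω = u}

/-- The pair `(U, V)` of two random variables. -/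
def pair (U : Ω → α) (V : Ω → β) (ω : Ω) : α × β := (U ω, V ω)

/-- Shannon entropy `H(U)`. -/
noncomputable def entropy [Fintype α] (p : Ω → ℝ) (U : Ω → α) : ℝ :=
  -∑ u, law p U u * Real.logb 2 (law p U u)

/-- Conditional entropy `H(U | V) = -∑ P(u, v) log P(u | v)`. -/
noncomputable def condEntropy [Fintype α] [Fintype β] (p : Ω → ℝ) (U : Ω → α) (V : Ω → β) : ℝ :=
  -∑ v, ∑ u, law p (pair U V) (u, v) * Real.logb 2 (law p (pair U V) (u, v) / law p V v)

/-- Mutual information `I(U; V)`. -/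
noncomputable def mutualInfo [Fintype α] [Fintype β] (p : Ω → ℝ) (U : Ω → α) (V : Ω → β) : ℝ :=
  entropy p U - condEntropy p U V

/-- Conditional mutual information `I(U; V | W)`. -/
noncomputable def condMutualInfo [Fintype α] [Fintype β] [Fintype γ]
    (p : Ω → ℝ) (U : Ω → α) (V : Ω → β) (W : Ω → γ) : ℝ :=
  condEntropy p U W - condEntropy p U (pair V W)

/-- The Markov chain `U ↔ V ↔ W`: given `V`, the variables `U` and `W` are independent. -/
def IsMarkov (p : Ω → ℝ) (U : Ω → α) (V : Ω → β) (W : Ω → γ) : Prop :=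
  ∀ u v w, law p (pair U (pair V W)) (u, v, w) * law p V v =
    law p (pair U V) (u, v) * law p (pair V W) (v, w)

end Info

/-! ### Discrete memoryless broadcast channels -/

/-- A discrete memoryless broadcast channel `X → (Y, Z)`, given by its transition
probabilities `prob x (y, z) = P(y, z | x)`; `Y` is the legitimate output, `Z` is Eve's. -/
structure DMBC (X Y Z : Type*) [Fintype Y] [Fintype Z] where
  prob : X → Y × Z → ℝ
  prob_mem : ∀ x, prob x ∈ stdSimplex ℝ (Y × Z)

namespace DMBC

section One

variable {X Y Z : Type*} [Fintype X] [Fintype Y] [Fintype Z]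

/-- The joint law of `(X, Y, Z)` when the input has law `P`. -/
def joint (W : DMBC X Y Z) (P : X → ℝ) : X × Y × Z → ℝ :=
  fun a => P a.1 * W.prob a.1 a.2

/-- `I(X; Y | Z)` when the input has law `P`. -/
noncomputable def secretInfo (W : DMBC X Y Z) (P : X → ℝ) : ℝ :=
  condMutualInfo (W.joint P) (fun a => a.1) (fun a => a.2.1) (fun a => a.2.2)

/-- `X ↔ Y ↔ Z` is a Markov chain, whatever the input law. -/
def ObverselyDegraded (W : DMBC X Y Z) : Prop :=
  ∀ P ∈ stdSimplex ℝ X,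
    IsMarkov (W.joint P) (fun a => a.1) (fun a => a.2.1) (fun a => a.2.2)

/-- `X ↔ Z ↔ Y` is a Markov chain, whatever the input law. -/
def ReverselyDegraded (W : DMBC X Y Z) : Prop :=
  ∀ P ∈ stdSimplex ℝ X,
    IsMarkov (W.joint P) (fun a => a.1) (fun a => a.2.2) (fun a => a.2.1)

end One

/-- `W` has the two independent subchannels `WO` and `WR`: up to relabelling of the alphabets,
`X = [XO, XR]`, `Y = [YO, YR]`, `Z = [ZO, ZR]`, where `(YO, ZO)` depends only on `XO`,
`(YR, ZR)` depends only on `XR`, and the two are produced independently. -/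
def HasSubchannels {X Y Z XO YO ZO XR YR ZR : Type*}
    [Fintype Y] [Fintype Z] [Fintype YO] [Fintype ZO] [Fintype YR] [Fintype ZR]
    (W : DMBC X Y Z) (WO : DMBC XO YO ZO) (WR : DMBC XR YR ZR) : Prop :=
  ∃ (eX : X ≃ XO × XR) (eY : Y ≃ YO × YR) (eZ : Z ≃ ZO × ZR), ∀ x y z,
    W.prob x (y, z) =
      WO.prob (eX x).1 ((eY y).1, (eZ z).1) * WR.prob (eX x).2 ((eY y).2, (eZ z).2)

/-- `W` is degraded, with obversely degraded part `WO` and reversely degraded part `WR`. -/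
def DegradedInto {X Y Z XO YO ZO XR YR ZR : Type*} [Fintype XO] [Fintype XR]
    [Fintype Y] [Fintype Z] [Fintype YO] [Fintype ZO] [Fintype YR] [Fintype ZR]
    (W : DMBC X Y Z) (WO : DMBC XO YO ZO) (WR : DMBC XR YR ZR) : Prop :=
  W.HasSubchannels WO WR ∧ WO.ObverselyDegraded ∧ WR.ReverselyDegraded

end DMBC

/-! ### Secret-key establishment protocols -/

/-- The public schedule of a protocol: a number of rounds, in which Alice and Bob send
alternately, who sends first, and how many symbols are sent in each round. -/
structure Schedule where
  rounds : ℕ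
  aliceFirst : Bool
  len : Fin rounds → ℕ

namespace Schedule

/-- Whether Alice is the sender in round `r` (rounds are numbered from `0`). -/
def aliceSends (σ : Schedule) (r : Fin σ.rounds) : Bool :=
  if r.val % 2 = 0 then σ.aliceFirst else !σ.aliceFirst

/-- The uses of the forward channel: a round in which Alice sends, and a position in it. -/
abbrev FwdUse (σ : Schedule) : Type :=
  Σ r : {r : Fin σ.rounds // σ.aliceSends r = true}, Fin (σ.len r.val)

/-- The uses of the backward channel: a round in which Bob sends, and a position in it. -/
abbrev BwdUse (σ : Schedule) : Type :=
  Σ r : {r : Fin σ.rounds // σ.aliceSends r = false}, Fin (σ.len r.val)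

/-- The total number `n_f + n_b` of channel uses. -/
def uses (σ : Schedule) : ℕ := Fintype.card σ.FwdUse + Fintype.card σ.BwdUse

end Schedule

/-- A secret-key establishment protocol. Alice and Bob hold independent local randomness; in every
round the sender computes the symbols to be sent from the local randomness and from
the symbols received in earlier rounds. At the end one party computes the key and the other
one its estimate, each from the local randomness and all the received symbols. -/
structure Protocol (Xf Yf Xb Yb : Type*) where
  σ : Schedule
  /-- Alice's local randomness: its range and its law. -/
  mA : ℕ
  randA : Fin mA → ℝ
  randA_mem : randA ∈ stdSimplex ℝ (Fin mA)
  /-- Bob's local randomness: its range and its law. -/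
  mB : ℕ
  randB : Fin mB → ℝ
  randB_mem : randB ∈ stdSimplex ℝ (Fin mB)
  /-- Alice's inputs to the forward channel, which depend on the past only. -/
  encA : Fin mA → (σ.BwdUse → Yb) → σ.FwdUse → Xf
  encA_causal : ∀ (a : Fin mA) (y y' : σ.BwdUse → Yb) (i : σ.FwdUse),
    (∀ j : σ.BwdUse, j.1.val < i.1.val → y j = y' j) → encA a y i = encA a y' i
  /-- Bob's inputs to the backward channel, which depend on the past only. -/
  encB : Fin mB → (σ.FwdUse → Yf) → σ.BwdUse → Xb
  encB_causal : ∀ (b : Fin mB) (y y' : σ.FwdUse → Yf) (j : σ.BwdUse),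
    (∀ i : σ.FwdUse, i.1.val < j.1.val → y i = y' i) → encB b y j = encB b y' j
  /-- The size of the key set. -/
  keySize : ℕ
  /-- What Alice and Bob output at the end. -/
  outA : Fin mA → (σ.BwdUse → Yb) → Fin keySize
  outB : Fin mB → (σ.FwdUse → Yf) → Fin keySize
  /-- Whether the key is Alice's output (and its estimate Bob's), or the other way round. -/
  keyByAlice : Bool

namespace Protocol

variable {Xf Yf Zf Xb Yb Zb : Type*} [Fintype Yf] [Fintype Zf] [Fintype Yb] [Fintype Zb]

/-- All that is random in an execution: the local randomness and the outputs of all uses of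
the two channels. -/
@[ext] structure Outcome (prot : Protocol Xf Yf Xb Yb) (Zf Zb : Type*) where
  a : Fin prot.mA
  b : Fin prot.mB
  yf : prot.σ.FwdUse → Yf
  zf : prot.σ.FwdUse → Zf
  yb : prot.σ.BwdUse → Yb
  zb : prot.σ.BwdUse → Zb

open Classical in
noncomputable instance (prot : Protocol Xf Yf Xb Yb) : Fintype (prot.Outcome Zf Zb) :=
  Fintype.ofInjective
    (fun o => (o.a, o.b, o.yf, o.zf, o.yb, o.zb)) (by
      rintro ⟨a, b, yf, zf, yb, zb⟩ ⟨a', b', yf', zf', yb', zb'⟩ h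
      simpa using h)

/-- The law of an execution over the independent memoryless channels `Wf` and `Wb`. -/
noncomputable def run (prot : Protocol Xf Yf Xb Yb) (Wf : DMBC Xf Yf Zf) (Wb : DMBC Xb Yb Zb)
    (o : prot.Outcome Zf Zb) : ℝ :=
  prot.randA o.a * prot.randB o.b *
    (∏ i, Wf.prob (prot.encA o.a o.yb i) (o.yf i, o.zf i)) *
    (∏ j, Wb.prob (prot.encB o.b o.yf j) (o.yb j, o.zb j))

/-- The key. -/
def key (prot : Protocol Xf Yf Xb Yb) (o : prot.Outcome Zf Zb) : Fin prot.keySize :=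
  if prot.keyByAlice then prot.outA o.a o.yb else prot.outB o.b o.yf

/-- The estimate of the key. -/
def keyEst (prot : Protocol Xf Yf Xb Yb) (o : prot.Outcome Zf Zb) : Fin prot.keySize :=
  if prot.keyByAlice then prot.outB o.b o.yf else prot.outA o.a o.yb

/-- Eve's view: everything she receives. -/
def viewE (prot : Protocol Xf Yf Xb Yb) (o : prot.Outcome Zf Zb) :
    (prot.σ.FwdUse → Zf) × (prot.σ.BwdUse → Zb) := (o.zf, o.zb)

/-- `(R, δ)`-security: the key has rate above `R - δ` and is uniform on its range up to `δ` bits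
per channel use, the estimate is reliable, and the key is secret. -/
structure Secure (prot : Protocol Xf Yf Xb Yb) (Wf : DMBC Xf Yf Zf) (Wb : DMBC Xb Yb Zb)
    (R δ : ℝ) : Prop where
  uses_pos : 0 < prot.σ.uses
  rate : R - δ < entropy (prot.run Wf Wb) prot.key / prot.σ.uses
  uniform : Real.logb 2 prot.keySize / prot.σ.uses - δ < entropy (prot.run Wf Wb) prot.key / prot.σ.uses
  reliable : prob (prot.run Wf Wb) {o | prot.keyEst o ≠ prot.key o} < δ
  secret : 1 - δ <
    condEntropy (prot.run Wf Wb) prot.key prot.viewE / entropy (prot.run Wf Wb) prot.key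

/-- One-round key transport: there is a single round, and the key is chosen by its sender
before the start, from the sender's local randomness alone. -/
def IsOneRoundKeyTransport (prot : Protocol Xf Yf Xb Yb) : Prop :=
  prot.σ.rounds = 1 ∧ prot.keyByAlice = prot.σ.aliceFirst ∧
    (prot.keyByAlice = true → ∀ a y y', prot.outA a y = prot.outA a y') ∧
    (prot.keyByAlice = false → ∀ b y y', prot.outB b y = prot.outB b y')

end Protocol

section Bounds

variable {Xf Yf Zf Xb Yb Zb : Type*} [Fintype Xf] [Fintype Yf] [Fintype Zf]
  [Fintype Xb] [Fintype Yb] [Fintype Zb]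

/-- `R` is an achievable secret-key rate. -/
def Achievable (Wf : DMBC Xf Yf Zf) (Wb : DMBC Xb Yb Zb) (R : ℝ) : Prop :=
  0 ≤ R ∧ ∀ δ : ℝ, 0 < δ → δ ≤ 1 → ∃ prot : Protocol Xf Yf Xb Yb, prot.Secure Wf Wb R δ

/-- `C` is the secret-key capacity: the largest achievable secret-key rate. -/
def IsSecretKeyCapacity (Wf : DMBC Xf Yf Zf) (Wb : DMBC Xb Yb Zb) (C : ℝ) : Prop :=
  IsGreatest {R | Achievable Wf Wb R} C

/-- The values `max {I(Xf; Yf | Zf), I(Xb; Yb | Zb)}` over all input laws. -/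
def secretInfoValues (Wf : DMBC Xf Yf Zf) (Wb : DMBC Xb Yb Zb) : Set ℝ :=
  {r | ∃ P ∈ stdSimplex ℝ Xf, ∃ Q ∈ stdSimplex ℝ Xb, r = max (Wf.secretInfo P) (Wb.secretInfo Q)}

/-- The rates of the two-round scheme in which the party at the input of `W` sends first and the
other one answers over `W'`: the values
`(n R₁ + n' [R₂]₊) / (n + n')` with `R₁ = I(V; X) - I(V; Z)` on `W` and
`R₂ = I(W₁; Y | W₂) - I(W₁; Z | W₂)` on `W'`, where `V ↔ Y ↔ (X, Z)` on `W`,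
`W₂ ↔ W₁ ↔ X ↔ (Y, Z)` on `W'`, and `n I(V; Y | X) < n' I(W₁; Y)`.
Here `p` is the law of `(V, X, Y, Z)` on `W`, and `q` that of `(W₂, W₁, X, Y, Z)` on `W'`. -/
def twoRoundValues (W : DMBC Xf Yf Zf) (W' : DMBC Xb Yb Zb) : Set ℝ :=
  {r | ∃ (n n' k k₁ k₂ : ℕ),
    ∃ p ∈ stdSimplex ℝ (Fin k × Xf × Yf × Zf),
    ∃ q ∈ stdSimplex ℝ (Fin k₂ × Fin k₁ × Xb × Yb × Zb),
    law p (fun a => a.2) = W.joint (law p (fun a => a.2.1)) ∧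
    IsMarkov p (fun a => a.1) (fun a => a.2.2.1) (fun a => (a.2.1, a.2.2.2)) ∧
    law q (fun a => a.2.2) = W'.joint (law q (fun a => a.2.2.1)) ∧
    IsMarkov q (fun a => a.1) (fun a => a.2.1) (fun a => a.2.2.1) ∧
    IsMarkov q (fun a => (a.1, a.2.1)) (fun a => a.2.2.1) (fun a => a.2.2.2) ∧
    n * condMutualInfo p (fun a => a.1) (fun a => a.2.2.1) (fun a => a.2.1) <
      n' * mutualInfo q (fun a => a.2.1) (fun a => a.2.2.2.1) ∧
    r = (n * (mutualInfo p (fun a => a.1) (fun a => a.2.1) -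
            mutualInfo p (fun a => a.1) (fun a => a.2.2.2)) +
          n' * max 0
            (condMutualInfo q (fun a => a.2.1) (fun a => a.2.2.2.1) (fun a => a.1) -
              condMutualInfo q (fun a => a.2.1) (fun a => a.2.2.2.2) (fun a => a.1))) /
        (n + n')}

end Bounds

end TwoWaySKE

namespace TwoWaySKE

/-! The upper and lower bounds meet already at the level of one channel use. For any channel I(X;Y)
- I(X;Z) ≤ I(X;Y|Z), with defect I(X;Z|Y). On a degraded channel H(Y,Z|X) and H(Z|X) add up over the
two subchannels even when their inputs are dependent, while H(Y|Z) is subadditive. So I(X;Y|Z) is at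
most the sum of the subchannel terms, and the reversely degraded term is zero. In the other
direction, freezing X_R makes I(X;Y) - I(X;Z) at least I(X_O;Y_O|Z_O). Hence the maxima of the three
quantities agree on each channel (`DMBC.DegradedInto.exists_optimal`), and C is the larger of the
two common values.

Converse (`Achievable.le`). The law of the whole execution is compared with a reference law in which
every use has P(y,z|x) replaced by P(z|x) P(y|z), where P(y|z) comes from the actual input law of
that use. Despite the interaction, the reference law factors, for a fixed view of Eve, into a
function of what Alice holds and a function of what Bob holds (`majorantA_mul_majorantB`), so under
it the parties share no secret. Its relative entropy from the true law is exactly the sum over the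
uses of I(X;Y|Z), hence at most nC. Two applications of Gibbs' inequality and a Fano kernel turn
this into H(S|View_E) ≤ nC plus Fano terms, and δ → 0 gives R ≤ C. The only place where the order of
the rounds matters is the fact that causal stochastic kernels multiply to total mass 1
(`sum_prod_causal`).

Achievability (`exists_secure_code`). This is random wiretap coding in a single round: about 2^{n
I(X;Z)} codewords for each of about 2^{n(I(X;Y) - I(X;Z))} keys, up to a small loss of rate.
Threshold decoding is reliable, and the codewords of each key softly cover Eve's output law.
Chebyshev-type bounds suffice, because secrecy is measured relative to H(S): a leak that is linear
in n with small slope is allowed. When C = 0, a rarely chosen second key serves instead.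

The general lower bound never exceeds C by data processing, and reaches it through the scheme that
leaves the first channel unused and takes W₁ = X on the second. -/

lemma pair_def {Ω α β : Type*} (U : Ω → α) (V : Ω → β) : pair U V = fun ω => (U ω, V ω) := rfl

/-! ### Entropy calculus on finite probability spaces -/

section InfoBasics

variable {Ω : Type*} [Fintype Ω] {α β γ : Type*}

lemma law_eq_sum [DecidableEq α] (p : Ω → ℝ) (U : Ω → α) (u : α) :
    law p U u = ∑ ω, if U ω = u then p ω else 0 := by
  simp [law, prob, Set.indicator_apply]

lemma law_nonneg {p : Ω → ℝ} (hp : ∀ ω, 0 ≤ p ω) (U : Ω → α) (u : α) : 0 ≤ law p U u := by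
  classical
  rw [law_eq_sum]
  exact Finset.sum_nonneg fun ω _ => by split_ifs <;> simp [hp]

lemma le_law {p : Ω → ℝ} (hp : ∀ ω, 0 ≤ p ω) (U : Ω → α) (ω : Ω) : p ω ≤ law p U (U ω) := by
  classical
  rw [law_eq_sum]
  refine le_trans (by simp) (Finset.single_le_sum (f := fun ω' => if U ω' = U ω then p ω' else 0)
    (fun ω' _ => ?_) (Finset.mem_univ ω))
  split_ifs <;> simp [hp]

lemma law_pos {p : Ω → ℝ} (hp : ∀ ω, 0 ≤ p ω) (U : Ω → α) {ω : Ω} (h : 0 < p ω) :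
    0 < law p U (U ω) := h.trans_le (le_law hp U ω)

lemma sum_law_mul [Fintype α] (p : Ω → ℝ) (U : Ω → α) (f : α → ℝ) :
    ∑ u, law p U u * f u = ∑ ω, p ω * f (U ω) := by
  classical
  simp_rw [law_eq_sum, Finset.sum_mul]
  rw [Finset.sum_comm]
  refine Finset.sum_congr rfl fun ω _ => ?_
  simp [ite_mul]

lemma sum_law [Fintype α] (p : Ω → ℝ) (U : Ω → α) : ∑ u, law p U u = ∑ ω, p ω := by
  simpa using sum_law_mul p U (fun _ => 1)

lemma law_mem_stdSimplex [Fintype α] {p : Ω → ℝ} (hp : p ∈ stdSimplex ℝ Ω) (U : Ω → α) :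
    law p U ∈ stdSimplex ℝ α :=
  ⟨law_nonneg hp.1 U, by rw [sum_law, hp.2]⟩

lemma law_law [Fintype α] (p : Ω → ℝ) (U : Ω → α) (f : α → β) :
    law (law p U) f = law p (fun ω => f (U ω)) := by
  classical
  ext b
  rw [law_eq_sum, law_eq_sum]
  have := sum_law_mul p U (fun a => if f a = b then 1 else 0)
  simpa [mul_ite] using this

lemma law_of_injective (p : Ω → ℝ) {U : Ω → α} (hU : Function.Injective U) (ω : Ω) :
    law p U (U ω) = p ω := by
  classical
  rw [law_eq_sum]
  simp [hU.eq_iff]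

/-- The law of `U` determines and is determined by the partition that `U` induces. -/
lemma law_congr (p : Ω → ℝ) {U : Ω → α} {V : Ω → β} (ω : Ω)
    (h : ∀ ω', U ω' = U ω ↔ V ω' = V ω) : law p U (U ω) = law p V (V ω) := by
  classical
  simp_rw [law_eq_sum, h]

lemma sum_law_pair_left [Fintype α] (p : Ω → ℝ) (U : Ω → α) (V : Ω → β) (v : β) :
    ∑ u, law p (pair U V) (u, v) = law p V v := by
  classical
  simp_rw [law_eq_sum]
  rw [Finset.sum_comm]
  refine Finset.sum_congr rfl fun ω _ => ?_
  simp only [pair, Prod.mk.injEq, ite_and]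
  simp

lemma law_pair_le_left {p : Ω → ℝ} (hp : ∀ ω, 0 ≤ p ω) (U : Ω → α) (V : Ω → β) (u : α) (v : β) :
    law p (pair U V) (u, v) ≤ law p U u := by
  classical
  simp_rw [law_eq_sum]
  refine Finset.sum_le_sum fun ω _ => ?_
  simp only [pair, Prod.mk.injEq, ite_and]
  split_ifs <;> simp [hp]

lemma law_le_one {p : Ω → ℝ} (hp : p ∈ stdSimplex ℝ Ω) (U : Ω → α) (u : α) : law p U u ≤ 1 := by
  classical
  rw [law_eq_sum, ← hp.2]
  refine Finset.sum_le_sum fun ω _ => ?_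
  split_ifs <;> simp [hp.1]

lemma entropy_eq_sum [Fintype α] (p : Ω → ℝ) (U : Ω → α) :
    entropy p U = -∑ ω, p ω * Real.logb 2 (law p U (U ω)) := by
  rw [entropy, sum_law_mul p U fun u => Real.logb 2 (law p U u)]

lemma condEntropy_eq_sum [Fintype α] [Fintype β] (p : Ω → ℝ) (U : Ω → α) (V : Ω → β) :
    condEntropy p U V =
      -∑ ω, p ω * Real.logb 2 (law p (pair U V) (U ω, V ω) / law p V (V ω)) := by
  rw [condEntropy, Finset.sum_comm, ← Fintype.sum_prod_type',
    sum_law_mul p (pair U V)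
      fun a => Real.logb 2 (law p (pair U V) (a.1, a.2) / law p V a.2)]
  rfl

/-- Sums weighted by `p` may be compared on the support of `p`. -/
lemma sum_mul_congr_of_pos {p f g : Ω → ℝ} (hp : ∀ ω, 0 ≤ p ω)
    (h : ∀ ω, 0 < p ω → f ω = g ω) : ∑ ω, p ω * f ω = ∑ ω, p ω * g ω := by
  refine Finset.sum_congr rfl fun ω _ => ?_
  rcases (hp ω).eq_or_lt with h0 | h0
  · simp [← h0]
  · rw [h ω h0]

lemma sum_mul_le_of_pos {p f g : Ω → ℝ} (hp : ∀ ω, 0 ≤ p ω)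
    (h : ∀ ω, 0 < p ω → f ω ≤ g ω) : ∑ ω, p ω * f ω ≤ ∑ ω, p ω * g ω := by
  refine Finset.sum_le_sum fun ω _ => ?_
  rcases (hp ω).eq_or_lt with h0 | h0
  · simp [← h0]
  · exact mul_le_mul_of_nonneg_left (h ω h0) h0.le

/-- The chain rule `H(U | V) = H(U, V) - H(V)`. -/
lemma condEntropy_eq_sub [Fintype α] [Fintype β] {p : Ω → ℝ} (hp : ∀ ω, 0 ≤ p ω)
    (U : Ω → α) (V : Ω → β) :
    condEntropy p U V = entropy p (pair U V) - entropy p V := by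
  rw [condEntropy_eq_sum, entropy_eq_sum, entropy_eq_sum, ← sub_eq_zero]
  have : ∑ ω, p ω * Real.logb 2 (law p (pair U V) (U ω, V ω) / law p V (V ω)) =
      ∑ ω, p ω * (Real.logb 2 (law p (pair U V) (pair U V ω)) -
        Real.logb 2 (law p V (V ω))) :=
    sum_mul_congr_of_pos hp fun ω h =>
      Real.logb_div (law_pos hp (pair U V) h).ne' (law_pos hp V h).ne'
  rw [this]
  simp_rw [mul_sub, Finset.sum_sub_distrib]
  ring

lemma logb_two_le_sub_one_div {x : ℝ} (hx : 0 < x) :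
    Real.logb 2 x ≤ (x - 1) / Real.log 2 :=
  div_le_div_of_nonneg_right (Real.log_le_sub_one_of_pos hx) (Real.log_pos one_lt_two).le

/-- Gibbs' inequality: the entropy is at most every cross entropy. -/
lemma entropy_le_crossEntropy [Fintype α] {p : Ω → ℝ} (hp : p ∈ stdSimplex ℝ Ω) (U : Ω → α)
    (g : α → ℝ) (hg : ∀ u, 0 ≤ g u) (hg1 : ∑ u, g u ≤ 1) (hpos : ∀ ω, 0 < p ω → 0 < g (U ω)) :
    entropy p U ≤ -∑ ω, p ω * Real.logb 2 (g (U ω)) := by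
  have hl2 := Real.log_pos one_lt_two
  rw [entropy_eq_sum, neg_le_neg_iff, ← sub_nonpos, ← Finset.sum_sub_distrib]
  have h1 : ∑ ω, (p ω * Real.logb 2 (g (U ω)) - p ω * Real.logb 2 (law p U (U ω))) ≤
      ∑ ω, p ω * ((g (U ω) / law p U (U ω) - 1) / Real.log 2) := by
    simp_rw [← mul_sub]
    refine sum_mul_le_of_pos hp.1 fun ω h => ?_
    have hU := law_pos hp.1 U h
    rw [← Real.logb_div (hpos ω h).ne' hU.ne']
    exact logb_two_le_sub_one_div (div_pos (hpos ω h) hU)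
  refine h1.trans ?_
  rw [← sum_law_mul p U fun u => (g u / law p U u - 1) / Real.log 2]
  have h2 : ∑ u, law p U u * ((g u / law p U u - 1) / Real.log 2) ≤
      ∑ u, (g u - law p U u) / Real.log 2 := by
    refine Finset.sum_le_sum fun u _ => ?_
    rw [← mul_div_assoc]
    refine div_le_div_of_nonneg_right ?_ hl2.le
    rcases (law_nonneg hp.1 U u).eq_or_lt with h0 | h0
    · simp [← h0, hg u]
    · rw [mul_sub, mul_div_cancel₀ _ h0.ne', mul_one]
  refine h2.trans ?_
  rw [← Finset.sum_div, Finset.sum_sub_distrib, sum_law, hp.2]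
  exact div_nonpos_of_nonpos_of_nonneg (by linarith) hl2.le

lemma entropy_congr [Fintype α] [Fintype β] (p : Ω → ℝ) {U : Ω → α} {V : Ω → β}
    (h : ∀ ω ω', U ω' = U ω ↔ V ω' = V ω) : entropy p U = entropy p V := by
  rw [entropy_eq_sum, entropy_eq_sum]
  simp_rw [law_congr p _ (h _)]

lemma entropy_map [Fintype α] [Fintype β] (p : Ω → ℝ) (U : Ω → α) (f : α → β) :
    entropy (law p U) f = entropy p (fun ω => f (U ω)) := by
  simp_rw [entropy, law_law]

lemma entropy_nonneg [Fintype α] {p : Ω → ℝ} (hp : p ∈ stdSimplex ℝ Ω) (U : Ω → α) :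
    0 ≤ entropy p U := by
  rw [entropy, neg_nonneg]
  refine Finset.sum_nonpos fun u _ => mul_nonpos_of_nonneg_of_nonpos (law_nonneg hp.1 U u) ?_
  exact Real.logb_nonpos one_lt_two (law_nonneg hp.1 U u) (law_le_one hp U u)

lemma entropy_le_pair [Fintype α] [Fintype β] {p : Ω → ℝ} (hp : ∀ ω, 0 ≤ p ω)
    (U : Ω → α) (V : Ω → β) : entropy p U ≤ entropy p (pair U V) := by
  rw [entropy_eq_sum, entropy_eq_sum, neg_le_neg_iff]
  refine sum_mul_le_of_pos hp fun ω h => ?_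
  exact Real.logb_le_logb_of_le one_lt_two (law_pos hp (pair U V) h) (law_pair_le_left hp U V _ _)

lemma entropy_pair_comm [Fintype α] [Fintype β] (p : Ω → ℝ) (U : Ω → α) (V : Ω → β) :
    entropy p (pair U V) = entropy p (pair V U) :=
  entropy_congr p fun ω ω' => by simp [pair, and_comm]

/-- Submodularity of entropy, i.e. `0 ≤ I(U; V | W)`. -/
lemma entropy_submodular [Fintype α] [Fintype β] [Fintype γ] {p : Ω → ℝ}
    (hp : p ∈ stdSimplex ℝ Ω) (U : Ω → α) (V : Ω → β) (W : Ω → γ) :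
    entropy p (pair U (pair V W)) + entropy p W ≤
      entropy p (pair U W) + entropy p (pair V W) := by
  -- Gibbs' inequality against P(u|w) P(v,w), the law with the same marginals on (U,W) and (V,W)
  -- that makes U and V independent given W.
  have key := entropy_le_crossEntropy hp (pair U (pair V W))
    (fun a => law p (pair U W) (a.1, a.2.2) * law p (pair V W) (a.2.1, a.2.2) / law p W a.2.2)
    (fun a => div_nonneg (mul_nonneg (law_nonneg hp.1 _ _) (law_nonneg hp.1 _ _))
      (law_nonneg hp.1 _ _)) ?_
    (fun ω h => div_pos (mul_pos (law_pos hp.1 (pair U W) h) (law_pos hp.1 (pair V W) h))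
      (law_pos hp.1 W h))
  · have e : ∑ ω, p ω * Real.logb 2 (law p (pair U W) (U ω, W ω) * law p (pair V W) (V ω, W ω) /
        law p W (W ω)) = ∑ ω, p ω * (Real.logb 2 (law p (pair U W) (pair U W ω)) +
          Real.logb 2 (law p (pair V W) (pair V W ω)) - Real.logb 2 (law p W (W ω))) := by
      refine sum_mul_congr_of_pos hp.1 fun ω h => ?_
      have h1 := (law_pos hp.1 (pair U W) h).ne'
      have h2 := (law_pos hp.1 (pair V W) h).ne'
      change Real.logb 2 (law p (pair U W) (pair U W ω) * law p (pair V W) (pair V W ω) / _) = _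
      rw [Real.logb_div (mul_ne_zero h1 h2) (law_pos hp.1 W h).ne', Real.logb_mul h1 h2]
    simp only [pair] at key e
    rw [e] at key
    simp_rw [mul_sub, mul_add, Finset.sum_sub_distrib, Finset.sum_add_distrib] at key
    rw [entropy_eq_sum p W, entropy_eq_sum p (pair U W), entropy_eq_sum p (pair V W)]
    simp only [pair] at key ⊢
    linarith
  · rw [Fintype.sum_prod_type]
    simp_rw [Fintype.sum_prod_type_right]
    have : ∀ w, ∑ u, ∑ v, law p (pair U W) (u, w) * law p (pair V W) (v, w) / law p W w ≤
        law p W w := by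
      intro w
      simp_rw [← Finset.sum_div, ← Finset.mul_sum, ← Finset.sum_mul, sum_law_pair_left]
      rcases eq_or_ne (law p W w) 0 with h | h
      · simp [h]
      · rw [mul_div_assoc, div_self h, mul_one]
    calc _ = ∑ w, ∑ u, ∑ v, law p (pair U W) (u, w) * law p (pair V W) (v, w) / law p W w := by
          rw [Finset.sum_comm]
      _ ≤ ∑ w, law p W w := Finset.sum_le_sum fun w _ => this w
      _ = 1 := by rw [sum_law, hp.2]

/-- Subadditivity of entropy, i.e. `0 ≤ I(U; V)`. -/
lemma entropy_pair_le [Fintype α] [Fintype β] {p : Ω → ℝ}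
    (hp : p ∈ stdSimplex ℝ Ω) (U : Ω → α) (V : Ω → β) :
    entropy p (pair U V) ≤ entropy p U + entropy p V := by
  have h := entropy_submodular hp U V (fun _ => ())
  have h0 : entropy p (fun _ : Ω => ()) = 0 := by
    rw [entropy_eq_sum]
    have : law p (fun _ : Ω => ()) () = 1 := by rw [law_eq_sum]; simpa using hp.2
    simp [this]
  rw [h0, entropy_congr p (U := pair U (pair V fun _ => ())) (V := pair U V) (by simp [pair]),
    entropy_congr p (U := pair U fun _ => ()) (V := U) (by simp [pair]),
    entropy_congr p (U := pair V fun _ => ()) (V := V) (by simp [pair])] at h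
  linarith

/-- A Markov chain `U ↔ V ↔ W` satisfies `I(U; W | V) = 0`. -/
lemma IsMarkov.entropy_eq [Fintype α] [Fintype β] [Fintype γ] {p : Ω → ℝ}
    (hp : ∀ ω, 0 ≤ p ω) {U : Ω → α} {V : Ω → β} {W : Ω → γ} (h : IsMarkov p U V W) :
    entropy p (pair U (pair V W)) + entropy p V =
      entropy p (pair U V) + entropy p (pair V W) := by
  simp_rw [entropy_eq_sum]
  rw [← neg_add, ← neg_add, neg_inj, ← Finset.sum_add_distrib, ← Finset.sum_add_distrib]
  simp_rw [← mul_add]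
  refine sum_mul_congr_of_pos hp fun ω hω => ?_
  have h1 := (law_pos hp (pair U (pair V W)) hω).ne'
  have h2 := (law_pos hp V hω).ne'
  have h3 := (law_pos hp (pair U V) hω).ne'
  have h4 := (law_pos hp (pair V W) hω).ne'
  rw [← Real.logb_mul h1 h2, ← Real.logb_mul h3 h4]
  exact congrArg _ (h (U ω) (V ω) (W ω))

lemma mutualInfo_eq [Fintype α] [Fintype β] {p : Ω → ℝ} (hp : ∀ ω, 0 ≤ p ω)
    (U : Ω → α) (V : Ω → β) :
    mutualInfo p U V = entropy p U + entropy p V - entropy p (pair U V) := by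
  rw [mutualInfo, condEntropy_eq_sub hp]; ring

lemma condMutualInfo_eq [Fintype α] [Fintype β] [Fintype γ] {p : Ω → ℝ} (hp : ∀ ω, 0 ≤ p ω)
    (U : Ω → α) (V : Ω → β) (W : Ω → γ) :
    condMutualInfo p U V W = entropy p (pair U W) + entropy p (pair V W) - entropy p W -
      entropy p (pair U (pair V W)) := by
  rw [condMutualInfo, condEntropy_eq_sub hp, condEntropy_eq_sub hp]; ring

lemma entropy_eq_zero_of_const [Fintype α] {p : Ω → ℝ}
    (hp : p ∈ stdSimplex ℝ Ω) {U : Ω → α} {u : α} (h : ∀ ω, 0 < p ω → U ω = u) :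
    entropy p U = 0 := by
  classical
  have h1 : law p U u = 1 := by
    rw [law_eq_sum, ← hp.2]
    refine Finset.sum_congr rfl fun ω _ => ?_
    rcases (hp.1 ω).eq_or_lt with h0 | h0
    · simp [← h0]
    · simp [h ω h0]
  rw [entropy_eq_sum, neg_eq_zero]
  refine (sum_mul_congr_of_pos hp.1 (g := fun _ => 0) fun ω hω => ?_).trans (by simp)
  rw [h ω hω, h1, Real.logb_one]

end InfoBasics

end TwoWaySKE
-- Single-letter quantities of broadcast channels and of their subchannels
namespace TwoWaySKE

namespace DMBC

section Transition

variable {X Y Z : Type*} [Fintype Y] [Fintype Z]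

/-- The transition probabilities of Eve's output. -/
def eve (W : DMBC X Y Z) (x : X) (z : Z) : ℝ := ∑ y, W.prob x (y, z)

/-- The transition probabilities of the legitimate output. -/
def legit (W : DMBC X Y Z) (x : X) (y : Y) : ℝ := ∑ z, W.prob x (y, z)

lemma prob_nonneg (W : DMBC X Y Z) (x : X) (b : Y × Z) : 0 ≤ W.prob x b := (W.prob_mem x).1 b

lemma sum_prob (W : DMBC X Y Z) (x : X) : ∑ b, W.prob x b = 1 := (W.prob_mem x).2

lemma nonempty_outputs [Nonempty X] (W : DMBC X Y Z) : Nonempty (Y × Z) := by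
  by_contra h
  rw [not_nonempty_iff] at h
  simpa using W.sum_prob (Classical.arbitrary X)

lemma eve_nonneg (W : DMBC X Y Z) (x : X) (z : Z) : 0 ≤ W.eve x z :=
  Finset.sum_nonneg fun _ _ => W.prob_nonneg _ _

lemma legit_nonneg (W : DMBC X Y Z) (x : X) (y : Y) : 0 ≤ W.legit x y :=
  Finset.sum_nonneg fun _ _ => W.prob_nonneg _ _

lemma sum_eve (W : DMBC X Y Z) (x : X) : ∑ z, W.eve x z = 1 := by
  rw [← W.sum_prob x, Fintype.sum_prod_type_right]; rfl

lemma sum_legit (W : DMBC X Y Z) (x : X) : ∑ y, W.legit x y = 1 := by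
  rw [← W.sum_prob x, Fintype.sum_prod_type]; rfl

lemma prob_le_eve (W : DMBC X Y Z) (x : X) (y : Y) (z : Z) : W.prob x (y, z) ≤ W.eve x z :=
  Finset.single_le_sum (f := fun y => W.prob x (y, z)) (fun _ _ => W.prob_nonneg _ _)
    (Finset.mem_univ y)

lemma joint_nonneg (W : DMBC X Y Z) {P : X → ℝ} (hP : ∀ x, 0 ≤ P x) (a : X × Y × Z) :
    0 ≤ W.joint P a := mul_nonneg (hP _) (W.prob_nonneg _ _)

lemma joint_pos_left (W : DMBC X Y Z) {P : X → ℝ} (hP : ∀ x, 0 ≤ P x) {a : X × Y × Z}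
    (h : 0 < W.joint P a) : 0 < P a.1 :=
  (hP _).lt_of_ne' fun h' => by simp [joint, h'] at h

lemma joint_pos_right (W : DMBC X Y Z) {P : X → ℝ} {a : X × Y × Z}
    (h : 0 < W.joint P a) : 0 < W.prob a.1 a.2 :=
  (W.prob_nonneg _ _).lt_of_ne' fun h' => by simp [joint, h'] at h

end Transition

section Joint

variable {X Y Z : Type*} [Fintype X] [Fintype Y] [Fintype Z]

lemma sum_joint_mul (W : DMBC X Y Z) (P : X → ℝ) (f : X × Y × Z → ℝ) :
    ∑ a, W.joint P a * f a = ∑ x, P x * ∑ b, W.prob x b * f (x, b) := by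
  rw [Fintype.sum_prod_type]
  simp_rw [joint, Finset.mul_sum, mul_assoc]

lemma joint_mem (W : DMBC X Y Z) {P : X → ℝ} (hP : P ∈ stdSimplex ℝ X) :
    W.joint P ∈ stdSimplex ℝ (X × Y × Z) := by
  refine ⟨W.joint_nonneg hP.1, ?_⟩
  have := W.sum_joint_mul P (fun _ => 1)
  simpa [W.sum_prob, hP.2] using this

lemma law_joint_fst (W : DMBC X Y Z) (P : X → ℝ) : law (W.joint P) (fun a => a.1) = P := by
  classical
  ext x
  rw [law_eq_sum]
  have := W.sum_joint_mul P (fun a => if a.1 = x then 1 else 0)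
  simpa [mul_ite, ← Finset.sum_mul, W.sum_prob] using this

lemma law_joint_eve (W : DMBC X Y Z) (P : X → ℝ) (x : X) (z : Z) :
    law (W.joint P) (pair (fun a => a.1) (fun a => a.2.2)) (x, z) = P x * W.eve x z := by
  classical
  rw [law_eq_sum]
  have := W.sum_joint_mul P (fun a => if (a.1, a.2.2) = (x, z) then 1 else 0)
  simp only [Prod.mk.injEq, mul_ite, mul_one, mul_zero, ite_and, Fintype.sum_prod_type] at this
  simpa [pair, ite_and, Fintype.sum_prod_type, eve] using this

lemma law_joint_legit (W : DMBC X Y Z) (P : X → ℝ) (x : X) (y : Y) :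
    law (W.joint P) (pair (fun a => a.1) (fun a => a.2.1)) (x, y) = P x * W.legit x y := by
  classical
  have : law (W.joint P) (pair (fun a => a.1) (fun a => a.2.1)) (x, y) =
      ∑ a, W.joint P a * (if (a.1, a.2.1) = (x, y) then 1 else 0) := by
    rw [law_eq_sum]; simp [pair]
  rw [this, sum_joint_mul, Finset.sum_eq_single x, Fintype.sum_prod_type_right]
  · simp [legit]
  · intro x' _ hx
    simp [hx]
  · simp

lemma secretInfo_eq (W : DMBC X Y Z) {P : X → ℝ} (hP : ∀ x, 0 ≤ P x) :
    W.secretInfo P = entropy (W.joint P) (pair (fun a => a.1) (fun a => a.2.2)) +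
      entropy (W.joint P) (pair (fun a => a.2.1) (fun a => a.2.2)) -
      entropy (W.joint P) (fun a => a.2.2) -
      entropy (W.joint P) (pair (fun a => a.1) (pair (fun a => a.2.1) (fun a => a.2.2))) :=
  condMutualInfo_eq (W.joint_nonneg hP) _ _ _

lemma secretInfo_nonneg (W : DMBC X Y Z) {P : X → ℝ} (hP : P ∈ stdSimplex ℝ X) :
    0 ≤ W.secretInfo P := by
  rw [W.secretInfo_eq hP.1]
  have := entropy_submodular (W.joint_mem hP) (fun a => a.1) (fun a => a.2.1) (fun a => a.2.2)
  linarith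

/-- The two expansions of I(X;Y,Z) by the chain rule show that the difference of the two sides is
I(X;Z|Y). -/
lemma mutualInfo_sub_le_secretInfo (W : DMBC X Y Z) {P : X → ℝ} (hP : P ∈ stdSimplex ℝ X) :
    mutualInfo (W.joint P) (fun a => a.1) (fun a => a.2.1) -
      mutualInfo (W.joint P) (fun a => a.1) (fun a => a.2.2) ≤ W.secretInfo P := by
  have hp := W.joint_mem hP
  rw [W.secretInfo_eq hP.1, mutualInfo_eq hp.1, mutualInfo_eq hp.1]
  have h := entropy_submodular hp (fun a => a.1) (fun a => a.2.2) (fun a => a.2.1)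
  rw [entropy_congr (W.joint P)
      (U := pair (fun a => a.1) (pair (fun a => a.2.2) (fun a => a.2.1)))
      (V := pair (fun a => a.1) (pair (fun a => a.2.1) (fun a => a.2.2)))
      (by intro ω ω'; simp only [pair, Prod.ext_iff]; tauto),
    entropy_pair_comm (W.joint P) (fun a => a.2.2) (fun a => a.2.1)] at h
  linarith

lemma continuous_law_joint {α : Type*} (W : DMBC X Y Z) (U : X × Y × Z → α) (u : α) :
    Continuous fun P => law (W.joint P) U u := by
  classical
  simp_rw [law_eq_sum, joint]
  refine continuous_finsetSum _ fun a _ => ?_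
  split_ifs <;> fun_prop

/-- `Real.negMulLog` is continuous at 0 as well, so no positivity of the masses is needed. With
compactness of the simplex this makes the maxima attained. -/
lemma continuous_entropy_joint {α : Type*} [Fintype α] (W : DMBC X Y Z) (U : X × Y × Z → α) :
    Continuous fun P => entropy (W.joint P) U := by
  have : ∀ P, entropy (W.joint P) U =
      (∑ u, Real.negMulLog (law (W.joint P) U u)) / Real.log 2 := by
    intro P
    rw [entropy, Finset.sum_div, ← Finset.sum_neg_distrib]
    refine Finset.sum_congr rfl fun u _ => ?_
    rw [Real.negMulLog, Real.logb]; ring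
  simp_rw [this]
  refine Continuous.div_const (continuous_finsetSum _ fun u _ => ?_) _
  exact Real.continuous_negMulLog.comp (W.continuous_law_joint U u)

lemma exists_isMaxOn_secretInfo [Nonempty X] (W : DMBC X Y Z) :
    ∃ P ∈ stdSimplex ℝ X, ∀ Q ∈ stdSimplex ℝ X, W.secretInfo Q ≤ W.secretInfo P := by
  have hne : (stdSimplex ℝ X).Nonempty := by
    classical
    exact ⟨_, single_mem_stdSimplex ℝ (Classical.arbitrary X)⟩
  have hc : ContinuousOn W.secretInfo (stdSimplex ℝ X) := by
    refine ContinuousOn.congr (Continuous.continuousOn ?_) fun P hP => W.secretInfo_eq hP.1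
    exact (((W.continuous_entropy_joint _).add (W.continuous_entropy_joint _)).sub
      (W.continuous_entropy_joint _)).sub (W.continuous_entropy_joint _)
  exact (isCompact_stdSimplex ℝ X).exists_isMaxOn hne hc

lemma ReverselyDegraded.secretInfo_eq_zero {W : DMBC X Y Z} (h : W.ReverselyDegraded) {P : X → ℝ}
    (hP : P ∈ stdSimplex ℝ X) : W.secretInfo P = 0 := by
  have hp := (W.joint_mem hP).1
  rw [W.secretInfo_eq hP.1]
  have h := (h P hP).entropy_eq hp
  rw [entropy_congr (W.joint P)
      (U := pair (fun a => a.1) (pair (fun a => a.2.2) (fun a => a.2.1)))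
      (V := pair (fun a => a.1) (pair (fun a => a.2.1) (fun a => a.2.2)))
      (by intro ω ω'; simp only [pair, Prod.ext_iff]; tauto),
    entropy_pair_comm (W.joint P) (fun a => a.2.2) (fun a => a.2.1)] at h
  linarith

/-- Here I(X;Z|Y) = 0, so I(X;Y|Z) equals I(X;Y) - I(X;Z), written as H(X|Z) - H(X|Y). -/
lemma ObverselyDegraded.secretInfo_eq_sub {W : DMBC X Y Z} (h : W.ObverselyDegraded) {P : X → ℝ}
    (hP : P ∈ stdSimplex ℝ X) :
    W.secretInfo P = entropy (W.joint P) (pair (fun a => a.1) (fun a => a.2.2)) -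
      entropy (W.joint P) (fun a => a.2.2) + entropy (W.joint P) (fun a => a.2.1) -
      entropy (W.joint P) (pair (fun a => a.1) (fun a => a.2.1)) := by
  rw [W.secretInfo_eq hP.1]
  linarith [(h P hP).entropy_eq (W.joint_mem hP).1]

/-- This is H(Y,Z|X) as the mean of -log P(y,z|x). In this form it is visibly additive when the
transition probabilities factor. -/
lemma entropy_joint_sub (W : DMBC X Y Z) {P : X → ℝ} (hP : P ∈ stdSimplex ℝ X) :
    entropy (W.joint P) (pair (fun a => a.1) (pair (fun a => a.2.1) (fun a => a.2.2))) -
      entropy (W.joint P) (fun a => a.1) =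
        -∑ a, W.joint P a * Real.logb 2 (W.prob a.1 a.2) := by
  have hp := (W.joint_mem hP).1
  rw [entropy_eq_sum, entropy_eq_sum, neg_sub_neg, ← neg_sub, neg_inj, ← Finset.sum_sub_distrib]
  simp_rw [← mul_sub, law_joint_fst]
  refine sum_mul_congr_of_pos hp fun a ha => ?_
  rw [law_of_injective (W.joint P)
    (U := pair (fun a => a.1) (pair (fun a => a.2.1) (fun a => a.2.2))) (fun a b hab => hab) a,
    joint, Real.logb_mul (W.joint_pos_left hP.1 ha).ne' (W.joint_pos_right ha).ne']
  ring

lemma entropy_joint_eve_sub (W : DMBC X Y Z) {P : X → ℝ} (hP : P ∈ stdSimplex ℝ X) :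
    entropy (W.joint P) (pair (fun a => a.1) (fun a => a.2.2)) -
      entropy (W.joint P) (fun a => a.1) =
        -∑ a, W.joint P a * Real.logb 2 (W.eve a.1 a.2.2) := by
  have hp := (W.joint_mem hP).1
  rw [entropy_eq_sum, entropy_eq_sum, neg_sub_neg, ← neg_sub, neg_inj, ← Finset.sum_sub_distrib]
  simp_rw [← mul_sub, law_joint_fst]
  refine sum_mul_congr_of_pos hp fun a ha => ?_
  have h2 := (W.joint_pos_right ha).trans_le (W.prob_le_eve a.1 a.2.1 a.2.2)
  rw [show pair (fun a : X × Y × Z => a.1) (fun a => a.2.2) a = (a.1, a.2.2) from rfl,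
    law_joint_eve, Real.logb_mul (W.joint_pos_left hP.1 ha).ne' h2.ne']
  ring

end Joint

section Subchannels

variable {X Y Z XO YO ZO XR YR ZR : Type*}
  [Fintype Y] [Fintype Z] [Fintype YO] [Fintype ZO] [Fintype YR] [Fintype ZR]
  {W : DMBC X Y Z} {WO : DMBC XO YO ZO} {WR : DMBC XR YR ZR}
  {eX : X ≃ XO × XR} {eY : Y ≃ YO × YR} {eZ : Z ≃ ZO × ZR}

lemma sum_prob_mul_of_subchannels
    (h : ∀ x y z, W.prob x (y, z) =
      WO.prob (eX x).1 ((eY y).1, (eZ z).1) * WR.prob (eX x).2 ((eY y).2, (eZ z).2))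
    (x : X) (F : YO × ZO → ℝ) (G : YR × ZR → ℝ) :
    ∑ b, W.prob x b * (F ((eY b.1).1, (eZ b.2).1) * G ((eY b.1).2, (eZ b.2).2)) =
      (∑ b, WO.prob (eX x).1 b * F b) * ∑ b, WR.prob (eX x).2 b * G b := by
  rw [Finset.sum_mul_sum, ← Fintype.sum_prod_type']
  refine Fintype.sum_equiv ((eY.prodCongr eZ).trans (Equiv.prodProdProdComm _ _ _ _)) _ _ ?_
  rintro ⟨y, z⟩
  rw [h]
  simp
  ring

lemma eve_of_subchannels
    (h : ∀ x y z, W.prob x (y, z) =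
      WO.prob (eX x).1 ((eY y).1, (eZ z).1) * WR.prob (eX x).2 ((eY y).2, (eZ z).2))
    (x : X) (z : Z) :
    W.eve x z = WO.eve (eX x).1 (eZ z).1 * WR.eve (eX x).2 (eZ z).2 := by
  simp_rw [eve, Finset.sum_mul_sum, ← Fintype.sum_prod_type', h]
  exact Fintype.sum_equiv eY _ _ fun y => rfl

variable [Fintype X]

/-- The outputs of the other subchannel sum to 1 whatever X_R is, so the obverse triple sees only
the marginal of X_O. Dependence between X_O and X_R does no harm. -/
lemma law_joint_obverse
    (h : ∀ x y z, W.prob x (y, z) =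
      WO.prob (eX x).1 ((eY y).1, (eZ z).1) * WR.prob (eX x).2 ((eY y).2, (eZ z).2))
    (P : X → ℝ) :
    law (W.joint P) (fun a => ((eX a.1).1, (eY a.2.1).1, (eZ a.2.2).1)) =
      WO.joint (law P fun x => (eX x).1) := by
  classical
  ext ⟨x', y', z'⟩
  rw [law_eq_sum]
  have := W.sum_joint_mul P
    (fun a => if ((eX a.1).1, (eY a.2.1).1, (eZ a.2.2).1) = (x', y', z') then 1 else 0)
  simp only [mul_ite, mul_one, mul_zero] at this
  rw [this, joint, law_eq_sum, Finset.sum_mul]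
  refine Finset.sum_congr rfl fun x _ => ?_
  have h2 := sum_prob_mul_of_subchannels h x (fun b => if b = (y', z') then 1 else 0) (fun _ => 1)
  simp only [mul_one, WR.sum_prob, mul_ite, mul_zero] at h2
  by_cases hx : (eX x).1 = x'
  · subst hx
    simpa using congrArg (P x * ·) h2
  · simp [hx]

lemma law_joint_reverse
    (h : ∀ x y z, W.prob x (y, z) =
      WO.prob (eX x).1 ((eY y).1, (eZ z).1) * WR.prob (eX x).2 ((eY y).2, (eZ z).2))
    (P : X → ℝ) :
    law (W.joint P) (fun a => ((eX a.1).2, (eY a.2.1).2, (eZ a.2.2).2)) =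
      WR.joint (law P fun x => (eX x).2) :=
  law_joint_obverse (WO := WR) (WR := WO) (eX := eX.trans (Equiv.prodComm _ _))
    (eY := eY.trans (Equiv.prodComm _ _)) (eZ := eZ.trans (Equiv.prodComm _ _))
    (fun x y z => by rw [h, mul_comm]; rfl) P

variable [Fintype XO] [Fintype XR]

omit [Fintype XR] in
lemma entropy_joint_obverse {α : Type*} [Fintype α]
    (h : ∀ x y z, W.prob x (y, z) =
      WO.prob (eX x).1 ((eY y).1, (eZ z).1) * WR.prob (eX x).2 ((eY y).2, (eZ z).2))
    (P : X → ℝ) (f : XO × YO × ZO → α) :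
    entropy (WO.joint (law P fun x => (eX x).1)) f =
      entropy (W.joint P) fun a => f ((eX a.1).1, (eY a.2.1).1, (eZ a.2.2).1) := by
  rw [← law_joint_obverse h, entropy_map]

omit [Fintype XO] in
lemma entropy_joint_reverse {α : Type*} [Fintype α]
    (h : ∀ x y z, W.prob x (y, z) =
      WO.prob (eX x).1 ((eY y).1, (eZ z).1) * WR.prob (eX x).2 ((eY y).2, (eZ z).2))
    (P : X → ℝ) (f : XR × YR × ZR → α) :
    entropy (WR.joint (law P fun x => (eX x).2)) f =
      entropy (W.joint P) fun a => f ((eX a.1).2, (eY a.2.1).2, (eZ a.2.2).2) := by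
  rw [← law_joint_reverse h, entropy_map]

/-- Given X the two output pairs are independent, so H(Y,Z|X) splits exactly, for dependent
subchannel inputs too. -/
lemma entropy_joint_sub_of_subchannels
    (h : ∀ x y z, W.prob x (y, z) =
      WO.prob (eX x).1 ((eY y).1, (eZ z).1) * WR.prob (eX x).2 ((eY y).2, (eZ z).2))
    {P : X → ℝ} (hP : P ∈ stdSimplex ℝ X) :
    entropy (W.joint P) (pair (fun a => a.1) (pair (fun a => a.2.1) (fun a => a.2.2))) -
        entropy (W.joint P) (fun a => a.1) =
      (entropy (WO.joint (law P fun x => (eX x).1))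
          (pair (fun a => a.1) (pair (fun a => a.2.1) (fun a => a.2.2))) -
        entropy (WO.joint (law P fun x => (eX x).1)) (fun a => a.1)) +
      (entropy (WR.joint (law P fun x => (eX x).2))
          (pair (fun a => a.1) (pair (fun a => a.2.1) (fun a => a.2.2))) -
        entropy (WR.joint (law P fun x => (eX x).2)) (fun a => a.1)) := by
  rw [W.entropy_joint_sub hP, WO.entropy_joint_sub (law_mem_stdSimplex hP _),
    WR.entropy_joint_sub (law_mem_stdSimplex hP _), ← law_joint_obverse h, ← law_joint_reverse h,
    sum_law_mul _ _ fun a : XO × YO × ZO => Real.logb 2 (WO.prob a.1 a.2),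
    sum_law_mul _ _ fun a : XR × YR × ZR => Real.logb 2 (WR.prob a.1 a.2),
    ← neg_add, neg_inj, ← Finset.sum_add_distrib]
  simp_rw [← mul_add]
  refine sum_mul_congr_of_pos (W.joint_mem hP).1 fun a ha => ?_
  have h0 := (W.joint_pos_right ha).ne'
  rw [show a.2 = (a.2.1, a.2.2) from rfl, h] at h0
  rw [show a.2 = (a.2.1, a.2.2) from rfl, h, Real.logb_mul (left_ne_zero_of_mul h0)
    (right_ne_zero_of_mul h0)]

lemma entropy_joint_eve_sub_of_subchannels
    (h : ∀ x y z, W.prob x (y, z) =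
      WO.prob (eX x).1 ((eY y).1, (eZ z).1) * WR.prob (eX x).2 ((eY y).2, (eZ z).2))
    {P : X → ℝ} (hP : P ∈ stdSimplex ℝ X) :
    entropy (W.joint P) (pair (fun a => a.1) (fun a => a.2.2)) -
        entropy (W.joint P) (fun a => a.1) =
      (entropy (WO.joint (law P fun x => (eX x).1)) (pair (fun a => a.1) (fun a => a.2.2)) -
        entropy (WO.joint (law P fun x => (eX x).1)) (fun a => a.1)) +
      (entropy (WR.joint (law P fun x => (eX x).2)) (pair (fun a => a.1) (fun a => a.2.2)) -
        entropy (WR.joint (law P fun x => (eX x).2)) (fun a => a.1)) := by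
  rw [W.entropy_joint_eve_sub hP, WO.entropy_joint_eve_sub (law_mem_stdSimplex hP _),
    WR.entropy_joint_eve_sub (law_mem_stdSimplex hP _), ← law_joint_obverse h,
    ← law_joint_reverse h,
    sum_law_mul _ _ fun a : XO × YO × ZO => Real.logb 2 (WO.eve a.1 a.2.2),
    sum_law_mul _ _ fun a : XR × YR × ZR => Real.logb 2 (WR.eve a.1 a.2.2),
    ← neg_add, neg_inj, ← Finset.sum_add_distrib]
  simp_rw [← mul_add]
  refine sum_mul_congr_of_pos (W.joint_mem hP).1 fun a ha => ?_
  have h0 := ((W.joint_pos_right ha).trans_le (W.prob_le_eve a.1 a.2.1 a.2.2)).ne'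
  rw [eve_of_subchannels h] at h0
  rw [eve_of_subchannels h, Real.logb_mul (left_ne_zero_of_mul h0) (right_ne_zero_of_mul h0)]

/-- Only the obversely degraded part contributes to `I(X; Y | Z)`. -/
lemma DegradedInto.exists_secretInfo_le (h : W.DegradedInto WO WR) {P : X → ℝ}
    (hP : P ∈ stdSimplex ℝ X) : ∃ PO ∈ stdSimplex ℝ XO, W.secretInfo P ≤ WO.secretInfo PO := by
  obtain ⟨⟨eX, eY, eZ, h⟩, -, hR⟩ := h
  have hO := law_mem_stdSimplex hP fun x => (eX x).1
  have hR' := law_mem_stdSimplex hP fun x => (eX x).2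
  refine ⟨_, hO, ?_⟩
  have h0 := hR.secretInfo_eq_zero hR'
  have e1 := entropy_joint_sub_of_subchannels h hP
  have e2 := entropy_joint_eve_sub_of_subchannels h hP
  have hp := W.joint_mem hP
  rw [WR.secretInfo_eq hR'.1] at h0
  rw [W.secretInfo_eq hP.1, WO.secretInfo_eq hO.1]
  -- Together `s1` and `s2` say H(Y|Z) ≤ H(Y_O|Z_O) + H(Y_R|Z_R), through I(Y_O;Y_R,Z_R|Z_O) ≥ 0 and
  -- I(Y_R;Z_O|Z_R) ≥ 0. The term H(Y|X,Z) splits exactly by `e1` and `e2`.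
  have s1 := entropy_submodular hp (fun a => (eY a.2.1).1)
    (pair (fun a => (eY a.2.1).2) (fun a => (eZ a.2.2).2)) (fun a => (eZ a.2.2).1)
  have s2 := entropy_submodular hp (fun a => (eY a.2.1).2) (fun a => (eZ a.2.2).1)
    (fun a => (eZ a.2.2).2)
  have o1 := entropy_joint_obverse h P (pair (fun a => a.2.1) (fun a => a.2.2))
  have o2 := entropy_joint_obverse h P (fun a => a.2.2)
  have r1 := entropy_joint_reverse h P (pair (fun a => a.2.1) (fun a => a.2.2))
  have r2 := entropy_joint_reverse h P (fun a => a.2.2)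
  have c1 : entropy (W.joint P) (pair (fun a => a.2.1) (fun a => a.2.2)) =
      entropy (W.joint P) (pair (fun a => (eY a.2.1).1) (pair (pair (fun a => (eY a.2.1).2)
        (fun a => (eZ a.2.2).2)) (fun a => (eZ a.2.2).1))) :=
    entropy_congr _ fun ω ω' => by
      simp only [pair, ← eY.apply_eq_iff_eq, ← eZ.apply_eq_iff_eq, Prod.ext_iff]
      tauto
  have c2 : entropy (W.joint P) (fun a => a.2.2) =
      entropy (W.joint P) (pair (fun a => (eZ a.2.2).1) (fun a => (eZ a.2.2).2)) :=
    entropy_congr _ fun ω ω' => by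
      simp only [pair, ← eZ.apply_eq_iff_eq, Prod.ext_iff]
  have c3 : entropy (W.joint P) (pair (fun a => (eY a.2.1).2) (pair (fun a => (eZ a.2.2).1)
        (fun a => (eZ a.2.2).2))) = entropy (W.joint P) (pair (pair (fun a => (eY a.2.1).2)
        (fun a => (eZ a.2.2).2)) (fun a => (eZ a.2.2).1)) :=
    entropy_congr _ fun ω ω' => by
      simp only [pair, Prod.mk.injEq]
      tauto
  simp only [pair_def] at *
  linarith

/-- With the input of the reversely degraded part frozen, `I(X; Y) - I(X; Z)` reaches the
`I(XO; YO | ZO)` of the obversely degraded part. -/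
lemma DegradedInto.exists_secretInfo_le_mutualInfo_sub [Nonempty X] (h : W.DegradedInto WO WR)
    {PO : XO → ℝ} (hPO : PO ∈ stdSimplex ℝ XO) :
    ∃ P ∈ stdSimplex ℝ X, WO.secretInfo PO ≤
      mutualInfo (W.joint P) (fun a => a.1) (fun a => a.2.1) -
        mutualInfo (W.joint P) (fun a => a.1) (fun a => a.2.2) := by
  classical
  obtain ⟨⟨eX, eY, eZ, h⟩, hobv, -⟩ := h
  let xr : XR := (eX (Classical.arbitrary X)).2
  let P : X → ℝ := fun x => PO (eX x).1 * if (eX x).2 = xr then 1 else 0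
  have hsum : ∀ f : XO → ℝ, ∑ x, P x * f (eX x).1 = ∑ xo, PO xo * f xo := by
    intro f
    have := Fintype.sum_equiv eX (fun x => P x * f (eX x).1)
      (fun b => (PO b.1 * if b.2 = xr then 1 else 0) * f b.1) (fun x => rfl)
    rw [this, Fintype.sum_prod_type]
    simp
  have hP : P ∈ stdSimplex ℝ X := by
    refine ⟨fun x => mul_nonneg (hPO.1 _) (by split_ifs <;> simp), ?_⟩
    simpa [hPO.2] using hsum fun _ => 1
  have hlaw : law P (fun x => (eX x).1) = PO := by
    ext xo
    rw [law_eq_sum]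
    simpa using hsum fun xo' => if xo' = xo then 1 else 0
  refine ⟨P, hP, ?_⟩
  have hp := W.joint_mem hP
  have e2 := entropy_joint_eve_sub_of_subchannels h hP
  rw [hobv.secretInfo_eq_sub hPO, mutualInfo_eq hp.1, mutualInfo_eq hp.1]
  rw [← hlaw]
  -- On the legitimate side, I(X;Y_R|Y_O) ≥ 0 shows that seeing Y_R costs nothing, and H(X_R) = 0
  -- lets X be replaced by X_O. On Eve's side H(Z) ≤ H(Z_O) + H(Z_R), while the exact splitting `e2`
  -- shows that Z_R adds nothing to I(X;Z) once X_R is constant.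
  have s1 := entropy_submodular hp (fun a => a.1) (fun a => (eY a.2.1).2) (fun a => (eY a.2.1).1)
  have s2 := entropy_pair_le hp (fun a => (eX a.1).2)
    (pair (fun a => (eX a.1).1) (fun a => (eY a.2.1).1))
  have s3 : entropy (W.joint P) (fun a => (eX a.1).2) = 0 :=
    entropy_eq_zero_of_const hp (u := xr) fun a ha => by
      by_contra hne
      have := W.joint_pos_left hP.1 ha
      simp [P, hne] at this
  have s4 := entropy_le_pair hp.1 (fun a => (eX a.1).1) (fun a => (eX a.1).2)
  have s5 := entropy_le_pair hp.1 (fun a => (eZ a.2.2).2) (fun a => (eX a.1).2)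
  have s6 := entropy_pair_le hp (fun a => (eZ a.2.2).1) (fun a => (eZ a.2.2).2)
  have o1 := entropy_joint_obverse h P (pair (fun a => a.1) (fun a => a.2.1))
  have o2 := entropy_joint_obverse h P (fun a => a.2.1)
  have o3 := entropy_joint_obverse h P (fun a => a.2.2)
  have o4 := entropy_joint_obverse h P (fun a => a.1)
  have r1 := entropy_joint_reverse h P (pair (fun a => a.1) (fun a => a.2.2))
  have r2 := entropy_joint_reverse h P (fun a => a.1)
  have r3 := entropy_pair_comm (W.joint P) (fun a => (eX a.1).2) (fun a => (eZ a.2.2).2)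
  have c1 : entropy (W.joint P) (fun a => a.2.2) =
      entropy (W.joint P) (pair (fun a => (eZ a.2.2).1) (fun a => (eZ a.2.2).2)) :=
    entropy_congr _ fun ω ω' => by
      simp only [pair, ← eZ.apply_eq_iff_eq, Prod.ext_iff]
  have c2 : entropy (W.joint P) (fun a => a.1) =
      entropy (W.joint P) (pair (fun a => (eX a.1).1) (fun a => (eX a.1).2)) :=
    entropy_congr _ fun ω ω' => by
      simp only [pair, ← eX.apply_eq_iff_eq, Prod.ext_iff]
  have c3 : entropy (W.joint P) (fun a => a.2.1) =
      entropy (W.joint P) (pair (fun a => (eY a.2.1).2) (fun a => (eY a.2.1).1)) :=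
    entropy_congr _ fun ω ω' => by
      simp only [pair, ← eY.apply_eq_iff_eq, Prod.ext_iff]
      tauto
  have c4 : entropy (W.joint P) (pair (fun a => a.1) (fun a => a.2.1)) =
      entropy (W.joint P)
        (pair (fun a => a.1) (pair (fun a => (eY a.2.1).2) (fun a => (eY a.2.1).1))) :=
    entropy_congr _ fun ω ω' => by
      simp only [pair, ← eY.apply_eq_iff_eq, Prod.ext_iff]
      tauto
  have c5 : entropy (W.joint P) (pair (fun a => a.1) (fun a => (eY a.2.1).1)) =
      entropy (W.joint P) (pair (fun a => (eX a.1).2)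
        (pair (fun a => (eX a.1).1) (fun a => (eY a.2.1).1))) :=
    entropy_congr _ fun ω ω' => by
      simp only [pair, ← eX.apply_eq_iff_eq, Prod.ext_iff]
      tauto
  simp only [pair_def] at *
  linarith

end Subchannels

end DMBC

end TwoWaySKE
-- The two-round lower bound
namespace TwoWaySKE

section MoreInfo

variable {Ω : Type*} [Fintype Ω] {α β γ τ : Type*}

lemma mutualInfo_nonneg [Fintype α] [Fintype β] {p : Ω → ℝ} (hp : p ∈ stdSimplex ℝ Ω)
    (U : Ω → α) (V : Ω → β) : 0 ≤ mutualInfo p U V := by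
  rw [mutualInfo_eq hp.1]
  linarith [entropy_pair_le hp U V]

lemma condEntropy_le_entropy [Fintype α] [Fintype β] {p : Ω → ℝ} (hp : p ∈ stdSimplex ℝ Ω)
    (U : Ω → α) (V : Ω → β) : condEntropy p U V ≤ entropy p U := by
  linarith [mutualInfo_nonneg hp U V, mutualInfo.eq_1 p U V]

/-- A function of `V` forms a Markov chain with `V` and any third variable. -/
lemma isMarkov_of_function (p : Ω → ℝ) {U : Ω → α} {V : Ω → β} (W : Ω → γ) (h : β → α)
    (hU : ∀ ω, U ω = h (V ω)) : IsMarkov p U V W := by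
  classical
  intro u v w
  have h1 : law p (pair U (pair V W)) (u, v, w) =
      if u = h v then law p (pair V W) (v, w) else 0 := by
    simp_rw [law_eq_sum, pair, hU, Prod.mk.injEq]
    split_ifs with huv
    · subst huv
      refine Finset.sum_congr rfl fun ω _ => if_congr ⟨fun h => h.2, ?_⟩ rfl rfl
      rintro ⟨rfl, rfl⟩
      simp
    · refine Finset.sum_eq_zero fun ω _ => if_neg ?_
      rintro ⟨rfl, rfl, rfl⟩
      exact huv rfl
  have h2 : law p (pair U V) (u, v) = if u = h v then law p V v else 0 := by
    simp_rw [law_eq_sum, pair, hU, Prod.mk.injEq]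
    split_ifs with huv
    · subst huv
      refine Finset.sum_congr rfl fun ω _ => if_congr ⟨fun h => h.2, ?_⟩ rfl rfl
      rintro rfl
      simp
    · refine Finset.sum_eq_zero fun ω _ => if_neg ?_
      rintro ⟨rfl, rfl⟩
      exact huv rfl
  rw [h1, h2]
  split_ifs <;> ring

lemma isMarkov_map [Fintype τ] {p : Ω → ℝ} {T : Ω → τ} {U : τ → α} {V : τ → β} {W : τ → γ}
    (h : IsMarkov p (fun ω => U (T ω)) (fun ω => V (T ω)) (fun ω => W (T ω))) :
    IsMarkov (law p T) U V W := by
  intro u v w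
  simp_rw [law_law]
  exact h u v w

lemma mutualInfo_map [Fintype τ] [Fintype α] [Fintype β] {p : Ω → ℝ} (hp : ∀ ω, 0 ≤ p ω)
    (T : Ω → τ) (U : τ → α) (V : τ → β) :
    mutualInfo (law p T) U V = mutualInfo p (fun ω => U (T ω)) (fun ω => V (T ω)) := by
  rw [mutualInfo_eq (law_nonneg hp T), mutualInfo_eq hp]
  simp_rw [entropy_map]
  rfl

lemma condMutualInfo_map [Fintype τ] [Fintype α] [Fintype β] [Fintype γ] {p : Ω → ℝ}
    (hp : ∀ ω, 0 ≤ p ω) (T : Ω → τ) (U : τ → α) (V : τ → β) (W : τ → γ) :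
    condMutualInfo (law p T) U V W =
      condMutualInfo p (fun ω => U (T ω)) (fun ω => V (T ω)) (fun ω => W (T ω)) := by
  rw [condMutualInfo_eq (law_nonneg hp T), condMutualInfo_eq hp]
  simp_rw [entropy_map]
  rfl

lemma condMutualInfo_const [Fintype α] [Fintype β] [Fintype γ] {p : Ω → ℝ}
    (hp : p ∈ stdSimplex ℝ Ω) {e : α → τ} [Fintype τ] (he : Function.Injective e) (U : Ω → α)
    (V : Ω → β) (c : γ) :
    condMutualInfo p (fun ω => e (U ω)) V (fun _ => c) = mutualInfo p U V := by
  rw [condMutualInfo_eq hp.1, mutualInfo_eq hp.1,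
    entropy_congr p (U := pair (fun ω => e (U ω)) (fun _ => c)) (V := U)
      (by simp [pair, he.eq_iff]),
    entropy_congr p (U := pair V (fun _ => c)) (V := V) (by simp [pair]),
    entropy_congr p (U := pair (fun ω => e (U ω)) (pair V (fun _ => c)))
      (V := pair U V) (by simp [pair, he.eq_iff]),
    entropy_eq_zero_of_const hp (u := c) (fun _ _ => rfl)]
  ring

/-- If `V ↔ Y ↔ (X, Z)`, then `I(V; X) - I(V; Z) ≤ I(X; Y | Z)`. -/
lemma mutualInfo_sub_le_condMutualInfo_of_isMarkov {ν ξ υ ζ : Type*} [Fintype ν] [Fintype ξ]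
    [Fintype υ] [Fintype ζ] {p : Ω → ℝ} (hp : p ∈ stdSimplex ℝ Ω) {V : Ω → ν} {X : Ω → ξ}
    {Y : Ω → υ} {Z : Ω → ζ} (h : IsMarkov p V Y (pair X Z)) :
    mutualInfo p V X - mutualInfo p V Z ≤ condMutualInfo p X Y Z := by
  rw [mutualInfo_eq hp.1, mutualInfo_eq hp.1, condMutualInfo_eq hp.1]
  have hm := h.entropy_eq hp.1
  -- The chain is I(V;X) - I(V;Z) ≤ I(V;X|Z) ≤ I(V,Y;X|Z) = I(X;Y|Z) + I(V;X|Y,Z), where the slacks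
  -- are `s1` and `s2`. The last term is zero by the Markov chain `hm`, with `s3` bounding it by
  -- I(V;X,Z|Y).
  have s1 := entropy_submodular hp V Z X
  have s2 := entropy_submodular hp X Y (pair V Z)
  have s3 := entropy_submodular hp V Z Y
  have c1 : entropy p (pair V (pair Z X)) = entropy p (pair X (pair V Z)) :=
    entropy_congr p fun ω ω' => by simp only [pair, Prod.ext_iff]; tauto
  have c2 : entropy p (pair X (pair Y (pair V Z))) = entropy p (pair V (pair Y (pair X Z))) :=
    entropy_congr p fun ω ω' => by simp only [pair, Prod.ext_iff]; tauto
  have c3 : entropy p (pair Y (pair V Z)) = entropy p (pair V (pair Z Y)) :=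
    entropy_congr p fun ω ω' => by simp only [pair, Prod.ext_iff]; tauto
  have c4 : entropy p (pair Y (pair X Z)) = entropy p (pair X (pair Y Z)) :=
    entropy_congr p fun ω ω' => by simp only [pair, Prod.ext_iff]; tauto
  have c5 := entropy_pair_comm p Z Y
  have c6 := entropy_pair_comm p Z X
  linarith

/-- If `(W₂, W₁) ↔ X ↔ (Y, Z)`, then `I(W₁; Y | W₂) - I(W₁; Z | W₂) ≤ I(X; Y | Z)`. -/
lemma condMutualInfo_sub_le_condMutualInfo_of_isMarkov {ν μ ξ υ ζ : Type*} [Fintype ν]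
    [Fintype μ] [Fintype ξ] [Fintype υ] [Fintype ζ] {p : Ω → ℝ} (hp : p ∈ stdSimplex ℝ Ω)
    {B : Ω → μ} {A : Ω → ν} {X : Ω → ξ} {Y : Ω → υ} {Z : Ω → ζ}
    (h : IsMarkov p (pair B A) X (pair Y Z)) :
    condMutualInfo p A Y B - condMutualInfo p A Z B ≤ condMutualInfo p X Y Z := by
  rw [condMutualInfo_eq hp.1, condMutualInfo_eq hp.1, condMutualInfo_eq hp.1]
  have hm := h.entropy_eq hp.1
  -- The chain is I(A;Y|B) - I(A;Z|B) ≤ I(A;Y|B,Z) ≤ I(A,B;Y|Z) ≤ I(X;Y|Z), with slacks `s1`, `s2`,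
  -- `s3`. The last inequality also needs I(A,B;Y|X,Z) = 0, which comes from `hm` and `s4`.
  have s1 := entropy_submodular hp A Z (pair Y B)
  have s2 := entropy_submodular hp Y B Z
  have s3 := entropy_submodular hp Y X (pair A (pair Z B))
  have s4 := entropy_submodular hp (pair B A) Z X
  have c1 : entropy p (pair A (pair Z (pair Y B))) = entropy p (pair Y (pair A (pair Z B))) :=
    entropy_congr p fun ω ω' => by simp only [pair, Prod.ext_iff]; tauto
  have c2 : entropy p (pair Z (pair Y B)) = entropy p (pair Y (pair B Z)) :=
    entropy_congr p fun ω ω' => by simp only [pair, Prod.ext_iff]; tauto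
  have c3 : entropy p (pair Y (pair X (pair A (pair Z B)))) =
      entropy p (pair (pair B A) (pair X (pair Y Z))) :=
    entropy_congr p fun ω ω' => by simp only [pair, Prod.ext_iff]; tauto
  have c4 : entropy p (pair X (pair A (pair Z B))) =
      entropy p (pair (pair B A) (pair Z X)) :=
    entropy_congr p fun ω ω' => by simp only [pair, Prod.ext_iff]; tauto
  have c5 := entropy_pair_comm p Z X
  have c6 := entropy_pair_comm p B Z
  linarith

end MoreInfo

section TwoRound

variable {Xf Yf Zf Xb Yb Zb : Type*} [Fintype Xf] [Fintype Yf] [Fintype Zf]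
  [Fintype Xb] [Fintype Yb] [Fintype Zb] {W : DMBC Xf Yf Zf} {W' : DMBC Xb Yb Zb}

/-- The rate is a weighted mean of two terms, and data processing bounds each of them by I(X;Y|Z) on
its own channel. The truncation at 0 of the second term is the reason for asking 0 ≤ C. -/
lemma le_of_mem_twoRoundValues {C r : ℝ} (hC : 0 ≤ C)
    (h : ∀ P ∈ stdSimplex ℝ Xf, W.secretInfo P ≤ C)
    (h' : ∀ P ∈ stdSimplex ℝ Xb, W'.secretInfo P ≤ C)
    (hr : r ∈ twoRoundValues W W') : r ≤ C := by
  obtain ⟨n, n', k, k₁, k₂, p, hp, q, hq, hpW, hpM, hqW, -, hqM, -, rfl⟩ := hr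
  have h1 := mutualInfo_sub_le_condMutualInfo_of_isMarkov hp hpM
  have h2 := condMutualInfo_sub_le_condMutualInfo_of_isMarkov hq hqM
  have e1 := condMutualInfo_map hp.1 (fun a => a.2) (fun a => a.1) (fun a => a.2.1)
    (fun a => a.2.2)
  have e2 := condMutualInfo_map hq.1 (fun a => a.2.2) (fun a => a.1) (fun a => a.2.1)
    (fun a => a.2.2)
  rw [hpW] at e1
  rw [hqW] at e2
  have g1 := h1.trans (e1.symm.le.trans (h _ (law_mem_stdSimplex hp _)))
  have g2 := max_le hC (h2.trans (e2.symm.le.trans (h' _ (law_mem_stdSimplex hq _))))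
  have hn : (0 : ℝ) ≤ n := n.cast_nonneg
  have hn' : (0 : ℝ) ≤ n' := n'.cast_nonneg
  refine div_le_of_le_mul₀ (by positivity) hC ?_
  have := mul_le_mul_of_nonneg_left g1 hn
  have := mul_le_mul_of_nonneg_left g2 hn'
  linarith

/-- With `n = 0`, `W₁ = X` and constant `V`, `W₂` the two-round scheme has rate
`I(X; Y) - I(X; Z)`. -/
lemma mutualInfo_sub_mem_twoRoundValues [Nonempty Xf] {P : Xb → ℝ} (hP : P ∈ stdSimplex ℝ Xb)
    (hpos : 0 < mutualInfo (W'.joint P) (fun a => a.1) (fun a => a.2.1) -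
      mutualInfo (W'.joint P) (fun a => a.1) (fun a => a.2.2)) :
    mutualInfo (W'.joint P) (fun a => a.1) (fun a => a.2.1) -
      mutualInfo (W'.joint P) (fun a => a.1) (fun a => a.2.2) ∈ twoRoundValues W W' := by
  classical
  let P₀ : Xf → ℝ := Pi.single (Classical.arbitrary Xf) 1
  have hP₀ : P₀ ∈ stdSimplex ℝ Xf := single_mem_stdSimplex ℝ _
  let e := Fintype.equivFin Xb
  have hp := W'.joint_mem hP
  have hnn := mutualInfo_nonneg hp (fun a => a.1) (fun a => a.2.2)
  have he : Function.Injective fun x => e x := e.injective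
  have hI : mutualInfo (W'.joint P) (fun a => e a.1) (fun a => a.2.1) =
      mutualInfo (W'.joint P) (fun a => a.1) (fun a => a.2.1) := by
    rw [mutualInfo_eq hp.1, mutualInfo_eq hp.1,
      entropy_congr (W'.joint P) (U := fun a => e a.1) (V := fun a => a.1) (by simp),
      entropy_congr (W'.joint P) (U := pair (fun a => e a.1) (fun a => a.2.1))
        (V := pair (fun a => a.1) (fun a => a.2.1)) (by simp [pair])]
  refine ⟨0, 1, 1, Fintype.card Xb, 1, law (W.joint P₀) fun a => (0, a),
    law_mem_stdSimplex (W.joint_mem hP₀) _, law (W'.joint P) fun a => (0, e a.1, a),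
    law_mem_stdSimplex hp _, ?_, ?_, ?_, ?_, ?_, ?_, ?_⟩
  · rw [law_law, law_law, W.law_joint_fst]
    ext a
    exact law_of_injective _ Function.injective_id a
  · exact isMarkov_map (isMarkov_of_function _ _ (fun _ => 0) fun _ => rfl)
  · rw [law_law, law_law, W'.law_joint_fst]
    ext a
    exact law_of_injective _ Function.injective_id a
  · exact isMarkov_map (isMarkov_of_function _ _ (fun _ => 0) fun _ => rfl)
  · exact isMarkov_map (isMarkov_of_function _ _ (fun x => (0, e x)) fun _ => rfl)
  -- With n = 0 admissibility reads 0 < I(X;Y). It follows from the positive difference and I(X;Z) ≥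
  -- 0.
  · rw [mutualInfo_map hp.1, hI]
    simp only [CharP.cast_eq_zero, zero_mul, Nat.cast_one, one_mul]
    linarith
  · rw [condMutualInfo_map hp.1, condMutualInfo_map hp.1,
      condMutualInfo_const hp he, condMutualInfo_const hp he, max_eq_right hpos.le]
    simp

end TwoRound

end TwoWaySKE
-- Converse: causal products of kernels and the abstract key bound
namespace TwoWaySKE

section Causal

/-- Exchanging the coordinate `f i` with `a` is an involution of the pairs (f, a). It turns the left
side into a sum that does not depend on `a`. -/
lemma sum_sum_update {I A : Type*} [Fintype I] [DecidableEq I] [Fintype A] (i : I)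
    (F : (I → A) → ℝ) :
    ∑ f, ∑ a, F (Function.update f i a) = Fintype.card A * ∑ f, F f := by
  have hinv : Function.Involutive
      (fun x : (I → A) × A => (Function.update x.1 i x.2, x.1 i)) := by
    rintro ⟨f, a⟩
    simp
  rw [← Fintype.sum_prod_type',
    Fintype.sum_equiv hinv.toPerm (fun x : (I → A) × A => F (Function.update x.1 i x.2))
      (fun x => F x.1) (fun x => rfl), Fintype.sum_prod_type, Finset.mul_sum]
  simp

/-- A factor of the summand that depends on the coordinate `i` may be replaced by any other
factor of the same total mass. -/
lemma sum_mul_apply_congr {I A : Type*} [Fintype I] [DecidableEq I] [Fintype A] (i : I)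
    {Φ : (I → A) → ℝ} {k k' : (I → A) → A → ℝ}
    (hΦ : ∀ f a, Φ (Function.update f i a) = Φ f)
    (hk : ∀ f a, k (Function.update f i a) = k f)
    (hk' : ∀ f a, k' (Function.update f i a) = k' f) (h : ∀ f, ∑ a, k f a = ∑ a, k' f a) :
    ∑ f, Φ f * k f (f i) = ∑ f, Φ f * k' f (f i) := by
  rcases isEmpty_or_nonempty A with hA | hA
  · have : IsEmpty (I → A) := ⟨fun f => hA.elim (f i)⟩
    simp
  have hc : (Fintype.card A : ℝ) ≠ 0 := by exact_mod_cast Fintype.card_ne_zero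
  refine mul_left_cancel₀ hc ?_
  rw [← sum_sum_update i, ← sum_sum_update i]
  refine Finset.sum_congr rfl fun f _ => ?_
  simp_rw [hΦ, hk, hk', Function.update_self, ← Finset.mul_sum, h]

/-- A product of stochastic kernels, each of which depends on the past only, has total mass `1`. -/
lemma sum_prod_causal {I J A B : Type*} [Fintype I] [Fintype J] [Fintype A] [Fintype B]
    [DecidableEq I] [DecidableEq J]
    [Nonempty A] [Nonempty B] (t : I → ℕ) (t' : J → ℕ)
    (k : (J → B) → I → A → ℝ) (k' : (I → A) → J → B → ℝ)
    (hk : ∀ g g' i, (∀ j, t' j < t i → g j = g' j) → k g i = k g' i)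
    (hk' : ∀ f f' j, (∀ i, t i < t' j → f i = f' i) → k' f j = k' f' j)
    (h1 : ∀ g i, ∑ a, k g i a = 1) (h1' : ∀ f j, ∑ b, k' f j b = 1) :
    ∑ f, ∑ g, (∏ i, k g i (f i)) * ∏ j, k' f j (g j) = 1 := by
  let u : A → ℝ := fun _ => (Fintype.card A : ℝ)⁻¹
  let u' : B → ℝ := fun _ => (Fintype.card B : ℝ)⁻¹
  have hA : (Fintype.card A : ℝ) ≠ 0 := by exact_mod_cast Fintype.card_ne_zero
  have hB : (Fintype.card B : ℝ) ≠ 0 := by exact_mod_cast Fintype.card_ne_zero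
  have hu : ∑ a, u a = 1 := by simp [u, hA]
  have hu' : ∑ b, u' b = 1 := by simp [u', hB]
  -- Kernels outside `S` are replaced by the uniform one. For `S` empty the total mass is
  -- elementary, and for `S` everything it is the claim.
  let K : Finset (I ⊕ J) → (J → B) → I → A → ℝ :=
    fun S g i => if Sum.inl i ∈ S then k g i else u
  let K' : Finset (I ⊕ J) → (I → A) → J → B → ℝ :=
    fun S f j => if Sum.inr j ∈ S then k' f j else u'
  have hK1 : ∀ S g i, ∑ a, K S g i a = 1 := by
    intro S g i
    by_cases h : Sum.inl i ∈ S <;> simp [K, h, h1, hu]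
  have hK1' : ∀ S f j, ∑ b, K' S f j b = 1 := by
    intro S f j
    by_cases h : Sum.inr j ∈ S <;> simp [K', h, h1', hu']
  suffices H : ∀ S : Finset (I ⊕ J),
      ∑ f, ∑ g, (∏ i, K S g i (f i)) * ∏ j, K' S f j (g j) = 1 by
    simpa [K, K'] using H Finset.univ
  intro S
  -- The inserted use is a latest one, so no kernel of `S` sees its outcome, and the kernels outside
  -- `S` are uniform. Its own kernel is then the only factor that involves this coordinate and can
  -- be traded for the uniform one.
  refine Finset.induction_on_max_value (Sum.elim t t') S ?_ ?_
  · simp [K, K', u, u', Finset.card_univ]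
    field_simp
  · rintro (i | j) S hS hmax ih
    · rw [← ih, Finset.sum_comm, Finset.sum_comm (s := Finset.univ (α := I → A))]
      refine Finset.sum_congr rfl fun g _ => ?_
      let Φ : (I → A) → ℝ := fun f => (∏ i' ∈ Finset.univ.erase i, K S g i' (f i')) *
        ∏ j, K' S f j (g j)
      have hΦ : ∀ f a, Φ (Function.update f i a) = Φ f := by
        intro f a
        refine congrArg₂ _ (Finset.prod_congr rfl fun i' hi' => ?_)
          (Finset.prod_congr rfl fun j _ => ?_)
        · rw [Function.update_of_ne (Finset.ne_of_mem_erase hi')]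
        · simp only [K']
          split_ifs with hj
          · rw [hk' (Function.update f i a) f j fun i' hi' => Function.update_of_ne ?_ _ _]
            rintro rfl
            exact absurd (hmax _ hj) (not_le.2 hi')
          · rfl
      have e : ∀ S', (∀ i' ≠ i, K S' g i' = K S g i') → (∀ f, K' S' f = K' S f) →
          ∀ f, (∏ i', K S' g i' (f i')) * ∏ j, K' S' f j (g j) = Φ f * K S' g i (f i) := by
        intro S' h h' f
        have hprod : ∏ i' ∈ Finset.univ.erase i, K S' g i' (f i') =
            ∏ i' ∈ Finset.univ.erase i, K S g i' (f i') :=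
          Finset.prod_congr rfl fun i' hi' => by rw [h i' (Finset.ne_of_mem_erase hi')]
        rw [← Finset.mul_prod_erase Finset.univ (fun i' => K S' g i' (f i')) (Finset.mem_univ i),
          h', hprod]
        ring
      simp_rw [e S (fun _ _ => rfl) (fun _ => rfl), e (insert (Sum.inl i) S)
        (fun i' hi' => by simp [K, hi']) (fun f => by ext; simp [K'])]
      exact sum_mul_apply_congr i (k := fun _ => K _ g i) (k' := fun _ => K S g i) hΦ
        (fun _ _ => rfl) (fun _ _ => rfl) (fun _ => by rw [hK1, hK1])
    · rw [← ih]
      refine Finset.sum_congr rfl fun f _ => ?_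
      let Φ : (J → B) → ℝ := fun g => (∏ i, K S g i (f i)) *
        ∏ j' ∈ Finset.univ.erase j, K' S f j' (g j')
      have hΦ : ∀ g b, Φ (Function.update g j b) = Φ g := by
        intro g b
        refine congrArg₂ _ (Finset.prod_congr rfl fun i _ => ?_)
          (Finset.prod_congr rfl fun j' hj' => ?_)
        · simp only [K]
          split_ifs with hi
          · rw [hk (Function.update g j b) g i fun j' hj' => Function.update_of_ne ?_ _ _]
            rintro rfl
            exact absurd (hmax _ hi) (not_le.2 hj')
          · rfl
        · rw [Function.update_of_ne (Finset.ne_of_mem_erase hj')]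
      have e : ∀ S', (∀ j' ≠ j, K' S' f j' = K' S f j') → (∀ g, K S' g = K S g) →
          ∀ g, (∏ i, K S' g i (f i)) * ∏ j', K' S' f j' (g j') = Φ g * K' S' f j (g j) := by
        intro S' h h' g
        have hprod : ∏ j' ∈ Finset.univ.erase j, K' S' f j' (g j') =
            ∏ j' ∈ Finset.univ.erase j, K' S f j' (g j') :=
          Finset.prod_congr rfl fun j' hj' => by rw [h j' (Finset.ne_of_mem_erase hj')]
        rw [← Finset.mul_prod_erase Finset.univ (fun j' => K' S' f j' (g j')) (Finset.mem_univ j),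
          h', hprod]
        ring
      simp_rw [e S (fun _ _ => rfl) (fun _ => rfl), e (insert (Sum.inr j) S)
        (fun j' hj' => by simp [K', hj']) (fun g => by ext; simp [K])]
      exact sum_mul_apply_congr j (k := fun _ => K' _ f j) (k' := fun _ => K' S f j) hΦ
        (fun _ _ => rfl) (fun _ _ => rfl) (fun _ => by rw [hK1', hK1'])

end Causal

section Guess

variable {X Y Z : Type*} [Fintype X] [Fintype Y] [Fintype Z]

open Classical in
/-- The conditional law of `Y` given `Z` when the input has law `P`. -/
noncomputable def DMBC.guess (W : DMBC X Y Z) (P : X → ℝ) (z : Z) (y : Y) : ℝ :=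
  if law (W.joint P) (fun a => a.2.2) z = 0 then (Fintype.card Y : ℝ)⁻¹ else
    law (W.joint P) (pair (fun a => a.2.1) (fun a => a.2.2)) (y, z) /
      law (W.joint P) (fun a => a.2.2) z

lemma DMBC.guess_nonneg (W : DMBC X Y Z) {P : X → ℝ} (hP : ∀ x, 0 ≤ P x) (z : Z) (y : Y) :
    0 ≤ W.guess P z y := by
  rw [guess]
  split_ifs
  · positivity
  · exact div_nonneg (law_nonneg (W.joint_nonneg hP) _ _) (law_nonneg (W.joint_nonneg hP) _ _)

/-- The uniform default at a `z` of probability zero makes this a stochastic kernel for every `z`,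
which the mass count of the reference law in `sum_majorants` requires. -/
lemma DMBC.sum_guess [Nonempty Y] (W : DMBC X Y Z) (P : X → ℝ) (z : Z) :
    ∑ y, W.guess P z y = 1 := by
  by_cases h : law (W.joint P) (fun a => a.2.2) z = 0
  · simp [guess, h]
  · simp only [guess, h, if_false]
    rw [← Finset.sum_div, sum_law_pair_left, div_self h]

lemma DMBC.guess_eq (W : DMBC X Y Z) {P : X → ℝ} (hP : ∀ x, 0 ≤ P x) {x : X} {y : Y} {z : Z}
    (h : 0 < W.joint P (x, y, z)) : W.guess P z y =
      law (W.joint P) (pair (fun a => a.2.1) (fun a => a.2.2)) (y, z) /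
        law (W.joint P) (fun a => a.2.2) z := by
  rw [guess, if_neg]
  exact (law_pos (W.joint_nonneg hP) (fun a => a.2.2) h).ne'

lemma DMBC.guess_pos (W : DMBC X Y Z) {P : X → ℝ} (hP : ∀ x, 0 ≤ P x) {x : X} {y : Y} {z : Z}
    (h : 0 < W.joint P (x, y, z)) : 0 < W.guess P z y := by
  rw [W.guess_eq hP h]
  exact div_pos (law_pos (W.joint_nonneg hP) (pair (fun a => a.2.1) (fun a => a.2.2)) h)
    (law_pos (W.joint_nonneg hP) (fun a => a.2.2) h)

/-- The information density whose mean is `I(X; Y | Z)`. -/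
noncomputable def DMBC.secretDensity (W : DMBC X Y Z) (P : X → ℝ) (x : X) (b : Y × Z) : ℝ :=
  Real.logb 2 (W.prob x b / (W.eve x b.2 * W.guess P b.2 b.1))

/-- On the support the density is log P(y|x,z) / P(y|z), because P(y,z|x) = P(z|x) P(y|x,z). -/
lemma DMBC.sum_secretDensity (W : DMBC X Y Z) {P : X → ℝ} (hP : P ∈ stdSimplex ℝ X) :
    ∑ x, P x * ∑ b, W.prob x b * W.secretDensity P x b = W.secretInfo P := by
  have hp := W.joint_mem hP
  rw [← W.sum_joint_mul P fun a => W.secretDensity P a.1 a.2, W.secretInfo_eq hP.1]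
  have e1 := W.entropy_joint_sub hP
  have e2 := W.entropy_joint_eve_sub hP
  have e3 := entropy_eq_sum (W.joint P) (pair (fun a => a.2.1) (fun a => a.2.2))
  have e4 := entropy_eq_sum (W.joint P) (fun a => a.2.2)
  have key : ∑ a, W.joint P a * W.secretDensity P a.1 a.2 =
      ∑ a, W.joint P a * (Real.logb 2 (W.prob a.1 a.2) - Real.logb 2 (W.eve a.1 a.2.2) -
        Real.logb 2 (law (W.joint P) (pair (fun a => a.2.1) (fun a => a.2.2))
          (pair (fun a => a.2.1) (fun a => a.2.2) a)) +
        Real.logb 2 (law (W.joint P) (fun a => a.2.2) a.2.2)) := by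
    refine sum_mul_congr_of_pos hp.1 ?_
    rintro ⟨x, y, z⟩ h
    have h1 := W.joint_pos_right h
    have h2 := h1.trans_le (W.prob_le_eve x y z)
    have h3 := law_pos hp.1 (pair (fun a => a.2.1) (fun a => a.2.2)) h
    have h4 := law_pos hp.1 (fun a => a.2.2) h
    rw [secretDensity, Real.logb_div h1.ne' (mul_pos h2 (W.guess_pos hP.1 h)).ne',
      Real.logb_mul h2.ne' (W.guess_pos hP.1 h).ne', W.guess_eq hP.1 h]
    change _ - (_ + Real.logb 2 (law _ _ (pair (fun a => a.2.1) (fun a => a.2.2) (x, y, z)) / _))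
      = _
    rw [Real.logb_div h3.ne' h4.ne']
    ring
  rw [key]
  simp_rw [mul_add, mul_sub, Finset.sum_add_distrib, Finset.sum_sub_distrib]
  linarith

end Guess

/-- A bound on the conditional entropy of a key that is a function of `U` and is guessed from `V`,
in terms of a majorant of the joint law that makes `U` and `V` independent given `E`. -/
lemma condEntropy_add_entropy_le {Ω υ ν ε κ : Type*} [Fintype Ω] [Fintype υ] [Fintype ν]
    [Fintype ε] [Fintype κ] {p : Ω → ℝ} (hp : p ∈ stdSimplex ℝ Ω) (U : Ω → υ) (V : Ω → ν)
    (E : Ω → ε) (s : υ → κ) (f : υ → ε → ℝ) (g : ν → ε → ℝ) (q : ν → κ → ℝ)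
    (hf : ∀ u e, 0 ≤ f u e) (hg : ∀ v e, 0 ≤ g v e) (hfg : ∑ e, (∑ u, f u e) * ∑ v, g v e ≤ 1)
    (hf' : ∀ ω, 0 < p ω → 0 < f (U ω) (E ω)) (hg' : ∀ ω, 0 < p ω → 0 < g (V ω) (E ω))
    (hq : ∀ v k, 0 < q v k) (hq1 : ∀ v, ∑ k, q v k = 1) :
    condEntropy p (fun ω => s (U ω)) E + entropy p (pair U (pair V E)) ≤
      -∑ ω, p ω * Real.logb 2 (f (U ω) (E ω) * g (V ω) (E ω)) -
        ∑ ω, p ω * Real.logb 2 (q (V ω) (s (U ω))) := by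
  let Fs : κ → ε → ℝ := fun k e => law (fun u => f u e) s k
  let F : ε → ℝ := fun e => ∑ u, f u e
  have hFs : ∀ k e, 0 ≤ Fs k e := fun k e => law_nonneg (fun u => hf u e) s k
  have hF : ∀ e, 0 ≤ F e := fun e => Finset.sum_nonneg fun u _ => hf u e
  have hFs' : ∀ ω, 0 < p ω → 0 < Fs (s (U ω)) (E ω) := fun ω h =>
    law_pos (fun u => hf u (E ω)) s (hf' ω h)
  have hF' : ∀ ω, 0 < p ω → 0 < F (E ω) := fun ω h =>
    (hf' ω h).trans_le (Finset.single_le_sum (f := fun u => f u (E ω)) (fun u _ => hf u _)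
      (Finset.mem_univ _))
  -- The first Gibbs bound keeps the true law of E and takes the posterior `Fs / F` of the key under
  -- the weight `f`. It bounds H(K|E) by the mean of -log(Fs / F), where K is the key.
  have g1 := entropy_le_crossEntropy hp (pair (fun ω => s (U ω)) E)
    (fun a => law p E a.2 * (Fs a.1 a.2 / F a.2))
    (fun a => mul_nonneg (law_nonneg hp.1 _ _) (div_nonneg (hFs _ _) (hF _))) ?_
    (fun ω h => mul_pos (law_pos hp.1 E h) (div_pos (hFs' ω h) (hF' ω h)))
  -- The second comparison law is f·g reweighted so that, given V, the key has law `q` instead of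
  -- its posterior. Summing over U inside a key class gives at most `q`, so the total mass stays at
  -- most the sum of the F·g. On adding the two bounds `Fs` and `F` cancel.
  · have g2 := entropy_le_crossEntropy hp (pair U (pair V E))
      (fun a => f a.1 a.2.2 * (q a.2.1 (s a.1) / Fs (s a.1) a.2.2) * (F a.2.2 * g a.2.1 a.2.2))
      (fun a => mul_nonneg (mul_nonneg (hf _ _) (div_nonneg (hq _ _).le (hFs _ _)))
        (mul_nonneg (hF _) (hg _ _))) ?_
      (fun ω h => mul_pos (mul_pos (hf' ω h) (div_pos (hq _ _) (hFs' ω h)))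
        (mul_pos (hF' ω h) (hg' ω h)))
    · rw [condEntropy_eq_sub hp.1, entropy_eq_sum p E]
      have key : ∑ ω, p ω * (Real.logb 2 (law p E (E ω) * (Fs (s (U ω)) (E ω) / F (E ω))) +
          Real.logb 2 (f (U ω) (E ω) * (q (V ω) (s (U ω)) / Fs (s (U ω)) (E ω)) *
            (F (E ω) * g (V ω) (E ω))) - Real.logb 2 (law p E (E ω))) =
          ∑ ω, p ω * (Real.logb 2 (f (U ω) (E ω) * g (V ω) (E ω)) +
            Real.logb 2 (q (V ω) (s (U ω)))) := by
        refine sum_mul_congr_of_pos hp.1 fun ω h => ?_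
        have a1 := (law_pos hp.1 E h).ne'
        have a2 := (hFs' ω h).ne'
        have a3 := (hF' ω h).ne'
        have a4 := (hf' ω h).ne'
        have a5 := (hg' ω h).ne'
        have a6 := (hq (V ω) (s (U ω))).ne'
        rw [Real.logb_mul a1 (div_ne_zero a2 a3), Real.logb_div a2 a3,
          Real.logb_mul (mul_ne_zero a4 (div_ne_zero a6 a2)) (mul_ne_zero a3 a5),
          Real.logb_mul a4 (div_ne_zero a6 a2), Real.logb_div a6 a2, Real.logb_mul a3 a5,
          Real.logb_mul a4 a5]
        ring
      simp_rw [mul_sub, mul_add, Finset.sum_sub_distrib, Finset.sum_add_distrib] at key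
      simp only [pair] at g1 g2 ⊢
      simp only [pair_def] at g1 g2 ⊢
      linarith
    · rw [Fintype.sum_prod_type, Finset.sum_comm, Fintype.sum_prod_type_right]
      refine le_trans (Finset.sum_le_sum fun e _ => ?_) hfg
      change _ ≤ F e * _
      rw [Finset.mul_sum]
      refine Finset.sum_le_sum fun v _ => ?_
      dsimp only
      rw [← Finset.sum_mul]
      refine mul_le_of_le_one_left (mul_nonneg (hF _) (hg _ _)) ?_
      rw [← sum_law_mul (fun u => f u e) s fun k => q v k / Fs k e, ← hq1 v]
      refine Finset.sum_le_sum fun k _ => ?_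
      change Fs k e * _ ≤ _
      rcases eq_or_ne (Fs k e) 0 with h | h
      · simp [h, (hq v k).le]
      · rw [mul_div_cancel₀ _ h]
  · rw [Fintype.sum_prod_type_right, ← hp.2, ← sum_law p E]
    refine Finset.sum_le_sum fun e _ => ?_
    dsimp only
    rw [← Finset.mul_sum, ← Finset.sum_div]
    refine mul_le_of_le_one_right (law_nonneg hp.1 _ _) ?_
    change (∑ k, law (fun u => f u e) s k) / F e ≤ 1
    rw [sum_law]
    exact div_self_le_one _

end TwoWaySKE
-- Converse: the law of an execution and its conditionally independent majorant
namespace TwoWaySKE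

namespace Protocol

variable {Xf Yf Zf Xb Yb Zb : Type*} [Fintype Yf] [Fintype Zf] [Fintype Yb] [Fintype Zb]

/-- An outcome as a tuple, the two outputs of each use being kept together. -/
def outcomeEquiv (prot : Protocol Xf Yf Xb Yb) (Zf Zb : Type*) :
    prot.Outcome Zf Zb ≃ (Fin prot.mA × Fin prot.mB) ×
      (prot.σ.FwdUse → Yf × Zf) × (prot.σ.BwdUse → Yb × Zb) where
  toFun o := ((o.a, o.b), fun i => (o.yf i, o.zf i), fun j => (o.yb j, o.zb j))
  invFun x := ⟨x.1.1, x.1.2, fun i => (x.2.1 i).1, fun i => (x.2.1 i).2, fun j => (x.2.2 j).1,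
    fun j => (x.2.2 j).2⟩
  left_inv _ := rfl
  right_inv _ := rfl

/-- An outcome as what Alice holds, what Bob holds, and what Eve receives. -/
def viewsEquiv (prot : Protocol Xf Yf Xb Yb) (Zf Zb : Type*) :
    prot.Outcome Zf Zb ≃ ((prot.σ.FwdUse → Zf) × (prot.σ.BwdUse → Zb)) ×
      (Fin prot.mA × (prot.σ.BwdUse → Yb)) × Fin prot.mB × (prot.σ.FwdUse → Yf) where
  toFun o := ((o.zf, o.zb), (o.a, o.yb), (o.b, o.yf))
  invFun x := ⟨x.2.1.1, x.2.2.1, x.2.2.2, x.1.1, x.2.1.2, x.1.2⟩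
  left_inv _ := rfl
  right_inv _ := rfl

/-- The weight of an execution in which every use of a channel has its own kernel. -/
def runWith (prot : Protocol Xf Yf Xb Yb) (kf : prot.σ.FwdUse → Xf → Yf × Zf → ℝ)
    (kb : prot.σ.BwdUse → Xb → Yb × Zb → ℝ) (o : prot.Outcome Zf Zb) : ℝ :=
  prot.randA o.a * prot.randB o.b *
    (∏ i, kf i (prot.encA o.a o.yb i) (o.yf i, o.zf i)) *
    (∏ j, kb j (prot.encB o.b o.yf j) (o.yb j, o.zb j))

/-- No sign condition is imposed on the kernels, and each use may have its own. This serves three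
purposes: the actual run, a run with one perturbed and possibly signed kernel, and the reference law
of the converse. -/
lemma sum_runWith [Nonempty (Yf × Zf)] [Nonempty (Yb × Zb)] (prot : Protocol Xf Yf Xb Yb)
    (kf : prot.σ.FwdUse → Xf → Yf × Zf → ℝ) (kb : prot.σ.BwdUse → Xb → Yb × Zb → ℝ)
    (hf : ∀ i x, ∑ b, kf i x b = 1) (hb : ∀ j x, ∑ b, kb j x b = 1) :
    ∑ o, prot.runWith kf kb o = 1 := by
  rw [Fintype.sum_equiv (prot.outcomeEquiv Zf Zb) (prot.runWith kf kb) (fun x =>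
    prot.randA x.1.1 * prot.randB x.1.2 *
      ((∏ i, kf i (prot.encA x.1.1 (fun j => (x.2.2 j).1) i) (x.2.1 i)) *
        ∏ j, kb j (prot.encB x.1.2 (fun i => (x.2.1 i).1) j) (x.2.2 j)))
    (fun o => mul_assoc _ _ _), Fintype.sum_prod_type]
  simp_rw [← Finset.mul_sum]
  have h : ∀ x : Fin prot.mA × Fin prot.mB,
      ∑ y : (prot.σ.FwdUse → Yf × Zf) × (prot.σ.BwdUse → Yb × Zb),
        ((∏ i, kf i (prot.encA x.1 (fun j => (y.2 j).1) i) (y.1 i)) *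
          ∏ j, kb j (prot.encB x.2 (fun i => (y.1 i).1) j) (y.2 j)) = 1 := by
    intro x
    rw [Fintype.sum_prod_type]
    have hA : ∀ (g g' : prot.σ.BwdUse → Yb × Zb) (i : prot.σ.FwdUse),
        (∀ j : prot.σ.BwdUse, j.1.val.val < i.1.val.val → g j = g' j) →
        kf i (prot.encA x.1 (fun j => (g j).1) i) = kf i (prot.encA x.1 (fun j => (g' j).1) i) :=
      fun g g' i h => congrArg (kf i) (prot.encA_causal x.1 _ _ i fun j hj =>
        congrArg Prod.fst (h j hj))
    have hB : ∀ (f f' : prot.σ.FwdUse → Yf × Zf) (j : prot.σ.BwdUse),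
        (∀ i : prot.σ.FwdUse, i.1.val.val < j.1.val.val → f i = f' i) →
        kb j (prot.encB x.2 (fun i => (f i).1) j) = kb j (prot.encB x.2 (fun i => (f' i).1) j) :=
      fun f f' j h => congrArg (kb j) (prot.encB_causal x.2 _ _ j fun i hi =>
        congrArg Prod.fst (h i hi))
    have hsum := sum_prod_causal (I := prot.σ.FwdUse) (J := prot.σ.BwdUse) (fun i => i.1.val.val)
      (fun j => j.1.val.val) (fun g i => kf i (prot.encA x.1 (fun j => (g j).1) i))
      (fun f j => kb j (prot.encB x.2 (fun i => (f i).1) j)) hA hB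
      (fun g i => hf i _) (fun f j => hb j _)
    exact hsum
  simp_rw [h, mul_one, Fintype.sum_prod_type, ← Finset.sum_mul_sum]
  rw [prot.randA_mem.2, prot.randB_mem.2, one_mul]

variable (prot : Protocol Xf Yf Xb Yb) (Wf : DMBC Xf Yf Zf) (Wb : DMBC Xb Yb Zb)

lemma run_nonneg (o : prot.Outcome Zf Zb) : 0 ≤ prot.run Wf Wb o :=
  mul_nonneg (mul_nonneg (mul_nonneg (prot.randA_mem.1 _) (prot.randB_mem.1 _))
    (Finset.prod_nonneg fun _ _ => Wf.prob_nonneg _ _))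
    (Finset.prod_nonneg fun _ _ => Wb.prob_nonneg _ _)

lemma run_mem [Nonempty Xf] [Nonempty Xb] :
    prot.run Wf Wb ∈ stdSimplex ℝ (prot.Outcome Zf Zb) := by
  have := Wf.nonempty_outputs
  have := Wb.nonempty_outputs
  exact ⟨prot.run_nonneg Wf Wb,
    prot.sum_runWith _ _ (fun _ => Wf.sum_prob) (fun _ => Wb.sum_prob)⟩

/-- Given the input of a use of the forward channel, its outputs follow the channel. -/
lemma sum_run_mul_fwd [Nonempty Xf] [Nonempty Xb] (i : prot.σ.FwdUse)
    (φ : Xf → Yf × Zf → ℝ) :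
    ∑ o, prot.run Wf Wb o * φ (prot.encA o.a o.yb i) (o.yf i, o.zf i) =
      ∑ o, prot.run Wf Wb o * ∑ b, Wf.prob (prot.encA o.a o.yb i) b *
        φ (prot.encA o.a o.yb i) b := by
  have := Wf.nonempty_outputs
  have := Wb.nonempty_outputs
  let m : Xf → ℝ := fun x => ∑ b, Wf.prob x b * φ x b
  -- One kernel is multiplied by 1 + φ - m, with m the conditional mean of φ. Its row sums are still
  -- 1, so the total mass is too, and comparison with the mass of the true run leaves E[φ - m] = 0.
  let kf : prot.σ.FwdUse → Xf → Yf × Zf → ℝ := Function.update (fun _ => Wf.prob) i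
    fun x b => Wf.prob x b * (1 + (φ x b - m x))
  have h1 := prot.sum_runWith kf (fun _ => Wb.prob) (fun i' x => by
    rcases eq_or_ne i' i with rfl | h
    · simp only [kf, Function.update_self, mul_add, mul_sub, Finset.sum_add_distrib,
        Finset.sum_sub_distrib, ← Finset.sum_mul, Wf.sum_prob, m]
      ring
    · simp only [kf, Function.update_of_ne h, Wf.sum_prob]) (fun _ => Wb.sum_prob)
  have h2 : ∀ o, prot.runWith kf (fun _ => Wb.prob) o = prot.run Wf Wb o *
      (1 + (φ (prot.encA o.a o.yb i) (o.yf i, o.zf i) - m (prot.encA o.a o.yb i))) := by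
    intro o
    have h3 : ∏ i' ∈ Finset.univ.erase i, kf i' (prot.encA o.a o.yb i') (o.yf i', o.zf i') =
        ∏ i' ∈ Finset.univ.erase i, Wf.prob (prot.encA o.a o.yb i') (o.yf i', o.zf i') :=
      Finset.prod_congr rfl fun i' hi' => by
        simp only [kf, Function.update_of_ne (Finset.ne_of_mem_erase hi')]
    rw [runWith, run, ← Finset.mul_prod_erase _ _ (Finset.mem_univ i), h3,
      ← Finset.mul_prod_erase _ (fun i' => Wf.prob (prot.encA o.a o.yb i') (o.yf i', o.zf i'))
        (Finset.mem_univ i)]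
    simp only [kf, Function.update_self]
    ring
  simp_rw [h2, mul_add, mul_sub, Finset.sum_add_distrib, Finset.sum_sub_distrib, mul_one] at h1
  rw [(prot.run_mem Wf Wb).2] at h1
  simp only [m] at h1
  linarith

/-- Given the input of a use of the backward channel, its outputs follow the channel. -/
lemma sum_run_mul_bwd [Nonempty Xf] [Nonempty Xb] (j : prot.σ.BwdUse)
    (φ : Xb → Yb × Zb → ℝ) :
    ∑ o, prot.run Wf Wb o * φ (prot.encB o.b o.yf j) (o.yb j, o.zb j) =
      ∑ o, prot.run Wf Wb o * ∑ b, Wb.prob (prot.encB o.b o.yf j) b *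
        φ (prot.encB o.b o.yf j) b := by
  have := Wf.nonempty_outputs
  have := Wb.nonempty_outputs
  let m : Xb → ℝ := fun x => ∑ b, Wb.prob x b * φ x b
  let kb : prot.σ.BwdUse → Xb → Yb × Zb → ℝ := Function.update (fun _ => Wb.prob) j
    fun x b => Wb.prob x b * (1 + (φ x b - m x))
  have h1 := prot.sum_runWith (fun _ => Wf.prob) kb (fun _ => Wf.sum_prob) (fun j' x => by
    rcases eq_or_ne j' j with rfl | h
    · simp only [kb, Function.update_self, mul_add, mul_sub, Finset.sum_add_distrib,
        Finset.sum_sub_distrib, ← Finset.sum_mul, Wb.sum_prob, m]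
      ring
    · simp only [kb, Function.update_of_ne h, Wb.sum_prob])
  have h2 : ∀ o, prot.runWith (fun _ => Wf.prob) kb o = prot.run Wf Wb o *
      (1 + (φ (prot.encB o.b o.yf j) (o.yb j, o.zb j) - m (prot.encB o.b o.yf j))) := by
    intro o
    have h3 : ∏ j' ∈ Finset.univ.erase j, kb j' (prot.encB o.b o.yf j') (o.yb j', o.zb j') =
        ∏ j' ∈ Finset.univ.erase j, Wb.prob (prot.encB o.b o.yf j') (o.yb j', o.zb j') :=
      Finset.prod_congr rfl fun j' hj' => by
        simp only [kb, Function.update_of_ne (Finset.ne_of_mem_erase hj')]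
    rw [runWith, run, ← Finset.mul_prod_erase _
        (fun j' => kb j' (prot.encB o.b o.yf j') (o.yb j', o.zb j')) (Finset.mem_univ j), h3,
      ← Finset.mul_prod_erase _ (fun j' => Wb.prob (prot.encB o.b o.yf j') (o.yb j', o.zb j'))
        (Finset.mem_univ j)]
    simp only [kb, Function.update_self]
    ring
  simp_rw [h2, mul_add, mul_sub, Finset.sum_add_distrib, Finset.sum_sub_distrib, mul_one] at h1
  rw [(prot.run_mem Wf Wb).2] at h1
  simp only [m] at h1
  linarith

/-- The law of the input of a use of the forward channel. -/
noncomputable def lawFwd (i : prot.σ.FwdUse) : Xf → ℝ :=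
  law (prot.run Wf Wb) fun o => prot.encA o.a o.yb i

/-- The law of the input of a use of the backward channel. -/
noncomputable def lawBwd (j : prot.σ.BwdUse) : Xb → ℝ :=
  law (prot.run Wf Wb) fun o => prot.encB o.b o.yf j

lemma lawFwd_nonneg (i : prot.σ.FwdUse) (x : Xf) : 0 ≤ prot.lawFwd Wf Wb i x :=
  law_nonneg (prot.run_nonneg Wf Wb) _ _

lemma lawBwd_nonneg (j : prot.σ.BwdUse) (x : Xb) : 0 ≤ prot.lawBwd Wf Wb j x :=
  law_nonneg (prot.run_nonneg Wf Wb) _ _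

lemma joint_fwd_pos {o : prot.Outcome Zf Zb} (h : 0 < prot.run Wf Wb o) (i : prot.σ.FwdUse) :
    0 < Wf.joint (prot.lawFwd Wf Wb i) (prot.encA o.a o.yb i, o.yf i, o.zf i) := by
  refine mul_pos (law_pos (prot.run_nonneg Wf Wb) (fun o => prot.encA o.a o.yb i) h) ?_
  refine (Wf.prob_nonneg _ _).lt_of_ne' fun h0 => ?_
  rw [run, Finset.prod_eq_zero (Finset.mem_univ i) h0] at h
  simp at h

lemma joint_bwd_pos {o : prot.Outcome Zf Zb} (h : 0 < prot.run Wf Wb o) (j : prot.σ.BwdUse) :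
    0 < Wb.joint (prot.lawBwd Wf Wb j) (prot.encB o.b o.yf j, o.yb j, o.zb j) := by
  refine mul_pos (law_pos (prot.run_nonneg Wf Wb) (fun o => prot.encB o.b o.yf j) h) ?_
  refine (Wb.prob_nonneg _ _).lt_of_ne' fun h0 => ?_
  rw [run, Finset.prod_eq_zero (Finset.mem_univ j) h0] at h
  simp at h

variable [Fintype Xf] [Fintype Xb]

/-- Alice's part of the majorant in which the outputs of every use are independent given Eve's. -/
noncomputable def majorantA
    (u : Fin prot.mA × (prot.σ.BwdUse → Yb)) (e : (prot.σ.FwdUse → Zf) × (prot.σ.BwdUse → Zb)) :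
    ℝ :=
  prot.randA u.1 * ((∏ i, Wf.eve (prot.encA u.1 u.2 i) (e.1 i)) *
    ∏ j, Wb.guess (prot.lawBwd Wf Wb j) (e.2 j) (u.2 j))

/-- Bob's part of the majorant. -/
noncomputable def majorantB
    (v : Fin prot.mB × (prot.σ.FwdUse → Yf)) (e : (prot.σ.FwdUse → Zf) × (prot.σ.BwdUse → Zb)) :
    ℝ :=
  prot.randB v.1 * ((∏ i, Wf.guess (prot.lawFwd Wf Wb i) (e.1 i) (v.2 i)) *
    ∏ j, Wb.eve (prot.encB v.1 v.2 j) (e.2 j))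

/-- In a forward use P(z|x) involves only Alice's data and Eve's symbol, and P(y|z) only Bob's
symbol and Eve's. Backward uses are the mirror image. Hence the reference execution separates into
two factors once Eve's view is fixed. -/
lemma majorantA_mul_majorantB (o : prot.Outcome Zf Zb) :
    prot.majorantA Wf Wb (o.a, o.yb) (o.zf, o.zb) * prot.majorantB Wf Wb (o.b, o.yf) (o.zf, o.zb) =
      prot.runWith (fun i x b => Wf.eve x b.2 * Wf.guess (prot.lawFwd Wf Wb i) b.2 b.1)
        (fun j x b => Wb.eve x b.2 * Wb.guess (prot.lawBwd Wf Wb j) b.2 b.1) o := by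
  rw [majorantA, majorantB, runWith, Finset.prod_mul_distrib, Finset.prod_mul_distrib]
  ring

omit [Fintype Xf] in
lemma majorantA_nonneg (u : Fin prot.mA × (prot.σ.BwdUse → Yb))
    (e : (prot.σ.FwdUse → Zf) × (prot.σ.BwdUse → Zb)) : 0 ≤ prot.majorantA Wf Wb u e :=
  mul_nonneg (prot.randA_mem.1 _) (mul_nonneg (Finset.prod_nonneg fun _ _ => Wf.eve_nonneg _ _)
    (Finset.prod_nonneg fun _ _ => Wb.guess_nonneg (prot.lawBwd_nonneg Wf Wb _) _ _))

omit [Fintype Xb] in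
lemma majorantB_nonneg (v : Fin prot.mB × (prot.σ.FwdUse → Yf))
    (e : (prot.σ.FwdUse → Zf) × (prot.σ.BwdUse → Zb)) : 0 ≤ prot.majorantB Wf Wb v e :=
  mul_nonneg (prot.randB_mem.1 _) (mul_nonneg (Finset.prod_nonneg fun _ _ =>
    Wf.guess_nonneg (prot.lawFwd_nonneg Wf Wb _) _ _)
    (Finset.prod_nonneg fun _ _ => Wb.eve_nonneg _ _))

omit [Fintype Xf] in
lemma majorantA_pos {o : prot.Outcome Zf Zb} (h : 0 < prot.run Wf Wb o) :
    0 < prot.majorantA Wf Wb (o.a, o.yb) (o.zf, o.zb) := by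
  refine mul_pos ((prot.randA_mem.1 _).lt_of_ne' fun h0 => by simp [run, h0] at h)
    (mul_pos (Finset.prod_pos fun i _ => ?_) (Finset.prod_pos fun j _ => ?_))
  · exact (Wf.joint_pos_right (prot.joint_fwd_pos Wf Wb h i)).trans_le (Wf.prob_le_eve _ _ _)
  · exact Wb.guess_pos (prot.lawBwd_nonneg Wf Wb j) (prot.joint_bwd_pos Wf Wb h j)

omit [Fintype Xb] in
lemma majorantB_pos {o : prot.Outcome Zf Zb} (h : 0 < prot.run Wf Wb o) :
    0 < prot.majorantB Wf Wb (o.b, o.yf) (o.zf, o.zb) := by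
  refine mul_pos ((prot.randB_mem.1 _).lt_of_ne' fun h0 => by simp [run, h0] at h)
    (mul_pos (Finset.prod_pos fun i _ => ?_) (Finset.prod_pos fun j _ => ?_))
  · exact Wf.guess_pos (prot.lawFwd_nonneg Wf Wb i) (prot.joint_fwd_pos Wf Wb h i)
  · exact (Wb.joint_pos_right (prot.joint_bwd_pos Wf Wb h j)).trans_le (Wb.prob_le_eve _ _ _)

/-- The product of the two parts is a causal execution with the stochastic kernels P(z|x) P(y|z), so
it has mass 1. -/
lemma sum_majorants [Nonempty Xf] [Nonempty Xb] :
    ∑ e, (∑ u, prot.majorantA Wf Wb u e) * ∑ v, prot.majorantB Wf Wb v e = 1 := by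
  have := Wf.nonempty_outputs
  have := Wb.nonempty_outputs
  have : Nonempty Yf := (nonempty_prod.1 ‹Nonempty (Yf × Zf)›).1
  have : Nonempty Yb := (nonempty_prod.1 ‹Nonempty (Yb × Zb)›).1
  rw [← prot.sum_runWith
    (fun i x b => Wf.eve x b.2 * Wf.guess (prot.lawFwd Wf Wb i) b.2 b.1)
    (fun j x b => Wb.eve x b.2 * Wb.guess (prot.lawBwd Wf Wb j) b.2 b.1)
    (fun i x => by
      simp_rw [Fintype.sum_prod_type_right, ← Finset.mul_sum, Wf.sum_guess, mul_one, Wf.sum_eve])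
    (fun i x => by
      simp_rw [Fintype.sum_prod_type_right, ← Finset.mul_sum, Wb.sum_guess, mul_one, Wb.sum_eve])]
  simp_rw [← majorantA_mul_majorantB, Finset.sum_mul_sum, ← Fintype.sum_prod_type']
  exact Fintype.sum_equiv (prot.viewsEquiv Zf Zb).symm _ _ fun x => rfl

/-- The information that Alice and Bob share given Eve's view is at most the sum of the
`I(X; Y | Z)` over all channel uses. -/
lemma sum_run_mul_logb_le [Nonempty Xf] [Nonempty Xb] {C : ℝ}
    (hf : ∀ P ∈ stdSimplex ℝ Xf, Wf.secretInfo P ≤ C)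
    (hb : ∀ P ∈ stdSimplex ℝ Xb, Wb.secretInfo P ≤ C) :
    ∑ o, prot.run Wf Wb o * Real.logb 2 (prot.run Wf Wb o) -
      ∑ o, prot.run Wf Wb o * Real.logb 2 (prot.majorantA Wf Wb (o.a, o.yb) (o.zf, o.zb) *
        prot.majorantB Wf Wb (o.b, o.yf) (o.zf, o.zb)) ≤ prot.σ.uses * C := by
  have hp := prot.run_mem Wf Wb
  -- On the support the local randomness cancels in the ratio of the true law to the reference law.
  -- What remains is a product over the uses, whose logarithm is a sum of the densities.
  have key : ∑ o, prot.run Wf Wb o * (Real.logb 2 (prot.run Wf Wb o) -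
      Real.logb 2 (prot.majorantA Wf Wb (o.a, o.yb) (o.zf, o.zb) *
        prot.majorantB Wf Wb (o.b, o.yf) (o.zf, o.zb))) =
      ∑ o, prot.run Wf Wb o *
        ((∑ i, Wf.secretDensity (prot.lawFwd Wf Wb i) (prot.encA o.a o.yb i) (o.yf i, o.zf i)) +
        ∑ j, Wb.secretDensity (prot.lawBwd Wf Wb j) (prot.encB o.b o.yf j) (o.yb j, o.zb j)) := by
    refine sum_mul_congr_of_pos hp.1 fun o h => ?_
    rw [← Real.logb_div h.ne'
      (mul_pos (prot.majorantA_pos Wf Wb h) (prot.majorantB_pos Wf Wb h)).ne',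
      majorantA_mul_majorantB]
    have hA : prot.randA o.a ≠ 0 := fun h0 => by simp [run, h0] at h
    have hB : prot.randB o.b ≠ 0 := fun h0 => by simp [run, h0] at h
    have e : ∀ a b c d e f : ℝ, a ≠ 0 → b ≠ 0 → a * b * c * d / (a * b * e * f) =
        (c / e) * (d / f) := by
      intro a b c d e f ha hb
      rw [mul_assoc (a * b), mul_assoc (a * b), mul_div_mul_left _ _ (mul_ne_zero ha hb),
        mul_div_mul_comm]
    have hposf : ∀ i, 0 < Wf.prob (prot.encA o.a o.yb i) (o.yf i, o.zf i) /
        (Wf.eve (prot.encA o.a o.yb i) (o.zf i) *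
          Wf.guess (prot.lawFwd Wf Wb i) (o.zf i) (o.yf i)) := fun i => by
      have h1 := Wf.joint_pos_right (prot.joint_fwd_pos Wf Wb h i)
      exact div_pos h1 (mul_pos (h1.trans_le (Wf.prob_le_eve _ _ _))
        (Wf.guess_pos (prot.lawFwd_nonneg Wf Wb i) (prot.joint_fwd_pos Wf Wb h i)))
    have hposb : ∀ j, 0 < Wb.prob (prot.encB o.b o.yf j) (o.yb j, o.zb j) /
        (Wb.eve (prot.encB o.b o.yf j) (o.zb j) *
          Wb.guess (prot.lawBwd Wf Wb j) (o.zb j) (o.yb j)) := fun j => by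
      have h1 := Wb.joint_pos_right (prot.joint_bwd_pos Wf Wb h j)
      exact div_pos h1 (mul_pos (h1.trans_le (Wb.prob_le_eve _ _ _))
        (Wb.guess_pos (prot.lawBwd_nonneg Wf Wb j) (prot.joint_bwd_pos Wf Wb h j)))
    rw [run, runWith, e _ _ _ _ _ _ hA hB, ← Finset.prod_div_distrib, ← Finset.prod_div_distrib,
      Real.logb_mul (Finset.prod_pos fun i _ => hposf i).ne'
        (Finset.prod_pos fun j _ => hposb j).ne',
      Real.logb_prod _ _ fun i _ => (hposf i).ne', Real.logb_prod _ _ fun j _ => (hposb j).ne']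
    rfl
  -- The mean density of a use involves only its input law: by `sum_run_mul_fwd` its outputs follow
  -- the channel given that input. So it is I(X;Y|Z) at `lawFwd`.
  have hF : ∀ i, ∑ o, prot.run Wf Wb o * Wf.secretDensity (prot.lawFwd Wf Wb i)
      (prot.encA o.a o.yb i) (o.yf i, o.zf i) ≤ C := by
    intro i
    rw [prot.sum_run_mul_fwd Wf Wb i (Wf.secretDensity (prot.lawFwd Wf Wb i)),
      ← sum_law_mul (prot.run Wf Wb) (fun o => prot.encA o.a o.yb i)
        (fun x => ∑ b, Wf.prob x b * Wf.secretDensity (prot.lawFwd Wf Wb i) x b)]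
    exact (Wf.sum_secretDensity (law_mem_stdSimplex hp _)).trans_le
      (hf _ (law_mem_stdSimplex hp _))
  have hB : ∀ j, ∑ o, prot.run Wf Wb o * Wb.secretDensity (prot.lawBwd Wf Wb j)
      (prot.encB o.b o.yf j) (o.yb j, o.zb j) ≤ C := by
    intro j
    rw [prot.sum_run_mul_bwd Wf Wb j (Wb.secretDensity (prot.lawBwd Wf Wb j)),
      ← sum_law_mul (prot.run Wf Wb) (fun o => prot.encB o.b o.yf j)
        (fun x => ∑ b, Wb.prob x b * Wb.secretDensity (prot.lawBwd Wf Wb j) x b)]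
    exact (Wb.sum_secretDensity (law_mem_stdSimplex hp _)).trans_le
      (hb _ (law_mem_stdSimplex hp _))
  simp_rw [mul_sub, Finset.sum_sub_distrib] at key
  rw [key]
  simp_rw [mul_add, Finset.sum_add_distrib, Finset.mul_sum]
  rw [Finset.sum_comm, Finset.sum_comm (t := Finset.univ (α := prot.σ.BwdUse))]
  have h1 := Finset.sum_le_card_nsmul Finset.univ _ C fun i _ => hF i
  have h2 := Finset.sum_le_card_nsmul Finset.univ _ C fun j _ => hB j
  simp only [nsmul_eq_mul, Finset.card_univ] at h1 h2
  rw [Schedule.uses]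
  push_cast
  linarith

end Protocol

end TwoWaySKE
-- Converse: Fano's inequality and the limit of small δ
namespace TwoWaySKE

/-- Fano's inequality in the form of a bound on a cross entropy: `d` guesses `k`. -/
lemma crossEntropy_guess_le {Ω : Type*} [Fintype Ω] {p : Ω → ℝ} (hp : p ∈ stdSimplex ℝ Ω) {K : ℕ}
    (hK : 0 < K) (k d : Ω → Fin K) {δ : ℝ} (hδ : 0 < δ) (hδ1 : δ < 1)
    (herr : prob p {ω | d ω ≠ k ω} ≤ δ) :
    -∑ ω, p ω * Real.logb 2 ((1 - δ) * (if d ω = k ω then 1 else 0) + δ / K) ≤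
      -Real.logb 2 (1 - δ) + δ * (Real.logb 2 K - Real.logb 2 δ) := by
  classical
  have hK' : (0 : ℝ) < K := by exact_mod_cast hK
  have hK1 : (1 : ℝ) ≤ K := by exact_mod_cast hK
  have hL : 0 ≤ Real.logb 2 K - Real.logb 2 δ := by
    linarith [Real.logb_nonneg one_lt_two hK1, Real.logb_nonpos one_lt_two hδ.le hδ1.le]
  -- A correct guess has weight at least 1 - δ. A wrong one has weight δ/K, whose logarithm is only
  -- lowered by adding log(1 - δ) ≤ 0.
  have h1 : ∑ ω, p ω * (Real.logb 2 (1 - δ) -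
      (if d ω ≠ k ω then 1 else 0) * (Real.logb 2 K - Real.logb 2 δ)) ≤
      ∑ ω, p ω * Real.logb 2 ((1 - δ) * (if d ω = k ω then 1 else 0) + δ / K) := by
    refine sum_mul_le_of_pos hp.1 fun ω _ => ?_
    by_cases h : d ω = k ω
    · simp only [h, ne_eq, not_true_eq_false, if_false, if_true, zero_mul, sub_zero, mul_one]
      exact Real.logb_le_logb_of_le one_lt_two (by linarith)
        (le_add_of_nonneg_right (div_pos hδ hK').le)
    · simp only [h, ne_eq, not_false_eq_true, if_false, if_true, mul_zero, one_mul, zero_add]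
      rw [Real.logb_div hδ.ne' hK'.ne']
      linarith [Real.logb_nonpos one_lt_two (sub_pos.2 hδ1).le (by linarith : 1 - δ ≤ 1)]
  have h2 : ∑ ω, p ω * (if d ω ≠ k ω then 1 else 0) = prob p {ω | d ω ≠ k ω} := by
    simp [prob, Set.indicator_apply]
  simp_rw [mul_sub, Finset.sum_sub_distrib, ← Finset.sum_mul, ← mul_assoc, ← Finset.sum_mul,
    hp.2, h2] at h1
  have h3 := mul_le_mul_of_nonneg_right herr hL
  linarith

namespace Protocol

variable {Xf Yf Zf Xb Yb Zb : Type*} [Fintype Xf] [Fintype Yf] [Fintype Zf] [Fintype Xb]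
  [Fintype Yb] [Fintype Zb] [Nonempty Xf] [Nonempty Xb]

/-- `condEntropy_add_entropy_le` is applied with U the view of the party that computes the key, V
that of the guessing party, and the two majorants as weights. The entropy of all views together
cancels against the log-likelihood of the run, leaving the divergence already bounded by nC and the
cost of the guess. -/
lemma condEntropy_key_le (prot : Protocol Xf Yf Xb Yb) (Wf : DMBC Xf Yf Zf) (Wb : DMBC Xb Yb Zb)
    {C δ : ℝ} (hf : ∀ P ∈ stdSimplex ℝ Xf, Wf.secretInfo P ≤ C)
    (hb : ∀ P ∈ stdSimplex ℝ Xb, Wb.secretInfo P ≤ C) (hδ : 0 < δ) (hδ1 : δ < 1)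
    (herr : prob (prot.run Wf Wb) {o | prot.keyEst o ≠ prot.key o} ≤ δ) :
    condEntropy (prot.run Wf Wb) prot.key prot.viewE ≤ prot.σ.uses * C +
      (-Real.logb 2 (1 - δ) + δ * (Real.logb 2 prot.keySize - Real.logb 2 δ)) := by
  classical
  have hp := prot.run_mem Wf Wb
  have hne : ∃ o : prot.Outcome Zf Zb, True := by
    by_contra h
    push Not at h
    have : IsEmpty (prot.Outcome Zf Zb) := ⟨fun o => (h o).elim⟩
    simpa using hp.2
  obtain ⟨o, -⟩ := hne
  have hK : 0 < prot.keySize := (prot.key o).pos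
  have hK' : (0 : ℝ) < prot.keySize := by exact_mod_cast hK
  have hfano := crossEntropy_guess_le hp hK prot.key prot.keyEst hδ hδ1 herr
  have hmain := prot.sum_run_mul_logb_le Wf Wb hf hb
  -- The guess is mixed with the uniform law so that no key has weight zero. The mixing weight δ is
  -- the error bound itself.
  let q : Fin prot.keySize → Fin prot.keySize → ℝ :=
    fun d k => (1 - δ) * (if d = k then 1 else 0) + δ / prot.keySize
  have hq : ∀ d k, 0 < q d k := fun d k => by
    have : 0 < δ / prot.keySize := div_pos hδ hK'
    have h1 : 0 < 1 - δ := sub_pos.2 hδ1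
    simp only [q]
    split_ifs <;> linarith
  have hq1 : ∀ d, ∑ k, q d k = 1 := fun d => by
    simp only [q, Finset.sum_add_distrib, ← Finset.mul_sum]
    simp
    field_simp
    ring
  rcases hkey : prot.keyByAlice with _ | _
  · have h := condEntropy_add_entropy_le hp (fun o => (o.b, o.yf)) (fun o => (o.a, o.yb))
      prot.viewE (fun v => prot.outB v.1 v.2) (prot.majorantB Wf Wb) (prot.majorantA Wf Wb)
      (fun u k => q (prot.outA u.1 u.2) k) (prot.majorantB_nonneg Wf Wb)
      (prot.majorantA_nonneg Wf Wb)
      (by simp_rw [mul_comm (∑ u, prot.majorantB Wf Wb u _)]; exact (prot.sum_majorants Wf Wb).le)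
      (fun o h => prot.majorantB_pos Wf Wb h) (fun o h => prot.majorantA_pos Wf Wb h)
      (fun u k => hq _ _) (fun u => hq1 _)
    have hk : (fun o : prot.Outcome Zf Zb => prot.outB o.b o.yf) = prot.key := by
      ext o; simp [key, hkey]
    have hd : ∀ o : prot.Outcome Zf Zb, prot.keyEst o = prot.outA o.a o.yb := by
      intro o; simp [keyEst, hkey]
    have hk' : ∀ o : prot.Outcome Zf Zb, prot.key o = prot.outB o.b o.yf := by
      intro o; simp [key, hkey]
    rw [entropy_eq_sum] at h
    -- The three views together determine the outcome, so their joint law is the law of the run.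
    have hinj : Function.Injective (pair (fun o : prot.Outcome Zf Zb => (o.b, o.yf))
        (pair (fun o => (o.a, o.yb)) prot.viewE)) := by
      rintro ⟨⟩ ⟨⟩ h
      simp [pair, viewE] at h
      simp [h]
    simp_rw [law_of_injective _ hinj] at h
    simp only [hk, hk', hd] at h hfano ⊢
    simp_rw [mul_comm (prot.majorantB Wf Wb _ _)] at h
    simp only [viewE, q] at h hmain hfano ⊢
    linarith
  · have h := condEntropy_add_entropy_le hp (fun o => (o.a, o.yb)) (fun o => (o.b, o.yf))
      prot.viewE (fun v => prot.outA v.1 v.2) (prot.majorantA Wf Wb) (prot.majorantB Wf Wb)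
      (fun u k => q (prot.outB u.1 u.2) k) (prot.majorantA_nonneg Wf Wb)
      (prot.majorantB_nonneg Wf Wb) (prot.sum_majorants Wf Wb).le
      (fun o h => prot.majorantA_pos Wf Wb h) (fun o h => prot.majorantB_pos Wf Wb h)
      (fun u k => hq _ _) (fun u => hq1 _)
    have hk : (fun o : prot.Outcome Zf Zb => prot.outA o.a o.yb) = prot.key := by
      ext o; simp [key, hkey]
    have hd : ∀ o : prot.Outcome Zf Zb, prot.keyEst o = prot.outB o.b o.yf := by
      intro o; simp [keyEst, hkey]
    have hk' : ∀ o : prot.Outcome Zf Zb, prot.key o = prot.outA o.a o.yb := by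
      intro o; simp [key, hkey]
    rw [entropy_eq_sum] at h
    have hinj : Function.Injective (pair (fun o : prot.Outcome Zf Zb => (o.a, o.yb))
        (pair (fun o => (o.b, o.yf)) prot.viewE)) := by
      rintro ⟨⟩ ⟨⟩ h
      simp [pair, viewE] at h
      simp [h]
    simp_rw [law_of_injective _ hinj] at h
    simp only [hk, hk', hd] at h hfano ⊢
    simp only [viewE, q] at h hmain hfano ⊢
    linarith

/-- Secrecy gives (1 - δ) H(S) < H(S|View_E), which is at most nC plus Fano's terms. Among these δ
log|S| is absorbed by near-uniformity, log|S| < H(S) + nδ, and this turns 1 - δ into 1 - 2δ. Since δ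
< 1/2, the rate bound H(S) > n(R - δ) may then be inserted. -/
lemma Secure.lt {prot : Protocol Xf Yf Xb Yb} {Wf : DMBC Xf Yf Zf} {Wb : DMBC Xb Yb Zb}
    {C R δ : ℝ} (h : prot.Secure Wf Wb R δ) (hf : ∀ P ∈ stdSimplex ℝ Xf, Wf.secretInfo P ≤ C)
    (hb : ∀ P ∈ stdSimplex ℝ Xb, Wb.secretInfo P ≤ C) (hδ : 0 < δ) (hδ2 : δ < 1 / 2) :
    (1 - 2 * δ) * (R - δ) ≤
      C + (-Real.logb 2 (1 - δ) - δ * Real.logb 2 δ) + δ ^ 2 := by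
  have hp := prot.run_mem Wf Wb
  have hk := prot.condEntropy_key_le Wf Wb hf hb hδ (by linarith) h.reliable.le
  have hn : (1 : ℝ) ≤ prot.σ.uses := by exact_mod_cast h.uses_pos
  have hn0 : (0 : ℝ) < prot.σ.uses := by linarith
  have hu := h.uniform
  have hr := h.rate
  have hs := h.secret
  have hu' : Real.logb 2 prot.keySize < entropy (prot.run Wf Wb) prot.key + prot.σ.uses * δ := by
    rw [sub_lt_iff_lt_add, div_add' _ _ _ hn0.ne', div_lt_div_iff_of_pos_right hn0] at hu
    linarith
  rw [lt_div_iff₀ hn0] at hr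
  have hH : 0 < entropy (prot.run Wf Wb) prot.key := by
    refine (entropy_nonneg hp _).lt_of_ne' fun h0 => ?_
    rw [h0, div_zero] at hs
    linarith
  rw [lt_div_iff₀ hH] at hs
  have hA : 0 ≤ -Real.logb 2 (1 - δ) - δ * Real.logb 2 δ := by
    have h1 := Real.logb_nonpos one_lt_two (by linarith : 0 ≤ 1 - δ) (by linarith : 1 - δ ≤ 1)
    have h2 := mul_nonpos_of_nonneg_of_nonpos hδ.le
      (Real.logb_nonpos one_lt_two hδ.le (by linarith : δ ≤ 1))
    linarith
  have h1 := mul_lt_mul_of_pos_left hu' hδ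
  have h2 := mul_le_mul_of_nonneg_left hr.le (by linarith : 0 ≤ 1 - 2 * δ)
  -- Fano's constant terms do not grow with n. As n ≥ 1 and they are nonnegative, they may be
  -- multiplied by n before dividing by it.
  have h3 := mul_le_mul_of_nonneg_right hn hA
  refine le_of_mul_le_mul_left ?_ hn0
  linarith

end Protocol

/-- The general upper bound on the achievable rates. -/
lemma Achievable.le {Xf Yf Zf Xb Yb Zb : Type*} [Fintype Xf] [Fintype Yf] [Fintype Zf]
    [Fintype Xb] [Fintype Yb] [Fintype Zb] [Nonempty Xf] [Nonempty Xb]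
    {Wf : DMBC Xf Yf Zf} {Wb : DMBC Xb Yb Zb} {C R : ℝ} (h : Achievable Wf Wb R)
    (hf : ∀ P ∈ stdSimplex ℝ Xf, Wf.secretInfo P ≤ C)
    (hb : ∀ P ∈ stdSimplex ℝ Xb, Wb.secretInfo P ≤ C) : R ≤ C := by
  have h1 : Filter.Tendsto (fun δ : ℝ => (1 - 2 * δ) * (R - δ)) (nhdsWithin 0 (Set.Ioi 0))
      (nhds R) := by
    have : ContinuousAt (fun δ : ℝ => (1 - 2 * δ) * (R - δ)) 0 := by fun_prop
    simpa using this.tendsto.mono_left nhdsWithin_le_nhds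
  have h2 : Filter.Tendsto (fun δ : ℝ => C + (-Real.logb 2 (1 - δ) - δ * Real.logb 2 δ) + δ ^ 2)
      (nhdsWithin 0 (Set.Ioi 0)) (nhds C) := by
    have : ContinuousAt
        (fun δ : ℝ => C + (-Real.logb 2 (1 - δ) - δ * Real.logb 2 δ) + δ ^ 2) 0 := by
      have e : ∀ δ : ℝ, δ * Real.logb 2 δ = δ * Real.log δ / Real.log 2 := fun δ => by
        rw [Real.logb]; ring
      simp_rw [e]
      have c1 : ContinuousAt (fun δ : ℝ => Real.logb 2 (1 - δ)) 0 := by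
        unfold Real.logb
        refine ContinuousAt.div_const (ContinuousAt.log (by fun_prop) (by norm_num)) _
      have c2 : ContinuousAt (fun δ : ℝ => δ * Real.log δ / Real.log 2) 0 :=
        (Real.continuous_mul_log.div_const _).continuousAt
      exact (continuousAt_const.add (c1.neg.sub c2)).add (by fun_prop)
    simpa using this.tendsto.mono_left nhdsWithin_le_nhds
  refine le_of_tendsto_of_tendsto h1 h2 ?_
  filter_upwards [Ioo_mem_nhdsGT (by norm_num : (0 : ℝ) < 1 / 2)] with δ hδ
  obtain ⟨prot, hprot⟩ := h.2 δ hδ.1 (by linarith [hδ.2])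
  exact hprot.lt hf hb hδ.1 hδ.2

end TwoWaySKE
-- Random coding: packing and soft covering
namespace TwoWaySKE

section Iid

variable {ι A : Type*} [Fintype ι] [DecidableEq ι] [Fintype A] {P : A → ℝ}

lemma sum_prod_iid (hP : ∑ a, P a = 1) : ∑ c : ι → A, ∏ j, P (c j) = 1 := by
  have := Finset.prod_univ_sum (fun _ : ι => (Finset.univ : Finset A)) (fun _ a => P a)
  simpa [hP] using this.symm

lemma sum_prod_iid_mul (hP : ∑ a, P a = 1) (i : ι) (f : A → ℝ) :
    ∑ c : ι → A, (∏ j, P (c j)) * f (c i) = ∑ a, P a * f a := by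
  have h := sum_mul_apply_congr i (Φ := fun c => ∏ j ∈ Finset.univ.erase i, P (c j))
    (k := fun _ a => P a * f a) (k' := fun _ a => P a * ∑ b, P b * f b)
    (fun c a => Finset.prod_congr rfl fun j hj => by
      rw [Function.update_of_ne (Finset.ne_of_mem_erase hj)])
    (fun _ _ => rfl) (fun _ _ => rfl) (fun _ => by rw [← Finset.sum_mul, hP, one_mul])
  have e : ∀ c : ι → A, ∏ j, P (c j) = (∏ j ∈ Finset.univ.erase i, P (c j)) * P (c i) :=
    fun c => (Finset.prod_erase_mul _ _ (Finset.mem_univ i)).symm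
  calc _ = ∑ c : ι → A, (∏ j ∈ Finset.univ.erase i, P (c j)) * (P (c i) * f (c i)) := by
        simp_rw [e, mul_assoc]
    _ = _ := h
    _ = (∑ c : ι → A, ∏ j, P (c j)) * ∑ b, P b * f b := by
        simp_rw [← mul_assoc, ← e, ← Finset.sum_mul]
    _ = _ := by rw [sum_prod_iid hP, one_mul]

lemma sum_prod_iid_mul_pair (hP : ∑ a, P a = 1) {i j : ι} (hij : i ≠ j) (f : A → A → ℝ) :
    ∑ c : ι → A, (∏ j, P (c j)) * f (c i) (c j) = ∑ a, P a * ∑ b, P b * f a b := by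
  have h := sum_mul_apply_congr j (Φ := fun c => ∏ j' ∈ Finset.univ.erase j, P (c j'))
    (k := fun c b => P b * f (c i) b) (k' := fun c b => P b * ∑ b', P b' * f (c i) b')
    (fun c a => Finset.prod_congr rfl fun j' hj => by
      rw [Function.update_of_ne (Finset.ne_of_mem_erase hj)])
    (fun c a => by simp [Function.update_of_ne hij])
    (fun c a => by simp [Function.update_of_ne hij])
    (fun _ => by rw [← Finset.sum_mul, hP, one_mul])
  have e : ∀ c : ι → A, ∏ j, P (c j) = (∏ j' ∈ Finset.univ.erase j, P (c j')) * P (c j) :=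
    fun c => (Finset.prod_erase_mul _ _ (Finset.mem_univ j)).symm
  calc _ = ∑ c : ι → A, (∏ j' ∈ Finset.univ.erase j, P (c j')) * (P (c j) * f (c i) (c j)) := by
        simp_rw [e, mul_assoc]
    _ = _ := h
    _ = ∑ c : ι → A, (∏ j, P (c j)) * ∑ b, P b * f (c i) b := by simp_rw [← mul_assoc, ← e]
    _ = _ := sum_prod_iid_mul hP i fun a => ∑ b, P b * f a b

/-- The second moment of a sum of centred i.i.d. variables. -/
lemma sum_prod_iid_mul_sq (hP : ∑ a, P a = 1) {φ : A → ℝ} (hφ : ∑ a, P a * φ a = 0) :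
    ∑ c : ι → A, (∏ j, P (c j)) * (∑ i, φ (c i)) ^ 2 =
      Fintype.card ι * ∑ a, P a * φ a ^ 2 := by
  simp_rw [sq, Finset.sum_mul_sum, Finset.mul_sum]
  rw [Finset.sum_comm]
  have : ∀ i : ι, ∑ c : ι → A, ∑ j, (∏ j, P (c j)) * (φ (c i) * φ (c j)) =
      ∑ a, P a * (φ a * φ a) := by
    intro i
    rw [Finset.sum_comm, Finset.sum_eq_single i]
    · exact sum_prod_iid_mul hP i fun a => φ a * φ a
    · intro j _ hj
      rw [sum_prod_iid_mul_pair hP hj.symm fun a b => φ a * φ b]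
      simp_rw [mul_left_comm (P _) (φ _), ← Finset.mul_sum, hφ]
      simp
    · simp
  rw [Finset.sum_congr rfl fun i _ => this i, Finset.sum_const, Finset.card_univ, nsmul_eq_mul,
    Finset.mul_sum]

end Iid

section RandomCoding

variable {J A B : Type*} [Fintype J] [DecidableEq J] [Fintype A]
  {P : A → ℝ} {κ : A → B → ℝ}

/-- The law of the output of the channel `κ` when the input has law `P`. -/
def outputLaw (κ : A → B → ℝ) (P : A → ℝ) (b : B) : ℝ := ∑ a, P a * κ a b

lemma outputLaw_nonneg (hP : ∀ a, 0 ≤ P a) (hκ : ∀ a b, 0 ≤ κ a b) (b : B) :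
    0 ≤ outputLaw κ P b := Finset.sum_nonneg fun _ _ => mul_nonneg (hP _) (hκ _ _)

lemma sum_outputLaw [Fintype B] (hP : ∑ a, P a = 1) (hκ1 : ∀ a, ∑ b, κ a b = 1) :
    ∑ b, outputLaw κ P b = 1 := by
  simp_rw [outputLaw]
  rw [Finset.sum_comm]
  simp_rw [← Finset.mul_sum, hκ1, mul_one, hP]

lemma outputLaw_pos (hP : ∀ a, 0 ≤ P a) (hκ : ∀ a b, 0 ≤ κ a b) {a : A} {b : B} (ha : 0 < P a)
    (hb : 0 < κ a b) : 0 < outputLaw κ P b :=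
  (mul_pos ha hb).trans_le (Finset.single_le_sum (f := fun a => P a * κ a b)
    (fun _ _ => mul_nonneg (hP _) (hκ _ _)) (Finset.mem_univ a))

variable [Fintype B]

lemma sum_mul_sum_mul_comm (P : A → ℝ) (G : A → A → ℝ) :
    ∑ a, P a * ∑ a', P a' * G a a' = ∑ a', P a' * ∑ a, P a * G a a' := by
  simp_rw [Finset.mul_sum]
  rw [Finset.sum_comm]
  refine Finset.sum_congr rfl fun a' _ => Finset.sum_congr rfl fun a _ => by ring

lemma sum_mul_sum_mul_eq_outputLaw (κ : A → B → ℝ) (P : A → ℝ) (G : B → ℝ) :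
    ∑ a, P a * ∑ b, κ a b * G b = ∑ b, outputLaw κ P b * G b := by
  simp_rw [outputLaw, Finset.sum_mul, Finset.mul_sum]
  rw [Finset.sum_comm]
  simp_rw [mul_assoc]

open Classical in
/-- The union bound on the probability that the codeword `c j` is confused with another one by
a decoder that compares the likelihood ratio with the threshold `γ`. -/
noncomputable def packingBound (κ : A → B → ℝ) (P : A → ℝ) (γ : ℝ) (c : J → A) (j : J) : ℝ :=
  ∑ b, κ (c j) b * ((if κ (c j) b ≤ γ * outputLaw κ P b then 1 else 0) +
    ∑ j' ∈ Finset.univ.erase j, if γ * outputLaw κ P b < κ (c j') b then 1 else 0)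

/-- The probability that the likelihood ratio stays below the threshold `γ`. -/
noncomputable def outageProb (κ : A → B → ℝ) (P : A → ℝ) (γ : ℝ) : ℝ :=
  ∑ a, P a * ∑ b, κ a b * (if κ a b ≤ γ * outputLaw κ P b then 1 else 0)

lemma packingBound_nonneg (hκ : ∀ a b, 0 ≤ κ a b) (γ : ℝ) (c : J → A) (j : J) :
    0 ≤ packingBound κ P γ c j := by
  refine Finset.sum_nonneg fun b _ => mul_nonneg (hκ _ _) (add_nonneg ?_
    (Finset.sum_nonneg fun j' _ => ?_)) <;> split_ifs <;> norm_num

/-- A competing codeword is independent of the channel output, so its likelihood ratio has mean 1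
and exceeds γ with probability at most 1/γ. -/
lemma sum_prod_mul_packingBound_le (hP : P ∈ stdSimplex ℝ A) (hκ : ∀ a b, 0 ≤ κ a b)
    (hκ1 : ∀ a, ∑ b, κ a b = 1) {γ : ℝ} (hγ : 0 < γ) (j : J) :
    ∑ c : J → A, (∏ j, P (c j)) * packingBound κ P γ c j ≤
      outageProb κ P γ + Fintype.card J / γ := by
  classical
  have e : ∀ c : J → A, (∏ j, P (c j)) * packingBound κ P γ c j =
      (∏ j, P (c j)) * (∑ b, κ (c j) b * (if κ (c j) b ≤ γ * outputLaw κ P b then 1 else 0)) +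
      ∑ j' ∈ Finset.univ.erase j, (∏ j, P (c j)) *
        (∑ b, κ (c j) b * if γ * outputLaw κ P b < κ (c j') b then 1 else 0) := by
    intro c
    rw [packingBound, ← Finset.mul_sum, ← mul_add, Finset.sum_comm, ← Finset.sum_add_distrib]
    simp_rw [mul_add, Finset.mul_sum]
  simp_rw [e, Finset.sum_add_distrib]
  rw [sum_prod_iid_mul hP.2 j fun a => ∑ b, κ a b * if κ a b ≤ γ * outputLaw κ P b then 1 else 0]
  refine add_le_add le_rfl ?_
  rw [Finset.sum_comm]
  have hb : ∀ j' ∈ Finset.univ.erase j, ∑ c : J → A, (∏ j, P (c j)) *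
      (∑ b, κ (c j) b * if γ * outputLaw κ P b < κ (c j') b then 1 else 0) ≤ 1 / γ := by
    intro j' hj'
    rw [sum_prod_iid_mul_pair hP.2 (Finset.ne_of_mem_erase hj').symm
      fun a a' => ∑ b, κ a b * if γ * outputLaw κ P b < κ a' b then 1 else 0]
    rw [sum_mul_sum_mul_comm]
    simp_rw [sum_mul_sum_mul_eq_outputLaw]
    have hI : ∀ a' b, outputLaw κ P b * (if γ * outputLaw κ P b < κ a' b then 1 else 0) ≤
        κ a' b / γ := by
      intro a' b
      split_ifs with h
      · rw [le_div_iff₀ hγ]; linarith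
      · simpa using div_nonneg (hκ _ _) hγ.le
    calc _ ≤ ∑ a', P a' * ∑ b, κ a' b / γ := Finset.sum_le_sum fun a' _ =>
          mul_le_mul_of_nonneg_left (Finset.sum_le_sum fun b _ => hI a' b) (hP.1 _)
      _ = 1 / γ := by simp_rw [← Finset.sum_div, hκ1, ← Finset.sum_mul, hP.2, one_mul]
  refine (Finset.sum_le_card_nsmul _ _ _ hb).trans ?_
  rw [nsmul_eq_mul, mul_one_div]
  refine div_le_div_of_nonneg_right ?_ hγ.le
  exact_mod_cast (Finset.card_erase_le).trans_eq Finset.card_univ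

/-- The divergence from the output law of the output of the subcode to which `c j` belongs,
restricted to the codeword `c j`. -/
noncomputable def subcodeLeak {K : ℕ} (κ : A → B → ℝ) (P : A → ℝ) (M : ℕ) (key : J → Fin K)
    (c : J → A) (j : J) : ℝ :=
  ∑ b, κ (c j) b * Real.logb 2
    ((∑ j', if key j' = key j then κ (c j') b else 0) / (M * outputLaw κ P b))

/-- The bound on the mean divergence of soft covering with `M` codewords. -/
noncomputable def coveringBound (κ : A → B → ℝ) (P : A → ℝ) (M : ℕ) : ℝ :=
  ∑ a, P a * ∑ b, κ a b * Real.logb 2 (1 + κ a b / (M * outputLaw κ P b))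

/-- Given the codeword `c j`, each of the other M - 1 codewords of its subcode adds at most 1/M to
the mean likelihood ratio. By concavity of the logarithm the mean may be taken inside, where the own
codeword and a constant 1 remain. -/
lemma sum_prod_mul_subcodeLeak_le {K M : ℕ} (hP : P ∈ stdSimplex ℝ A) (hκ : ∀ a b, 0 ≤ κ a b)
    (hM : 0 < M) (key : J → Fin K) (j : J)
    (hkey : (Finset.univ.filter fun j' => key j' = key j).card = M) :
    ∑ c : J → A, (∏ j, P (c j)) * subcodeLeak κ P M key c j ≤ coveringBound κ P M := by
  have hM' : (0 : ℝ) < M := by exact_mod_cast hM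
  have hl2 := Real.log_pos one_lt_two
  let t : A → B → ℝ := fun a b => 1 + κ a b / (M * outputLaw κ P b)
  let S : Finset J := (Finset.univ.filter fun j' => key j' = key j).erase j
  have hout := outputLaw_nonneg (P := P) hP.1 hκ
  have ht : ∀ a b, 1 ≤ t a b := fun a b =>
    le_add_of_nonneg_right (div_nonneg (hκ _ _) (mul_nonneg hM'.le (hout b)))
  -- The slope of log₂ at `t`, weighted by the channel. As the ratio `T` equals t - 1 plus the
  -- contribution of the other codewords, the correction T/t - 1 is that contribution minus 1, times
  -- 1/t, and its mean is not positive.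
  let G : A → B → ℝ := fun a b => κ a b / (t a b * Real.log 2)
  have hG : ∀ a b, 0 ≤ G a b := fun a b =>
    div_nonneg (hκ _ _) (mul_nonneg (zero_le_one.trans (ht _ _)) hl2.le)
  have hw : ∀ c : J → A, 0 ≤ ∏ j, P (c j) := fun c => Finset.prod_nonneg fun j _ => hP.1 _
  -- the tangent of the logarithm at `t`
  have hpt : ∀ c : J → A, (∏ j, P (c j)) * subcodeLeak κ P M key c j ≤
      (∏ j, P (c j)) * (∑ b, κ (c j) b * Real.logb 2 (t (c j) b)) +
      (∑ j' ∈ S, (∏ j, P (c j)) * (∑ b, G (c j) b * (κ (c j') b / (M * outputLaw κ P b))) -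
        (∏ j, P (c j)) * ∑ b, G (c j) b) := by
    intro c
    rw [← Finset.mul_sum, ← mul_sub, ← mul_add]
    refine (hw c).eq_or_lt.elim (fun h => by simp [← h]) fun hc => ?_
    refine mul_le_mul_of_nonneg_left ?_ (hw c)
    rw [Finset.sum_comm, ← Finset.sum_sub_distrib, ← Finset.sum_add_distrib]
    refine Finset.sum_le_sum fun b _ => ?_
    rw [← Finset.mul_sum]
    rcases (hκ (c j) b).eq_or_lt with h0 | h0
    · simp [← h0, G]
    have hPj : 0 < P (c j) := (hP.1 _).lt_of_ne' fun h => hc.ne'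
      (Finset.prod_eq_zero (Finset.mem_univ j) h)
    have ho := outputLaw_pos hP.1 hκ hPj h0
    have hMo := mul_pos hM' ho
    set T := (∑ j', if key j' = key j then κ (c j') b else 0) / (M * outputLaw κ P b) with hT
    have hsum : T = t (c j) b - 1 + ∑ j' ∈ S, κ (c j') b / (M * outputLaw κ P b) := by
      rw [hT, ← Finset.sum_filter, ← Finset.add_sum_erase _ _
        (show j ∈ Finset.univ.filter fun j' => key j' = key j by simp), add_div, Finset.sum_div]
      simp [t, S]
    have hSnn : 0 ≤ ∑ j' ∈ S, κ (c j') b / (M * outputLaw κ P b) :=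
      Finset.sum_nonneg fun _ _ => div_nonneg (hκ _ _) hMo.le
    have hTpos : 0 < T := by
      rw [hsum]
      have : 0 < κ (c j) b / (M * outputLaw κ P b) := div_pos h0 hMo
      simp only [t]
      linarith
    have ht0 : 0 < t (c j) b := zero_lt_one.trans_le (ht _ _)
    have hlog : Real.logb 2 T ≤ Real.logb 2 (t (c j) b) + (T / t (c j) b - 1) / Real.log 2 := by
      have := logb_two_le_sub_one_div (div_pos hTpos ht0)
      rw [Real.logb_div hTpos.ne' ht0.ne'] at this
      linarith
    have hgoal : κ (c j) b * (Real.logb 2 (t (c j) b) + (T / t (c j) b - 1) / Real.log 2) =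
        κ (c j) b * Real.logb 2 (t (c j) b) +
          (G (c j) b * ∑ j' ∈ S, κ (c j') b / (M * outputLaw κ P b) - G (c j) b) := by
      have : ∑ j' ∈ S, κ (c j') b / (M * outputLaw κ P b) = T - t (c j) b + 1 := by
        rw [hsum]; ring
      rw [this]
      simp only [G]
      field_simp
      ring
    exact (mul_le_mul_of_nonneg_left hlog h0.le).trans_eq hgoal
  refine (Finset.sum_le_sum fun c _ => hpt c).trans ?_
  rw [Finset.sum_add_distrib, Finset.sum_sub_distrib, Finset.sum_comm,
    sum_prod_iid_mul hP.2 j fun a => ∑ b, κ a b * Real.logb 2 (t a b),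
    sum_prod_iid_mul hP.2 j fun a => ∑ b, G a b]
  have hpair : ∀ j' ∈ S, ∑ c : J → A, (∏ j, P (c j)) *
      (∑ b, G (c j) b * (κ (c j') b / (M * outputLaw κ P b))) ≤
      (∑ a, P a * ∑ b, G a b) / M := by
    intro j' hj'
    rw [sum_prod_iid_mul_pair hP.2 (Finset.ne_of_mem_erase hj').symm
      fun a a' => ∑ b, G a b * (κ a' b / (M * outputLaw κ P b)), Finset.sum_div]
    refine Finset.sum_le_sum fun a _ => ?_
    rw [mul_div_assoc]
    refine mul_le_mul_of_nonneg_left ?_ (hP.1 a)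
    have e : ∀ a' b, G a b * (κ a' b / (M * outputLaw κ P b)) =
        κ a' b * (G a b / (M * outputLaw κ P b)) := fun a' b => by ring
    simp_rw [e]
    rw [sum_mul_sum_mul_eq_outputLaw κ P fun b => G a b / (M * outputLaw κ P b), Finset.sum_div]
    refine Finset.sum_le_sum fun b _ => ?_
    rcases (hout b).eq_or_lt with h0 | h0
    · rw [← h0, zero_mul]
      exact div_nonneg (hG _ _) hM'.le
    · refine le_of_eq ?_
      field_simp
  have hcard : (S.card : ℝ) ≤ M := by
    have : S.card ≤ M := Finset.card_erase_le.trans_eq hkey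
    exact_mod_cast this
  have hg : 0 ≤ ∑ a, P a * ∑ b, G a b :=
    Finset.sum_nonneg fun a _ => mul_nonneg (hP.1 _) (Finset.sum_nonneg fun b _ => hG _ _)
  have hS := Finset.sum_le_card_nsmul S _ _ hpair
  rw [nsmul_eq_mul] at hS
  have h1 : (S.card : ℝ) * ((∑ a, P a * ∑ b, G a b) / M) ≤ ∑ a, P a * ∑ b, G a b := by
    rw [← mul_div_assoc, div_le_iff₀ hM', mul_comm]
    exact mul_le_mul_of_nonneg_left hcard hg
  have h2 : ∑ a, P a * ∑ b, κ a b * Real.logb 2 (t a b) = coveringBound κ P M := rfl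
  linarith

end RandomCoding

end TwoWaySKE
-- Memoryless extensions: second-moment bounds for packing and covering
namespace TwoWaySKE

section Blocks

variable {ι A B : Type*} [Fintype ι] [Fintype A] [Fintype B]
  {P : A → ℝ} {κ : A → B → ℝ}

/-- The memoryless extension of the channel `κ`. -/
def blockKernel (ι : Type*) [Fintype ι] (κ : A → B → ℝ) (x : ι → A) (y : ι → B) : ℝ :=
  ∏ i, κ (x i) (y i)

/-- The law of an i.i.d. sequence. -/
def blockLaw (ι : Type*) [Fintype ι] (P : A → ℝ) (x : ι → A) : ℝ := ∏ i, P (x i)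

/-- The information density of the channel `κ` with input law `P`. -/
noncomputable def infoDensity (κ : A → B → ℝ) (P : A → ℝ) (w : A × B) : ℝ :=
  Real.logb 2 (κ w.1 w.2 / outputLaw κ P w.2)

/-- The mean of the information density, i.e. the mutual information of input and output. -/
noncomputable def infoMean (κ : A → B → ℝ) (P : A → ℝ) : ℝ :=
  ∑ w : A × B, P w.1 * κ w.1 w.2 * infoDensity κ P w

/-- The variance of the information density. -/
noncomputable def infoVar (κ : A → B → ℝ) (P : A → ℝ) : ℝ :=
  ∑ w : A × B, P w.1 * κ w.1 w.2 * (infoDensity κ P w - infoMean κ P) ^ 2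

lemma infoVar_nonneg (hP : ∀ a, 0 ≤ P a) (hκ : ∀ a b, 0 ≤ κ a b) : 0 ≤ infoVar κ P :=
  Finset.sum_nonneg fun _ _ => mul_nonneg (mul_nonneg (hP _) (hκ _ _)) (sq_nonneg _)

variable [DecidableEq ι]

lemma blockLaw_mem (hP : P ∈ stdSimplex ℝ A) : blockLaw ι P ∈ stdSimplex ℝ (ι → A) :=
  ⟨fun _ => Finset.prod_nonneg fun _ _ => hP.1 _, sum_prod_iid hP.2⟩

lemma sum_prod_apply (f : ι → B → ℝ) : ∑ y : ι → B, ∏ i, f i (y i) = ∏ i, ∑ b, f i b := by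
  simpa using (Finset.prod_univ_sum (fun _ : ι => (Finset.univ : Finset B)) f).symm

omit [Fintype B] in
lemma outputLaw_block (y : ι → B) :
    outputLaw (blockKernel ι κ) (blockLaw ι P) y = ∏ i, outputLaw κ P (y i) := by
  simp_rw [outputLaw, blockKernel, blockLaw, ← Finset.prod_mul_distrib]
  exact sum_prod_apply fun i a => P a * κ a (y i)

lemma sum_block_mul (F : (ι → A) → (ι → B) → ℝ) :
    ∑ x, blockLaw ι P x * ∑ y, blockKernel ι κ x y * F x y =
      ∑ w : ι → A × B, (∏ i, P (w i).1 * κ (w i).1 (w i).2) *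
        F (fun i => (w i).1) (fun i => (w i).2) := by
  simp_rw [Finset.mul_sum]
  rw [← Fintype.sum_prod_type']
  refine Fintype.sum_equiv (Equiv.arrowProdEquivProdArrow ι (fun _ => A) (fun _ => B)).symm _ _ ?_
  rintro ⟨x, y⟩
  simp [blockLaw, blockKernel, Finset.prod_mul_distrib, mul_assoc, Equiv.arrowProdEquivProdArrow]

/-- Chebyshev's sum: the second moment of the deviation of the information density. -/
lemma sum_block_sq (hP : P ∈ stdSimplex ℝ A) (hκ1 : ∀ a, ∑ b, κ a b = 1) :
    ∑ w : ι → A × B, (∏ i, P (w i).1 * κ (w i).1 (w i).2) *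
      (∑ i, (infoDensity κ P (w i) - infoMean κ P)) ^ 2 = Fintype.card ι * infoVar κ P := by
  have h1 : ∑ w : A × B, P w.1 * κ w.1 w.2 = 1 := by
    rw [Fintype.sum_prod_type]
    simp_rw [← Finset.mul_sum, hκ1, mul_one, hP.2]
  have h2 : ∑ w : A × B, P w.1 * κ w.1 w.2 * (infoDensity κ P w - infoMean κ P) = 0 := by
    simp_rw [mul_sub, Finset.sum_sub_distrib, ← Finset.sum_mul, h1]
    rw [infoMean, one_mul, sub_self]
  have h3 := sum_prod_iid_mul_sq (ι := ι) (P := fun w : A × B => P w.1 * κ w.1 w.2)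
    (φ := fun w => infoDensity κ P w - infoMean κ P) h1 h2
  exact h3

omit [Fintype B] in
lemma logb_block_ratio (hP : ∀ a, 0 ≤ P a) (hκ : ∀ a b, 0 ≤ κ a b) {w : ι → A × B}
    (hw : 0 < ∏ i, P (w i).1 * κ (w i).1 (w i).2) :
    0 < blockKernel ι κ (fun i => (w i).1) (fun i => (w i).2) ∧
    0 < outputLaw (blockKernel ι κ) (blockLaw ι P) (fun i => (w i).2) ∧
    Real.logb 2 (blockKernel ι κ (fun i => (w i).1) (fun i => (w i).2) /
      outputLaw (blockKernel ι κ) (blockLaw ι P) (fun i => (w i).2)) =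
      ∑ i, infoDensity κ P (w i) := by
  have h0 : ∀ i, P (w i).1 ≠ 0 ∧ κ (w i).1 (w i).2 ≠ 0 := fun i => by
    have := fun h => hw.ne' (Finset.prod_eq_zero (Finset.mem_univ i) h)
    exact mul_ne_zero_iff.1 this
  have h1 : ∀ i, 0 < κ (w i).1 (w i).2 := fun i => (hκ _ _).lt_of_ne' (h0 i).2
  have h2 : ∀ i, 0 < outputLaw κ P (w i).2 := fun i =>
    outputLaw_pos hP hκ ((hP _).lt_of_ne' (h0 i).1) (h1 i)
  refine ⟨Finset.prod_pos fun i _ => h1 i, ?_, ?_⟩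
  · rw [outputLaw_block]; exact Finset.prod_pos fun i _ => h2 i
  · rw [outputLaw_block, blockKernel, ← Finset.prod_div_distrib,
      Real.logb_prod _ _ fun i _ => (div_pos (h1 i) (h2 i)).ne']
    rfl

/-- Chebyshev's inequality for the likelihood ratio. -/
lemma outageProb_block_le (hP : P ∈ stdSimplex ℝ A) (hκ : ∀ a b, 0 ≤ κ a b)
    (hκ1 : ∀ a, ∑ b, κ a b = 1) {ε : ℝ} (hε : 0 < ε) (hn : 0 < Fintype.card ι) :
    outageProb (blockKernel ι κ) (blockLaw ι P)
      (2 ^ (Fintype.card ι * (infoMean κ P - ε) : ℝ)) ≤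
      infoVar κ P / (Fintype.card ι * ε ^ 2) := by
  have hn' : (0 : ℝ) < Fintype.card ι := by exact_mod_cast hn
  have hpos : (0 : ℝ) < (Fintype.card ι * ε) ^ 2 := by positivity
  rw [outageProb, sum_block_mul fun x y => if blockKernel ι κ x y ≤
    2 ^ (Fintype.card ι * (infoMean κ P - ε) : ℝ) *
      outputLaw (blockKernel ι κ) (blockLaw ι P) y then 1 else 0]
  have hle : ∑ w : ι → A × B, (∏ i, P (w i).1 * κ (w i).1 (w i).2) *
      (if blockKernel ι κ (fun i => (w i).1) (fun i => (w i).2) ≤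
        2 ^ (Fintype.card ι * (infoMean κ P - ε) : ℝ) *
          outputLaw (blockKernel ι κ) (blockLaw ι P) (fun i => (w i).2) then 1 else 0) ≤
      ∑ w : ι → A × B, (∏ i, P (w i).1 * κ (w i).1 (w i).2) *
        ((∑ i, (infoDensity κ P (w i) - infoMean κ P)) ^ 2 / (Fintype.card ι * ε) ^ 2) := by
    refine sum_mul_le_of_pos (fun w => Finset.prod_nonneg fun i _ =>
      mul_nonneg (hP.1 _) (hκ _ _)) fun w hw => ?_
    split_ifs with h
    · obtain ⟨h1, h2, h3⟩ := logb_block_ratio hP.1 hκ hw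
      rw [one_le_div hpos]
      have h4 : ∑ i, infoDensity κ P (w i) ≤ Fintype.card ι * (infoMean κ P - ε) := by
        rw [← h3, Real.logb_le_iff_le_rpow one_lt_two (div_pos h1 h2), div_le_iff₀ h2]
        exact h
      rw [Finset.sum_sub_distrib, Finset.sum_const, Finset.card_univ, nsmul_eq_mul]
      refine (pow_le_pow_left₀ (by positivity) ?_ 2).trans_eq (neg_sq _)
      linarith
    · positivity
  refine hle.trans_eq ?_
  simp_rw [← mul_div_assoc, ← Finset.sum_div]
  rw [sum_block_sq hP hκ1]
  field_simp

/-- The left side is at most 1 plus the positive part of log x, and a ≤ a²/(2t) + t/2 replaces that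
part by a quadratic. Only a second moment is then needed to average it. -/
lemma logb_one_add_le {a t : ℝ} (ht : 0 < t) {x : ℝ} (hx : 0 < x) (hxa : Real.logb 2 x ≤ a) :
    Real.logb 2 (1 + x) ≤ 1 + (a ^ 2 / (2 * t) + t / 2) := by
  have h0 : a ≤ a ^ 2 / (2 * t) + t / 2 := by
    rw [div_add_div _ _ (by positivity) (by positivity), le_div_iff₀ (by positivity)]
    nlinarith [sq_nonneg (a - t)]
  have h1 : 0 ≤ a ^ 2 / (2 * t) + t / 2 := by positivity
  have h2 : 1 + x ≤ 2 * 2 ^ (a ^ 2 / (2 * t) + t / 2) := by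
    have h3 : x ≤ 2 ^ (a ^ 2 / (2 * t) + t / 2) := by
      rw [← Real.logb_le_iff_le_rpow one_lt_two hx]; exact hxa.trans h0
    have h4 := Real.one_le_rpow one_le_two h1
    linarith
  calc _ ≤ Real.logb 2 (2 * 2 ^ (a ^ 2 / (2 * t) + t / 2)) :=
        Real.logb_le_logb_of_le one_lt_two (by linarith) h2
    _ = _ := by
        rw [Real.logb_mul two_ne_zero (by positivity), Real.logb_self_eq_one one_lt_two,
          Real.logb_rpow two_pos (by norm_num)]

/-- For M ≥ 2^{nI} the logarithm of the ratio is at most the deviation of the information density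
from its mean, whose second moment is n times the variance. Taking t = nη in `logb_one_add_le` gives
a leak that is linear in n, with slope as small as desired. -/
lemma coveringBound_block_le (hP : P ∈ stdSimplex ℝ A) (hκ : ∀ a b, 0 ≤ κ a b)
    (hκ1 : ∀ a, ∑ b, κ a b = 1) {η : ℝ} (hη : 0 < η) (hn : 0 < Fintype.card ι) {M : ℕ}
    (hM : (2 : ℝ) ^ (Fintype.card ι * infoMean κ P) ≤ M) :
    coveringBound (blockKernel ι κ) (blockLaw ι P) M ≤
      1 + infoVar κ P / (2 * η) + Fintype.card ι * η / 2 := by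
  have hn' : (0 : ℝ) < Fintype.card ι := by exact_mod_cast hn
  have hM0 : (0 : ℝ) < M := (by positivity : (0 : ℝ) < 2 ^ (Fintype.card ι * infoMean κ P)).trans_le
    hM
  rw [coveringBound, sum_block_mul fun x y => Real.logb 2 (1 + blockKernel ι κ x y /
    (M * outputLaw (blockKernel ι κ) (blockLaw ι P) y))]
  have hle : ∑ w : ι → A × B, (∏ i, P (w i).1 * κ (w i).1 (w i).2) *
      Real.logb 2 (1 + blockKernel ι κ (fun i => (w i).1) (fun i => (w i).2) /
        (M * outputLaw (blockKernel ι κ) (blockLaw ι P) (fun i => (w i).2))) ≤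
      ∑ w : ι → A × B, (∏ i, P (w i).1 * κ (w i).1 (w i).2) *
        (1 + ((∑ i, (infoDensity κ P (w i) - infoMean κ P)) ^ 2 / (2 * (Fintype.card ι * η)) +
          Fintype.card ι * η / 2)) := by
    refine sum_mul_le_of_pos (fun w => Finset.prod_nonneg fun i _ =>
      mul_nonneg (hP.1 _) (hκ _ _)) fun w hw => ?_
    obtain ⟨h1, h2, h3⟩ := logb_block_ratio hP.1 hκ hw
    refine logb_one_add_le (by positivity) (by positivity) ?_
    rw [mul_comm (M : ℝ), ← div_div, Real.logb_div (div_pos h1 h2).ne' hM0.ne', h3,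
      Finset.sum_sub_distrib, Finset.sum_const, Finset.card_univ, nsmul_eq_mul]
    have := (Real.le_logb_iff_rpow_le one_lt_two hM0).2 hM
    linarith
  refine hle.trans_eq ?_
  have h1 : ∑ w : ι → A × B, ∏ i, P (w i).1 * κ (w i).1 (w i).2 = 1 := by
    refine sum_prod_iid (P := fun w : A × B => P w.1 * κ w.1 w.2) ?_
    rw [Fintype.sum_prod_type]
    simp_rw [← Finset.mul_sum, hκ1, mul_one, hP.2]
  simp_rw [mul_add, Finset.sum_add_distrib, ← Finset.sum_mul, h1, ← mul_div_assoc,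
    ← Finset.sum_div]
  rw [sum_block_sq hP hκ1]
  field_simp
  ring

end Blocks

end TwoWaySKE
-- One-shot wiretap codes
namespace TwoWaySKE

namespace DMBC

variable {A B E T : Type*} [Fintype B] [Fintype E]

/-- The channel `V` with its input preprocessed by `c`. -/
def comap (V : DMBC A B E) (c : T → A) : DMBC T B E where
  prob t := V.prob (c t)
  prob_mem t := V.prob_mem (c t)

/-- The memoryless extension of a broadcast channel. -/
def block (ι : Type*) [Fintype ι] [DecidableEq ι] (V : DMBC A B E) :
    DMBC (ι → A) (ι → B) (ι → E) where
  prob x b := ∏ i, V.prob (x i) (b.1 i, b.2 i)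
  prob_mem x := by
    refine ⟨fun b => Finset.prod_nonneg fun i _ => V.prob_nonneg _ _, ?_⟩
    refine (Fintype.sum_equiv (Equiv.arrowProdEquivProdArrow ι (fun _ => B) (fun _ => E)).symm
      (fun b => ∏ i, V.prob (x i) (b.1 i, b.2 i)) (fun w : ι → B × E => ∏ i, V.prob (x i) (w i))
      (fun b => rfl)).trans ?_
    rw [sum_prod_apply fun i => V.prob (x i)]
    simp [V.sum_prob]

variable {ι : Type*} [Fintype ι] [DecidableEq ι]

lemma legit_block (V : DMBC A B E) : (V.block ι).legit = blockKernel ι V.legit := by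
  ext x y
  exact sum_prod_apply fun i e => V.prob (x i) (y i, e)

lemma eve_block (V : DMBC A B E) : (V.block ι).eve = blockKernel ι V.eve := by
  ext x z
  exact sum_prod_apply fun i b => V.prob (x i) (b, z i)

variable [Fintype A]

lemma law_joint_snd_fst (V : DMBC A B E) (P : A → ℝ) :
    law (V.joint P) (fun a => a.2.1) = outputLaw V.legit P := by
  ext y
  rw [← sum_law_pair_left (V.joint P) (fun a => a.1) (fun a => a.2.1) y]
  simp_rw [law_joint_legit]
  rfl

lemma law_joint_snd_snd (V : DMBC A B E) (P : A → ℝ) :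
    law (V.joint P) (fun a => a.2.2) = outputLaw V.eve P := by
  ext z
  rw [← sum_law_pair_left (V.joint P) (fun a => a.1) (fun a => a.2.2) z]
  simp_rw [law_joint_eve]
  rfl

lemma infoMean_legit (V : DMBC A B E) {P : A → ℝ} (hP : P ∈ stdSimplex ℝ A) :
    infoMean V.legit P = mutualInfo (V.joint P) (fun a => a.1) (fun a => a.2.1) := by
  have hp := V.joint_mem hP
  rw [mutualInfo, condEntropy_eq_sum, entropy_eq_sum, law_joint_fst, law_joint_snd_fst, infoMean,
    neg_sub_neg, ← Finset.sum_sub_distrib]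
  simp_rw [← mul_sub]
  have e : ∀ w : A × B, P w.1 * V.legit w.1 w.2 =
      law (V.joint P) (pair (fun a => a.1) (fun a => a.2.1)) w := fun w =>
    (V.law_joint_legit P w.1 w.2).symm
  simp_rw [e]
  rw [sum_law_mul]
  refine sum_mul_congr_of_pos hp.1 fun a ha => ?_
  have h1 := V.joint_pos_left hP.1 ha
  have h2 := law_pos hp.1 (pair (fun a => a.1) (fun a => a.2.1)) ha
  have h3 := law_pos hp.1 (fun a => a.2.1) ha
  rw [law_joint_snd_fst] at h3
  rw [show pair (fun a : A × B × E => a.1) (fun a => a.2.1) a = (a.1, a.2.1) from rfl,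
    law_joint_legit] at h2
  rw [law_joint_legit]
  have h4 := pos_of_mul_pos_right h2 h1.le
  rw [infoDensity, pair, Real.logb_div h4.ne' h3.ne', Real.logb_div h2.ne' h3.ne',
    Real.logb_mul h1.ne' h4.ne']
  ring

lemma infoMean_eve (V : DMBC A B E) {P : A → ℝ} (hP : P ∈ stdSimplex ℝ A) :
    infoMean V.eve P = mutualInfo (V.joint P) (fun a => a.1) (fun a => a.2.2) := by
  have hp := V.joint_mem hP
  rw [mutualInfo, condEntropy_eq_sum, entropy_eq_sum, law_joint_fst, law_joint_snd_snd, infoMean,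
    neg_sub_neg, ← Finset.sum_sub_distrib]
  simp_rw [← mul_sub]
  have e : ∀ w : A × E, P w.1 * V.eve w.1 w.2 =
      law (V.joint P) (pair (fun a => a.1) (fun a => a.2.2)) w := fun w =>
    (V.law_joint_eve P w.1 w.2).symm
  simp_rw [e]
  rw [sum_law_mul]
  refine sum_mul_congr_of_pos hp.1 fun a ha => ?_
  have h1 := V.joint_pos_left hP.1 ha
  have h2 := law_pos hp.1 (pair (fun a => a.1) (fun a => a.2.2)) ha
  have h3 := law_pos hp.1 (fun a => a.2.2) ha
  rw [law_joint_snd_snd] at h3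
  rw [show pair (fun a : A × B × E => a.1) (fun a => a.2.2) a = (a.1, a.2.2) from rfl,
    law_joint_eve] at h2
  rw [law_joint_eve]
  have h4 := pos_of_mul_pos_right h2 h1.le
  rw [infoDensity, pair, Real.logb_div h4.ne' h3.ne', Real.logb_div h2.ne' h3.ne',
    Real.logb_mul h1.ne' h4.ne']
  ring

end DMBC

section OneShot

variable {A B E J : Type*} [Fintype B] [Fintype E] [Fintype J]

/-- The decoder takes the key of an arbitrary codeword above the threshold. It can err only if the
sent codeword is below the threshold or a different one is above it, and those are the events
counted in `packingBound`. -/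
lemma exists_decoder_prob_le [Fintype A] [DecidableEq J] (V : DMBC A B E) {K : ℕ} (P : A → ℝ) (γ : ℝ) (key : J → Fin K)
    (c : J → A) {ρ : J → ℝ} (hρ : ∀ j, 0 ≤ ρ j) [Nonempty J] :
    ∃ dec : B → Fin K, prob ((V.comap c).joint ρ) {ω | dec ω.2.1 ≠ key ω.1} ≤
      ∑ j, ρ j * packingBound V.legit P γ c j := by
  classical
  let dec : B → Fin K := fun y =>
    if h : ∃ j, γ * outputLaw V.legit P y < V.legit (c j) y then key h.choose
    else key (Classical.arbitrary J)
  have hdec : ∀ j y, (if dec y ≠ key j then (1 : ℝ) else 0) ≤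
      (if V.legit (c j) y ≤ γ * outputLaw V.legit P y then 1 else 0) +
        ∑ j' ∈ Finset.univ.erase j,
          if γ * outputLaw V.legit P y < V.legit (c j') y then 1 else 0 := by
    intro j y
    have hnn : ∀ j', (0 : ℝ) ≤ if γ * outputLaw V.legit P y < V.legit (c j') y then 1 else 0 :=
      fun j' => by split_ifs <;> norm_num
    have hs : (0 : ℝ) ≤ ∑ j' ∈ Finset.univ.erase j,
        if γ * outputLaw V.legit P y < V.legit (c j') y then 1 else 0 :=
      Finset.sum_nonneg fun j' _ => hnn j'
    by_cases hj : V.legit (c j) y ≤ γ * outputLaw V.legit P y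
    · rw [if_pos hj]
      have : (if dec y ≠ key j then (1 : ℝ) else 0) ≤ 1 := by split_ifs <;> norm_num
      linarith
    · rw [if_neg hj, zero_add]
      have hex : ∃ j, γ * outputLaw V.legit P y < V.legit (c j) y := ⟨j, not_le.1 hj⟩
      have hd : dec y = key hex.choose := dif_pos hex
      by_cases he : hex.choose = j
      · rw [hd, he]
        simp
      · have h1 := Finset.single_le_sum (f := fun j' =>
          if γ * outputLaw V.legit P y < V.legit (c j') y then (1 : ℝ) else 0)
          (fun j' _ => hnn j') (Finset.mem_erase.2 ⟨he, Finset.mem_univ _⟩)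
        simp only [hex.choose_spec, if_true] at h1
        refine le_trans ?_ h1
        split_ifs <;> norm_num
  refine ⟨dec, ?_⟩
  have e : prob ((V.comap c).joint ρ) {ω | dec ω.2.1 ≠ key ω.1} =
      ∑ ω, (V.comap c).joint ρ ω * (if dec ω.2.1 ≠ key ω.1 then 1 else 0) := by
    simp [prob, Set.indicator_apply]
  rw [e, DMBC.sum_joint_mul]
  refine Finset.sum_le_sum fun j _ => mul_le_mul_of_nonneg_left ?_ (hρ j)
  rw [packingBound, Fintype.sum_prod_type]
  refine Finset.sum_le_sum fun y _ => ?_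
  change ∑ z, V.prob (c j) (y, z) * (if dec y ≠ key j then 1 else 0) ≤ V.legit (c j) y * _
  rw [← Finset.sum_mul]
  exact mul_le_mul_of_nonneg_left (hdec j y) (Finset.sum_nonneg fun _ _ => V.prob_nonneg _ _)

variable {K M : ℕ} {key : J → Fin K}

lemma sum_ite_key (hkey : ∀ s, (Finset.univ.filter fun j => key j = s).card = M) (s : Fin K) :
    ∑ j, (if key j = s then ((K : ℝ) * M)⁻¹ else 0) = M * ((K : ℝ) * M)⁻¹ := by
  rw [← Finset.sum_filter, Finset.sum_const, hkey, nsmul_eq_mul]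

lemma const_mem_stdSimplex (hkey : ∀ s, (Finset.univ.filter fun j => key j = s).card = M)
    (hK : 0 < K) (hM : 0 < M) : (fun _ : J => ((K : ℝ) * M)⁻¹) ∈ stdSimplex ℝ J := by
  have hK' : (K : ℝ) ≠ 0 := by exact_mod_cast hK.ne'
  have hM' : (M : ℝ) ≠ 0 := by exact_mod_cast hM.ne'
  refine ⟨fun _ => by positivity, ?_⟩
  have h : ∑ s, ∑ j, (if key j = s then ((K : ℝ) * M)⁻¹ else 0) = ∑ j : J, ((K : ℝ) * M)⁻¹ := by
    rw [Finset.sum_comm]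
    simp
  rw [← h]
  simp_rw [sum_ite_key hkey]
  simp
  field_simp

lemma entropy_key (V : DMBC A B E) (hkey : ∀ s, (Finset.univ.filter fun j => key j = s).card = M)
    (hK : 0 < K) (hM : 0 < M) (c : J → A) :
    entropy ((V.comap c).joint fun _ => ((K : ℝ) * M)⁻¹) (fun ω => key ω.1) = Real.logb 2 K := by
  have hK' : (K : ℝ) ≠ 0 := by exact_mod_cast hK.ne'
  have hM' : (M : ℝ) ≠ 0 := by exact_mod_cast hM.ne'
  have h := entropy_map ((V.comap c).joint fun _ => ((K : ℝ) * M)⁻¹) (fun ω => ω.1) key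
  rw [← h, DMBC.law_joint_fst, entropy]
  simp_rw [law_eq_sum, sum_ite_key hkey]
  have : (M : ℝ) * ((K : ℝ) * M)⁻¹ = (K : ℝ)⁻¹ := by field_simp
  rw [this, Finset.sum_const, Finset.card_univ, Fintype.card_fin, nsmul_eq_mul, Real.logb_inv]
  field_simp

variable [Fintype A]

/-- The key is uniform, so the left side is I(S;Z). Measuring Z against `outputLaw` instead of its
true law can only increase this, by Gibbs' inequality, and gives the mean divergence of the
subcodes. Codewords in the support of P make `outputLaw` positive wherever it is needed. -/
lemma logb_sub_condEntropy_le (V : DMBC A B E) {P : A → ℝ} (hP : P ∈ stdSimplex ℝ A)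
    (hkey : ∀ s, (Finset.univ.filter fun j => key j = s).card = M)
    (hK : 0 < K) (hM : 0 < M) {c : J → A} (hc : ∀ j, 0 < P (c j)) :
    Real.logb 2 K - condEntropy ((V.comap c).joint fun _ => ((K : ℝ) * M)⁻¹)
      (fun ω => key ω.1) (fun ω => ω.2.2) ≤
      ∑ j, ((K : ℝ) * M)⁻¹ * subcodeLeak V.eve P M key c j := by
  have hK' : (0 : ℝ) < K := by exact_mod_cast hK
  have hM' : (0 : ℝ) < M := by exact_mod_cast hM
  have hρ := const_mem_stdSimplex hkey hK hM
  have hp := (V.comap c).joint_mem hρ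
  set p := (V.comap c).joint fun _ => ((K : ℝ) * M)⁻¹ with hp_def
  let T : J → E → ℝ := fun j z => ∑ j', if key j' = key j then V.eve (c j') z else 0
  have hlaw : ∀ j z, law p (pair (fun ω => key ω.1) (fun ω => ω.2.2)) (key j, z) =
      ((K : ℝ) * M)⁻¹ * T j z := by
    intro j z
    have h1 : law p (pair (fun ω => key ω.1) (fun ω => ω.2.2)) =
        law (law p (pair (fun ω => ω.1) (fun ω => ω.2.2))) fun a => (key a.1, a.2) := by
      rw [law_law]; rfl
    classical
    rw [h1, law_eq_sum, Fintype.sum_prod_type, Finset.mul_sum]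
    refine Finset.sum_congr rfl fun j' _ => ?_
    have h2 : ∀ z', law p (pair (fun ω => ω.1) (fun ω => ω.2.2)) (j', z') =
        ((K : ℝ) * M)⁻¹ * V.eve (c j') z' := fun z' => (V.comap c).law_joint_eve _ j' z'
    simp_rw [h2, Prod.mk.injEq, ite_and]
    split_ifs <;> simp
  have hpos : ∀ ω, 0 < p ω → 0 < V.eve (c ω.1) ω.2.2 := fun ω h =>
    ((V.comap c).joint_pos_right h).trans_le (V.prob_le_eve _ _ _)
  have hout : ∀ ω, 0 < p ω → 0 < outputLaw V.eve P ω.2.2 := fun ω h =>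
    outputLaw_pos hP.1 V.eve_nonneg (hc ω.1) (hpos ω h)
  have hT : ∀ ω, 0 < p ω → 0 < T ω.1 ω.2.2 := fun ω h => by
    refine (hpos ω h).trans_le ?_
    refine le_trans (by simp) (Finset.single_le_sum
      (f := fun j' => if key j' = key ω.1 then V.eve (c j') ω.2.2 else 0) (fun j' _ => ?_)
      (Finset.mem_univ ω.1))
    split_ifs
    · exact V.eve_nonneg _ _
    · exact le_rfl
  have hE := entropy_le_crossEntropy hp (fun ω => ω.2.2) (outputLaw V.eve P)
    (outputLaw_nonneg hP.1 V.eve_nonneg) (sum_outputLaw hP.2 V.sum_eve).le hout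
  have hleak : ∑ j, ((K : ℝ) * M)⁻¹ * subcodeLeak V.eve P M key c j =
      ∑ ω, p ω * Real.logb 2 (T ω.1 ω.2.2 / (M * outputLaw V.eve P ω.2.2)) := by
    rw [hp_def, DMBC.sum_joint_mul]
    refine Finset.sum_congr rfl fun j _ => ?_
    rw [subcodeLeak, Fintype.sum_prod_type_right]
    refine congrArg _ (Finset.sum_congr rfl fun z _ => ?_)
    rw [DMBC.eve, Finset.sum_mul]
    rfl
  have hsum : ∑ ω, p ω * Real.logb 2 (T ω.1 ω.2.2 / (M * outputLaw V.eve P ω.2.2)) =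
      ∑ ω, p ω * (Real.logb 2 (law p (pair (fun ω => key ω.1) (fun ω => ω.2.2))
        (pair (fun ω => key ω.1) (fun ω => ω.2.2) ω)) - Real.logb 2 (outputLaw V.eve P ω.2.2) +
        Real.logb 2 K) := by
    refine sum_mul_congr_of_pos hp.1 fun ω h => ?_
    rw [show pair (fun ω : J × B × E => key ω.1) (fun ω => ω.2.2) ω = (key ω.1, ω.2.2) from rfl,
      hlaw, Real.logb_div (hT ω h).ne' (mul_pos hM' (hout ω h)).ne',
      Real.logb_mul hM'.ne' (hout ω h).ne', Real.logb_mul (by positivity) (hT ω h).ne',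
      Real.logb_inv, Real.logb_mul hK'.ne' hM'.ne']
    ring
  simp_rw [mul_add, mul_sub, Finset.sum_add_distrib, Finset.sum_sub_distrib, ← Finset.sum_mul,
    hp.2] at hsum
  rw [condEntropy_eq_sub hp.1, entropy_eq_sum p (pair _ _), hleak, hsum]
  linarith

/-- One-shot existence of a code for the wiretap channel `V`. -/
lemma exists_code [DecidableEq J] (V : DMBC A B E) {P : A → ℝ} (hP : P ∈ stdSimplex ℝ A)
    (hkey : ∀ s, (Finset.univ.filter fun j => key j = s).card = M)
    (hK : 0 < K) (hM : 0 < M) {γ e₁ e₂ : ℝ} (hγ : 0 < γ) (he₁ : 0 < e₁) (he₂ : 0 < e₂)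
    (h : (outageProb V.legit P γ + K * M / γ) / e₁ + coveringBound V.eve P M / e₂ < 1) :
    ∃ (c : J → A) (dec : B → Fin K),
      prob ((V.comap c).joint fun _ => ((K : ℝ) * M)⁻¹) {ω | dec ω.2.1 ≠ key ω.1} < e₁ ∧
      Real.logb 2 K - condEntropy ((V.comap c).joint fun _ => ((K : ℝ) * M)⁻¹)
        (fun ω => key ω.1) (fun ω => ω.2.2) < e₂ := by
  have hρ := const_mem_stdSimplex hkey hK hM
  have hcard : (Fintype.card J : ℝ) = K * M := by
    have hpos : (0 : ℝ) < K * M := by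
      have hK' : (0 : ℝ) < K := by exact_mod_cast hK
      have hM' : (0 : ℝ) < M := by exact_mod_cast hM
      positivity
    have := hρ.2
    rw [Finset.sum_const, Finset.card_univ, nsmul_eq_mul] at this
    exact (mul_inv_eq_one₀ hpos.ne').1 this
  have : Nonempty J := by
    by_contra hne
    rw [not_nonempty_iff] at hne
    simpa using hρ.2
  set ρ := ((K : ℝ) * M)⁻¹ with hρ_def
  have hρ0 : 0 ≤ ρ := hρ.1 (Classical.arbitrary J)
  let w : (J → A) → ℝ := fun c => ∏ j, P (c j)
  have hw : ∀ c, 0 ≤ w c := fun c => Finset.prod_nonneg fun _ _ => hP.1 _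
  -- One codebook must be good in both respects. The mean of the sum of the two normalised defects
  -- is below 1, and both are nonnegative in the end, so some codebook has each below 1.
  let F : (J → A) → ℝ := fun c => (∑ j, ρ * packingBound V.legit P γ c j) / e₁ +
    (∑ j, ρ * subcodeLeak V.eve P M key c j) / e₂
  have hF : ∑ c, w c * F c < ∑ c, w c := by
    have h1 : ∑ c, w c * ∑ j, ρ * packingBound V.legit P γ c j ≤
        outageProb V.legit P γ + K * M / γ := by
      simp_rw [Finset.mul_sum]
      rw [Finset.sum_comm]
      simp_rw [mul_left_comm (w _) ρ, ← Finset.mul_sum]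
      have := Finset.sum_le_card_nsmul Finset.univ _ _ fun j _ =>
        sum_prod_mul_packingBound_le (J := J) hP V.legit_nonneg V.sum_legit hγ j
      rw [Finset.card_univ, nsmul_eq_mul, hcard] at this
      refine (mul_le_mul_of_nonneg_left this hρ0).trans_eq ?_
      rw [← mul_assoc, ← hcard, hρ_def, ← hcard, inv_mul_cancel₀ (by
        exact_mod_cast Fintype.card_ne_zero), one_mul]
    have h2 : ∑ c, w c * ∑ j, ρ * subcodeLeak V.eve P M key c j ≤
        coveringBound V.eve P M := by
      simp_rw [Finset.mul_sum]
      rw [Finset.sum_comm]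
      simp_rw [mul_left_comm (w _) ρ, ← Finset.mul_sum]
      have := Finset.sum_le_card_nsmul Finset.univ _ _ fun j _ =>
        sum_prod_mul_subcodeLeak_le (J := J) hP V.eve_nonneg hM key j (hkey _)
      rw [Finset.card_univ, nsmul_eq_mul, hcard] at this
      refine (mul_le_mul_of_nonneg_left this hρ0).trans_eq ?_
      rw [← mul_assoc, ← hcard, hρ_def, ← hcard, inv_mul_cancel₀ (by
        exact_mod_cast Fintype.card_ne_zero), one_mul]
    have h3 : ∑ c, w c = 1 := sum_prod_iid hP.2
    rw [h3]
    simp only [F, mul_add, ← mul_div_assoc, Finset.sum_add_distrib, ← Finset.sum_div]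
    refine lt_of_le_of_lt (add_le_add (div_le_div_of_nonneg_right h1 he₁.le)
      (div_le_div_of_nonneg_right h2 he₂.le)) h
  obtain ⟨c, -, hc⟩ := Finset.exists_lt_of_sum_lt hF
  -- The strict inequality selects a codebook of positive weight, so all its codewords lie in the
  -- support of P.
  have hwc : 0 < w c := (hw c).lt_of_ne' fun h0 => by simp [h0] at hc
  have hFc : F c < 1 := by
    by_contra h1
    exact absurd hc (not_lt.2 (le_mul_of_one_le_right hwc.le (not_lt.1 h1)))
  have hPc : ∀ j, 0 < P (c j) := fun j => (hP.1 _).lt_of_ne' fun h0 =>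
    hwc.ne' (Finset.prod_eq_zero (Finset.mem_univ j) h0)
  obtain ⟨dec, hdec⟩ := exists_decoder_prob_le V P γ key c (ρ := fun _ => ρ) fun _ => hρ0
  have hleak := logb_sub_condEntropy_le V hP hkey hK hM hPc
  -- The terms `subcodeLeak` may be negative. Their mean is not, because it dominates the mutual
  -- information between the key and Eve's output.
  have hnn := condEntropy_le_entropy ((V.comap c).joint_mem hρ) (fun ω => key ω.1)
    (fun ω => ω.2.2)
  rw [entropy_key V hkey hK hM] at hnn
  have h1 : 0 ≤ ∑ j, ρ * packingBound V.legit P γ c j := Finset.sum_nonneg fun j _ =>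
    mul_nonneg hρ0 (packingBound_nonneg V.legit_nonneg _ _ _)
  have h2 : 0 ≤ ∑ j, ρ * subcodeLeak V.eve P M key c j := by linarith
  have h3 : (∑ j, ρ * packingBound V.legit P γ c j) / e₁ < 1 := by
    have := div_nonneg h2 he₂.le
    simp only [F] at hFc
    linarith
  have h4 : (∑ j, ρ * subcodeLeak V.eve P M key c j) / e₂ < 1 := by
    have := div_nonneg h1 he₁.le
    simp only [F] at hFc
    linarith
  rw [div_lt_one he₁] at h3
  rw [div_lt_one he₂] at h4
  exact ⟨c, dec, hdec.trans_lt h3, hleak.trans_lt h4⟩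

end OneShot

end TwoWaySKE
-- Wiretap codes of positive rate, and the degenerate code of rate zero
namespace TwoWaySKE

/-- A code for the one-way use of the channel `V`: a random message, a codeword and a key computed
from the message, and the estimate of the key from the channel output. -/
structure OneWayCode {A B E : Type*} [Fintype B] [Fintype E] (V : DMBC A B E) where
  size : ℕ
  rand : Fin size → ℝ
  rand_mem : rand ∈ stdSimplex ℝ (Fin size)
  keySize : ℕ
  enc : Fin size → A
  key : Fin size → Fin keySize
  dec : B → Fin keySize

namespace OneWayCode

variable {A B E : Type*} [Fintype B] [Fintype E] {V : DMBC A B E}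

/-- The joint law of the message and of the two channel outputs. -/
def law (code : OneWayCode V) : Fin code.size × B × E → ℝ := (V.comap code.enc).joint code.rand

lemma law_mem (code : OneWayCode V) : code.law ∈ stdSimplex ℝ (Fin code.size × B × E) :=
  (V.comap code.enc).joint_mem code.rand_mem

/-- The code is `(R, δ)`-secure when it takes `n` channel uses. -/
structure Secure (code : OneWayCode V) (n : ℕ) (R δ : ℝ) : Prop where
  rate : R - δ < entropy code.law (fun ω => code.key ω.1) / n
  uniform : Real.logb 2 code.keySize / n - δ < entropy code.law (fun ω => code.key ω.1) / n
  reliable : prob code.law {ω | code.dec ω.2.1 ≠ code.key ω.1} < δ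
  secret : 1 - δ < condEntropy code.law (fun ω => code.key ω.1) (fun ω => ω.2.2) /
    entropy code.law (fun ω => code.key ω.1)

/-- A rarely chosen second key has positive entropy, which is all that rate `0` asks for. -/
lemma exists_secure_zero [Nonempty A] (V : DMBC A B E) {δ : ℝ} (hδ : 0 < δ) (hδ1 : δ ≤ 1) {n : ℕ}
    (hn : 1 < n * δ) : ∃ code : OneWayCode V, code.Secure n 0 δ := by
  have hn0 : (0 : ℝ) < n := pos_of_mul_pos_left (zero_lt_one.trans hn) hδ.le
  -- The constant guess 0 errs with probability δ/2, and the constant codeword tells Eve nothing.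
  -- The key set has one bit, which is less than δ per use by `hn`.
  let ρ : Fin 2 → ℝ := ![1 - δ / 2, δ / 2]
  have hρ : ρ ∈ stdSimplex ℝ (Fin 2) := by
    refine ⟨fun i => ?_, by simp [ρ]⟩
    fin_cases i <;> simp [ρ] <;> linarith
  let x₀ : A := Classical.arbitrary A
  let code : OneWayCode V := ⟨2, ρ, hρ, 2, fun _ => x₀, id, fun _ => 0⟩
  have hp : code.law ∈ stdSimplex ℝ (Fin 2 × B × E) := code.law_mem
  have hlaw : TwoWaySKE.law code.law (fun ω => ω.1) = ρ := (V.comap code.enc).law_joint_fst ρ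
  have hH : entropy code.law (fun ω => code.key ω.1) =
      -((1 - δ / 2) * Real.logb 2 (1 - δ / 2) + δ / 2 * Real.logb 2 (δ / 2)) := by
    change entropy code.law (fun ω => ω.1) = _
    rw [entropy, hlaw]
    exact congrArg Neg.neg (Fin.sum_univ_two fun u => ρ u * Real.logb 2 (ρ u))
  have hpos : 0 < entropy code.law (fun ω => code.key ω.1) := by
    have h1 := Real.logb_neg one_lt_two (by linarith : 0 < 1 - δ / 2) (by linarith)
    have h2 := Real.logb_neg one_lt_two (by linarith : 0 < δ / 2) (by linarith)
    rw [hH]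
    nlinarith
  have hcond : condEntropy code.law (fun ω => code.key ω.1) (fun ω => ω.2.2) =
      entropy code.law (fun ω => code.key ω.1) := by
    have h1 := (V.comap code.enc).entropy_joint_eve_sub hρ
    have h2 : entropy code.law (fun ω => ω.2.2) =
        -∑ ω, code.law ω * Real.logb 2 ((V.comap code.enc).eve ω.1 ω.2.2) := by
      have h3 : TwoWaySKE.law code.law (fun ω => ω.2.2) = V.eve x₀ := by
        refine ((V.comap code.enc).law_joint_snd_snd ρ).trans ?_
        ext z
        change ∑ a, ρ a * V.eve x₀ z = _
        rw [← Finset.sum_mul, hρ.2, one_mul]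
      rw [entropy_eq_sum, h3]
      rfl
    rw [condEntropy_eq_sub hp.1, h2]
    change entropy ((V.comap code.enc).joint ρ) (pair (fun ω => ω.1) fun ω => ω.2.2) - _ =
      entropy ((V.comap code.enc).joint ρ) fun ω => ω.1
    change _ = -∑ ω, code.law ω * _ at h1
    linarith
  refine ⟨code, ?_, ?_, ?_, ?_⟩
  · have := div_pos hpos hn0
    linarith
  · have h1 : Real.logb 2 (code.keySize : ℝ) = 1 := Real.logb_self_eq_one one_lt_two
    have h2 : 1 / (n : ℝ) < δ := by rwa [div_lt_iff₀ hn0, mul_comm]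
    rw [h1]
    have := div_pos hpos hn0
    linarith
  · have h1 : prob code.law {ω | code.dec ω.2.1 ≠ code.key ω.1} =
        TwoWaySKE.law code.law (fun ω => ω.1) 1 := by
      refine congrArg (prob code.law) (Set.ext fun ω => ?_)
      change ((0 : Fin 2) ≠ ω.1) ↔ ω.1 = 1
      generalize (ω.1 : Fin 2) = a
      fin_cases a <;> simp
    rw [h1, hlaw]
    simp [ρ]
    linarith
  · rw [hcond, div_self hpos.ne']
    linarith

end OneWayCode

lemma half_rpow_le_floor {x : ℝ} (hx : 1 ≤ x) :
    0 < ⌊(2 : ℝ) ^ x⌋₊ ∧ x - 1 ≤ Real.logb 2 ⌊(2 : ℝ) ^ x⌋₊ := by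
  have h2 : (2 : ℝ) ≤ 2 ^ x := by
    simpa using Real.rpow_le_rpow_of_exponent_le one_le_two hx
  have h3 : (2 : ℝ) ^ (x - 1) ≤ ⌊(2 : ℝ) ^ x⌋₊ := by
    have := Nat.lt_floor_add_one ((2 : ℝ) ^ x)
    rw [Real.rpow_sub_one two_ne_zero]
    linarith
  have h4 : (0 : ℝ) < ⌊(2 : ℝ) ^ x⌋₊ := (by positivity : (0 : ℝ) < 2 ^ (x - 1)).trans_le h3
  exact ⟨by exact_mod_cast h4, (Real.le_logb_iff_rpow_le one_lt_two h4).2 h3⟩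

lemma two_rpow_neg_le_inv {x : ℝ} (hx : 1 ≤ x) : (2 : ℝ) ^ (-x) ≤ x⁻¹ := by
  rw [Real.rpow_neg two_pos.le]
  refine inv_anti₀ (by linarith) ?_
  have := one_add_mul_self_le_rpow_one_add (by norm_num : (-1 : ℝ) ≤ 1) hx
  norm_num at this
  linarith

/-- A message is a key together with one of M fillers, so a uniform message has a uniform key. -/
lemma card_filter_finProdFinEquiv {K M : ℕ} (s : Fin K) :
    (Finset.univ.filter fun j : Fin (K * M) => (finProdFinEquiv.symm j).1 = s).card = M := by
  have : (Finset.univ.filter fun j : Fin (K * M) => (finProdFinEquiv.symm j).1 = s) =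
      (Finset.univ : Finset (Fin M)).map
        ⟨fun m => finProdFinEquiv (s, m), fun m m' h => by simpa using h⟩ := by
    ext j
    simp only [Finset.mem_filter, Finset.mem_univ, true_and, Finset.mem_map]
    constructor
    · rintro rfl
      exact ⟨(finProdFinEquiv.symm j).2, finProdFinEquiv.apply_symm_apply j⟩
    · rintro ⟨m, rfl⟩
      change (finProdFinEquiv.symm (finProdFinEquiv (s, m))).1 = s
      rw [Equiv.symm_apply_apply]
  rw [this, Finset.card_map, Finset.card_univ, Fintype.card_fin]

/-- Wiretap codes for the block channel, of rate close to `I(X; Y) - I(X; Z)`. -/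
lemma exists_secure_code {X Y Z : Type*} [Fintype X] [Fintype Y] [Fintype Z] (W : DMBC X Y Z)
    {P : X → ℝ} (hP : P ∈ stdSimplex ℝ X) {D δ : ℝ} (hD : 0 < D)
    (hDI : D = infoMean W.legit P - infoMean W.eve P) (hδ : 0 < δ) :
    ∃ n₀ : ℝ, ∀ (ι : Type) [Fintype ι] [DecidableEq ι], n₀ < Fintype.card ι →
      ∃ code : OneWayCode (W.block ι), code.Secure (Fintype.card ι) D δ := by
  -- The key rate is a = D - 3ε. With M near 2^{n I(X;Z)} and threshold γ = 2^{n(I(X;Y) - ε)}, the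
  -- ratio KM/γ is at most 2·2^{-2nε}. The choice η = δa/2 makes the linear part of the leak equal
  -- nδa/4, half of the budget below to leading order.
  set ε := min D δ / 8 with hε_def
  have hε : 0 < ε := div_pos (lt_min hD hδ) (by norm_num)
  have hεD : 8 * ε ≤ D := by rw [hε_def]; linarith [min_le_left D δ]
  have hεδ : 8 * ε ≤ δ := by rw [hε_def]; linarith [min_le_right D δ]
  set a := D - 3 * ε with ha_def
  have ha : 0 < a := by linarith
  set η := δ * a / 2 with hη_def
  have hη : 0 < η := by positivity
  have hvY : 0 ≤ infoVar W.legit P := infoVar_nonneg hP.1 W.legit_nonneg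
  have hIZ : 0 ≤ infoMean W.eve P := by
    rw [W.infoMean_eve hP]; exact mutualInfo_nonneg (W.joint_mem hP) _ _
  -- In order: outage at most δ/8, packing at most δ/8, na > 2, nε > 2, and a covering bound below
  -- half of the leakage budget.
  refine ⟨max (max (8 * infoVar W.legit P / (ε ^ 2 * δ)) (8 / (ε * δ)))
    (max (max (2 / a) (2 / ε)) (8 * (1 + infoVar W.eve P / (2 * η) + δ) / (δ * a))), ?_⟩
  intro ι _ _ hn
  set n : ℝ := (Fintype.card ι : ℝ) with hn_def
  simp only [max_lt_iff] at hn
  obtain ⟨⟨hn1, hn2⟩, ⟨hn3, hn4⟩, hn5⟩ := hn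
  have hn0 : 0 < n := lt_of_le_of_lt (by positivity) hn3
  have hcard : 0 < Fintype.card ι := by
    rw [hn_def] at hn0; exact_mod_cast hn0
  rw [div_lt_iff₀ (by positivity)] at hn1 hn2 hn3 hn4 hn5
  obtain ⟨hK, hKlog⟩ := half_rpow_le_floor (x := n * a) (by linarith)
  set K := ⌊(2 : ℝ) ^ (n * a)⌋₊ with hK_def
  set M := ⌈(2 : ℝ) ^ (n * infoMean W.eve P)⌉₊ with hM_def
  have hM : 0 < M := Nat.ceil_pos.2 (by positivity)
  let key : Fin (K * M) → Fin K := fun j => (finProdFinEquiv.symm j).1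
  have hkey : ∀ s, (Finset.univ.filter fun j => key j = s).card = M :=
    card_filter_finProdFinEquiv
  have hKle : (K : ℝ) ≤ 2 ^ (n * a) := Nat.floor_le (by positivity)
  have hMle : (M : ℝ) ≤ 2 * 2 ^ (n * infoMean W.eve P) := by
    have h1 := Nat.ceil_lt_add_one (by positivity : (0 : ℝ) ≤ 2 ^ (n * infoMean W.eve P))
    have h2 : (1 : ℝ) ≤ 2 ^ (n * infoMean W.eve P) :=
      Real.one_le_rpow one_le_two (by positivity)
    linarith
  set γ : ℝ := 2 ^ (n * (infoMean W.legit P - ε)) with hγ_def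
  have hγ : 0 < γ := by positivity
  have hpack : K * M / γ ≤ δ / 8 := by
    have h1 : (K : ℝ) * M / γ ≤ 2 * 2 ^ (-(2 * (n * ε))) := by
      rw [div_le_iff₀ hγ]
      calc (K : ℝ) * M ≤ 2 ^ (n * a) * (2 * 2 ^ (n * infoMean W.eve P)) :=
            mul_le_mul hKle hMle (by positivity) (by positivity)
        _ = _ := by
            rw [hγ_def, mul_left_comm, mul_assoc, ← Real.rpow_add two_pos,
              ← Real.rpow_add two_pos]
            congr 2
            rw [ha_def, hDI]
            ring
    have h2 := two_rpow_neg_le_inv (x := 2 * (n * ε)) (by linarith)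
    refine h1.trans ((mul_le_mul_of_nonneg_left h2 two_pos.le).trans ?_)
    rw [← div_eq_mul_inv, div_le_div_iff₀ (by positivity) (by norm_num)]
    nlinarith
  have hout : outageProb (W.block ι).legit (blockLaw ι P) γ ≤ δ / 8 := by
    rw [W.legit_block]
    refine (outageProb_block_le hP W.legit_nonneg W.sum_legit hε hcard).trans ?_
    rw [div_le_div_iff₀ (by positivity) (by norm_num)]
    linarith
  have hcov := coveringBound_block_le (ι := ι) (M := M) hP W.eve_nonneg W.sum_eve hη hcard
    (Nat.le_ceil _)
  rw [← W.eve_block] at hcov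
  have hna : 0 < n * a - 1 := by linarith
  -- The leakage budget: log K is at least na - 1, the 1 paying for the floor, so a smaller leak is
  -- less than δ H(S).
  have he₂ : 0 < δ * (n * a - 1) := by positivity
  have hcov' : coveringBound (W.block ι).eve (blockLaw ι P) M < δ * (n * a - 1) / 2 := by
    refine hcov.trans_lt ?_
    rw [← hn_def]
    have : n * η / 2 = n * (δ * a) / 4 := by rw [hη_def]; ring
    rw [this]
    have hvE : 0 ≤ infoVar W.eve P / (2 * η) :=
      div_nonneg (infoVar_nonneg hP.1 W.eve_nonneg) (by positivity)
    linarith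
  obtain ⟨c, dec, hrel, hleak⟩ := exists_code (W.block ι) (blockLaw_mem (ι := ι) hP) hkey hK hM
    hγ hδ he₂ (by
      have h1 : (outageProb (W.block ι).legit (blockLaw ι P) γ + K * M / γ) / δ ≤ 1 / 4 := by
        rw [div_le_iff₀ hδ]; linarith
      have h2 : coveringBound (W.block ι).eve (blockLaw ι P) M / (δ * (n * a - 1)) < 1 / 2 := by
        rw [div_lt_iff₀ he₂]; linarith
      linarith)
  have hent := entropy_key (W.block ι) hkey hK hM c
  let code : OneWayCode (W.block ι) :=
    ⟨K * M, fun _ => ((K : ℝ) * M)⁻¹, const_mem_stdSimplex hkey hK hM, K, c, key, dec⟩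
  have hH : entropy code.law (fun ω => code.key ω.1) = Real.logb 2 K := hent
  have hHpos : 0 < entropy code.law (fun ω => code.key ω.1) := by rw [hH]; linarith
  refine ⟨code, ?_, ?_, hrel, ?_⟩
  · rw [hH, lt_div_iff₀ hn0]
    have : n * a = n * D - 3 * (n * ε) := by rw [ha_def]; ring
    have h2 : 8 * (n * ε) ≤ n * δ := by nlinarith
    linarith
  · rw [hH]
    change Real.logb 2 K / n - δ < Real.logb 2 K / n
    linarith
  · rw [lt_div_iff₀ hHpos, hH]
    have h1 : Real.logb 2 K - condEntropy code.law (fun ω => code.key ω.1) (fun ω => ω.2.2) <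
        δ * (n * a - 1) := hleak
    have h2 := mul_le_mul_of_nonneg_left hKlog hδ.le
    linarith

end TwoWaySKE
-- One-way codes as one-round protocols
namespace TwoWaySKE

namespace Schedule

/-- The schedule with a single round. -/
def oneRound (aliceFirst : Bool) (n : ℕ) : Schedule := ⟨1, aliceFirst, fun _ => n⟩

lemma card_fwdUse_oneRound (n : ℕ) : Fintype.card (oneRound true n).FwdUse = n := by
  have h : Fintype.card {r : Fin (oneRound true n).rounds //
      (oneRound true n).aliceSends r = true} = 1 :=
    Fintype.card_eq_one_iff.2 ⟨⟨(0 : Fin 1), rfl⟩, fun r => Subtype.ext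
      (Subsingleton.elim (α := Fin 1) _ _)⟩
  rw [Fintype.card_sigma]
  change ∑ r : {r : Fin (oneRound true n).rounds // (oneRound true n).aliceSends r = true},
    Fintype.card (Fin n) = n
  rw [Fintype.card_fin, Finset.sum_const, Finset.card_univ, h, one_smul]

lemma card_bwdUse_oneRound (n : ℕ) : Fintype.card (oneRound false n).BwdUse = n := by
  have h : Fintype.card {r : Fin (oneRound false n).rounds //
      (oneRound false n).aliceSends r = false} = 1 :=
    Fintype.card_eq_one_iff.2 ⟨⟨(0 : Fin 1), rfl⟩, fun r => Subtype.ext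
      (Subsingleton.elim (α := Fin 1) _ _)⟩
  rw [Fintype.card_sigma]
  change ∑ r : {r : Fin (oneRound false n).rounds // (oneRound false n).aliceSends r = false},
    Fintype.card (Fin n) = n
  rw [Fintype.card_fin, Finset.sum_const, Finset.card_univ, h, one_smul]

instance isEmpty_bwdUse_oneRound (n : ℕ) : IsEmpty (oneRound true n).BwdUse :=
  ⟨fun j => by
    have h := j.1.2
    simp [aliceSends, oneRound] at h⟩

instance isEmpty_fwdUse_oneRound (n : ℕ) : IsEmpty (oneRound false n).FwdUse :=
  ⟨fun j => by
    have h := j.1.2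
    simp [aliceSends, oneRound] at h⟩

lemma uses_oneRound (b : Bool) (n : ℕ) : (oneRound b n).uses = n := by
  rw [uses]
  cases b
  · rw [card_bwdUse_oneRound, Fintype.card_eq_zero, zero_add]
  · rw [card_fwdUse_oneRound, Fintype.card_eq_zero, add_zero]

end Schedule

lemma one_mem_stdSimplex_fin_one : (fun _ => 1) ∈ stdSimplex ℝ (Fin 1) :=
  ⟨fun _ => zero_le_one, by simp⟩

namespace OneWayCode

variable {Xf Yf Zf Xb Yb Zb : Type*}

/-- Alice transports the key to Bob with a code for the forward channel. -/
def forward [Fintype Yf] [Fintype Zf] {Wf : DMBC Xf Yf Zf} (Xb Yb : Type*) {n : ℕ}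
    (code : OneWayCode (Wf.block (Schedule.oneRound true n).FwdUse)) : Protocol Xf Yf Xb Yb where
  σ := Schedule.oneRound true n
  mA := code.size
  randA := code.rand
  randA_mem := code.rand_mem
  mB := 1
  randB := fun _ => 1
  randB_mem := one_mem_stdSimplex_fin_one
  encA a _ := code.enc a
  encA_causal _ _ _ _ _ := rfl
  encB _ _ j := isEmptyElim j
  encB_causal _ _ _ j := isEmptyElim j
  keySize := code.keySize
  outA a _ := code.key a
  outB _ y := code.dec y
  keyByAlice := true

/-- Bob transports the key to Alice with a code for the backward channel. -/
def backward [Fintype Yb] [Fintype Zb] {Wb : DMBC Xb Yb Zb} (Xf Yf : Type*) {n : ℕ}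
    (code : OneWayCode (Wb.block (Schedule.oneRound false n).BwdUse)) : Protocol Xf Yf Xb Yb where
  σ := Schedule.oneRound false n
  mA := 1
  randA := fun _ => 1
  randA_mem := one_mem_stdSimplex_fin_one
  mB := code.size
  randB := code.rand
  randB_mem := code.rand_mem
  encA _ _ j := isEmptyElim j
  encA_causal _ _ _ j := isEmptyElim j
  encB b _ := code.enc b
  encB_causal _ _ _ _ _ := rfl
  keySize := code.keySize
  outA _ y := code.dec y
  outB b _ := code.key b
  keyByAlice := false

lemma isOneRoundKeyTransport_forward [Fintype Yf] [Fintype Zf]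
    {Wf : DMBC Xf Yf Zf} {n : ℕ}
    (code : OneWayCode (Wf.block (Schedule.oneRound true n).FwdUse)) :
    (code.forward Xb Yb).IsOneRoundKeyTransport :=
  ⟨rfl, rfl, fun _ _ _ _ => rfl, fun h => absurd h (by simp [forward])⟩

lemma isOneRoundKeyTransport_backward [Fintype Yb] [Fintype Zb]
    {Wb : DMBC Xb Yb Zb} {n : ℕ}
    (code : OneWayCode (Wb.block (Schedule.oneRound false n).BwdUse)) :
    (code.backward Xf Yf).IsOneRoundKeyTransport :=
  ⟨rfl, rfl, fun h => absurd h (by simp [backward]), fun _ _ _ _ => rfl⟩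

end OneWayCode

/-- A protocol is as secure as a one-way code when its outcomes follow the law of the code. -/
lemma Protocol.secure_of_oneWayCode {Xf Yf Zf Xb Yb Zb A B E : Type*} [Fintype Yf] [Fintype Zf]
    [Fintype Yb] [Fintype Zb] [Fintype B] [Fintype E] {Wf : DMBC Xf Yf Zf} {Wb : DMBC Xb Yb Zb}
    {V : DMBC A B E} {prot : Protocol Xf Yf Xb Yb} {code : OneWayCode V} {R δ : ℝ}
    (h : code.Secure prot.σ.uses R δ) (hn : 0 < prot.σ.uses)
    (T : prot.Outcome Zf Zb ≃ Fin code.size × B × E)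
    (hrun : ∀ o, prot.run Wf Wb o = code.law (T o)) (hK : code.keySize = prot.keySize)
    (hkey : ∀ o, prot.key o = Fin.cast hK (code.key (T o).1))
    (hest : ∀ o, prot.keyEst o = Fin.cast hK (code.dec (T o).2.1))
    (hview : ∀ o o' : prot.Outcome Zf Zb, prot.viewE o' = prot.viewE o ↔ (T o').2.2 = (T o).2.2) :
    prot.Secure Wf Wb R δ := by
  have hp : ∀ o, 0 ≤ prot.run Wf Wb o := prot.run_nonneg Wf Wb
  have hlaw : law (prot.run Wf Wb) T = code.law := by
    ext a
    obtain ⟨o, rfl⟩ := T.surjective a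
    rw [law_of_injective _ T.injective, hrun]
  have hH : entropy (prot.run Wf Wb) prot.key = entropy code.law fun ω => code.key ω.1 := by
    rw [← hlaw, entropy_map]
    exact entropy_congr _ fun o o' => by rw [hkey, hkey, (Fin.cast_injective hK).eq_iff]
  have hHc : condEntropy (prot.run Wf Wb) prot.key prot.viewE =
      condEntropy code.law (fun ω => code.key ω.1) (fun ω => ω.2.2) := by
    rw [condEntropy_eq_sub hp, condEntropy_eq_sub code.law_mem.1, ← hlaw, entropy_map, entropy_map]
    refine congrArg₂ _ (entropy_congr _ fun o o' => ?_) (entropy_congr _ hview)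
    simp only [pair, Prod.mk.injEq]
    rw [hkey, hkey, (Fin.cast_injective hK).eq_iff, hview]
  have hprob : prob (prot.run Wf Wb) {o | prot.keyEst o ≠ prot.key o} =
      prob code.law {ω | code.dec ω.2.1 ≠ code.key ω.1} := by
    classical
    simp_rw [prob, Set.indicator_apply]
    refine Fintype.sum_equiv T _ _ fun o => ?_
    rw [hrun]
    refine if_congr ?_ rfl rfl
    change prot.keyEst o ≠ prot.key o ↔ code.dec (T o).2.1 ≠ code.key (T o).1
    rw [hkey, hest, (Fin.cast_injective hK).ne_iff]
  refine ⟨hn, ?_, ?_, ?_, ?_⟩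
  · rw [hH]; exact h.rate
  · rw [hH, ← hK]; exact h.uniform
  · rw [hprob]; exact h.reliable
  · rw [hH, hHc]; exact h.secret

namespace OneWayCode

variable {Xf Yf Zf Xb Yb Zb : Type*} [Fintype Yf] [Fintype Zf] [Fintype Yb] [Fintype Zb]
  {Wf : DMBC Xf Yf Zf} {Wb : DMBC Xb Yb Zb} {n : ℕ} {R δ : ℝ}

lemma Secure.forward {code : OneWayCode (Wf.block (Schedule.oneRound true n).FwdUse)}
    (h : code.Secure n R δ) (hn : 0 < n) : (code.forward Xb Yb).Secure Wf Wb R δ := by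
  have hu : (code.forward Xb Yb).σ.uses = n := Schedule.uses_oneRound true n
  let T : (code.forward Xb Yb).Outcome Zf Zb ≃ Fin code.size ×
      ((Schedule.oneRound true n).FwdUse → Yf) × ((Schedule.oneRound true n).FwdUse → Zf) :=
    { toFun := fun o => (o.a, o.yf, o.zf)
      invFun := fun x => ⟨x.1, (0 : Fin 1), x.2.1, x.2.2,
        fun j => (Schedule.isEmpty_bwdUse_oneRound n).elim j,
        fun j => (Schedule.isEmpty_bwdUse_oneRound n).elim j⟩
      left_inv := fun o => by
        refine Protocol.Outcome.ext rfl (Subsingleton.elim (α := Fin 1) _ _) rfl rfl ?_ ?_ <;>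
          exact funext fun j =>
            (Schedule.isEmpty_bwdUse_oneRound n).elim j
      right_inv := fun _ => rfl }
  refine Protocol.secure_of_oneWayCode (by rwa [hu]) (by rwa [hu]) T (fun o => ?_) rfl
    (fun _ => rfl) (fun _ => rfl) fun o o' => ?_
  · have h1 : ∏ j, Wb.prob ((code.forward Xb Yb).encB o.b o.yf j) (o.yb j, o.zb j) = 1 :=
      Finset.prod_eq_one fun j _ =>
        (Schedule.isEmpty_bwdUse_oneRound n).elim j
    rw [Protocol.run, h1, mul_one]
    exact congrArg (· * _) (mul_one (code.rand o.a))
  · have h2 : o'.zb = o.zb := funext fun j =>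
      (Schedule.isEmpty_bwdUse_oneRound n).elim j
    exact ⟨fun h => congrArg Prod.fst h, fun h => Prod.ext h h2⟩

lemma Secure.backward {code : OneWayCode (Wb.block (Schedule.oneRound false n).BwdUse)}
    (h : code.Secure n R δ) (hn : 0 < n) : (code.backward Xf Yf).Secure Wf Wb R δ := by
  have hu : (code.backward Xf Yf).σ.uses = n := Schedule.uses_oneRound false n
  let T : (code.backward Xf Yf).Outcome Zf Zb ≃ Fin code.size ×
      ((Schedule.oneRound false n).BwdUse → Yb) × ((Schedule.oneRound false n).BwdUse → Zb) :=
    { toFun := fun o => (o.b, o.yb, o.zb)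
      invFun := fun x => ⟨(0 : Fin 1), x.1,
        fun j => (Schedule.isEmpty_fwdUse_oneRound n).elim j,
        fun j => (Schedule.isEmpty_fwdUse_oneRound n).elim j,
        x.2.1, x.2.2⟩
      left_inv := fun o => by
        refine Protocol.Outcome.ext (Subsingleton.elim (α := Fin 1) _ _) rfl ?_ ?_ rfl rfl <;>
          exact funext fun j =>
            (Schedule.isEmpty_fwdUse_oneRound n).elim j
      right_inv := fun _ => rfl }
  refine Protocol.secure_of_oneWayCode (by rwa [hu]) (by rwa [hu]) T (fun o => ?_) rfl
    (fun _ => rfl) (fun _ => rfl) fun o o' => ?_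
  · have h1 : ∏ j, Wf.prob ((code.backward Xf Yf).encA o.a o.yb j) (o.yf j, o.zf j) = 1 :=
      Finset.prod_eq_one fun j _ =>
        (Schedule.isEmpty_fwdUse_oneRound n).elim j
    rw [Protocol.run, h1, mul_one]
    exact congrArg (· * _) (one_mul (code.rand o.b))
  · have h2 : o'.zf = o.zf := funext fun j =>
      (Schedule.isEmpty_fwdUse_oneRound n).elim j
    exact ⟨fun h => (Prod.ext_iff.1 h).2, fun h => Prod.ext h2 h⟩

end OneWayCode

end TwoWaySKE
-- Key transport at capacity and the final assembly
namespace TwoWaySKE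

variable {Xf Yf Zf Xb Yb Zb : Type*} [Fintype Xf] [Fintype Yf] [Fintype Zf]
  [Fintype Xb] [Fintype Yb] [Fintype Zb] {Wf : DMBC Xf Yf Zf} {Wb : DMBC Xb Yb Zb}

-- Rate zero still demands a key of positive entropy: a constant key has secrecy ratio 0/0 = 0,
-- which is not above 1 - δ when δ ≤ 1.
omit [Fintype Xf] [Fintype Xb] in
lemma exists_oneRoundKeyTransport_zero [Nonempty Xf] (Wf : DMBC Xf Yf Zf) (Wb : DMBC Xb Yb Zb)
    {δ : ℝ} (hδ : 0 < δ) (hδ1 : δ ≤ 1) :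
    ∃ prot : Protocol Xf Yf Xb Yb, prot.IsOneRoundKeyTransport ∧ prot.Secure Wf Wb 0 δ := by
  obtain ⟨n, hn⟩ := exists_nat_gt (1 / δ)
  have hn0 : 0 < n := by exact_mod_cast (one_div_pos.2 hδ).trans hn
  rw [div_lt_iff₀ hδ] at hn
  obtain ⟨code, hcode⟩ := OneWayCode.exists_secure_zero
    (Wf.block (Schedule.oneRound true n).FwdUse) hδ hδ1 hn
  exact ⟨_, code.isOneRoundKeyTransport_forward, hcode.forward hn0⟩

omit [Fintype Xb] in
lemma exists_oneRoundKeyTransport_forward (Wb : DMBC Xb Yb Zb) {P : Xf → ℝ}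
    (hP : P ∈ stdSimplex ℝ Xf) {D δ : ℝ} (hD : 0 < D)
    (hDI : D = mutualInfo (Wf.joint P) (fun a => a.1) (fun a => a.2.1) -
      mutualInfo (Wf.joint P) (fun a => a.1) (fun a => a.2.2)) (hδ : 0 < δ) :
    ∃ prot : Protocol Xf Yf Xb Yb, prot.IsOneRoundKeyTransport ∧ prot.Secure Wf Wb D δ := by
  rw [← Wf.infoMean_legit hP, ← Wf.infoMean_eve hP] at hDI
  obtain ⟨n₀, h⟩ := exists_secure_code Wf hP hD hDI hδ
  obtain ⟨n, hn⟩ := exists_nat_gt (max n₀ 0)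
  have hn0 : 0 < n := by exact_mod_cast (le_max_right _ _).trans_lt hn
  have hcard := Schedule.card_fwdUse_oneRound n
  obtain ⟨code, hcode⟩ := h (Schedule.oneRound true n).FwdUse
    (by rw [hcard]; exact (le_max_left _ _).trans_lt hn)
  rw [hcard] at hcode
  exact ⟨_, code.isOneRoundKeyTransport_forward, hcode.forward hn0⟩

omit [Fintype Xf] in
lemma exists_oneRoundKeyTransport_backward (Wf : DMBC Xf Yf Zf) {P : Xb → ℝ}
    (hP : P ∈ stdSimplex ℝ Xb) {D δ : ℝ} (hD : 0 < D)
    (hDI : D = mutualInfo (Wb.joint P) (fun a => a.1) (fun a => a.2.1) -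
      mutualInfo (Wb.joint P) (fun a => a.1) (fun a => a.2.2)) (hδ : 0 < δ) :
    ∃ prot : Protocol Xf Yf Xb Yb, prot.IsOneRoundKeyTransport ∧ prot.Secure Wf Wb D δ := by
  rw [← Wb.infoMean_legit hP, ← Wb.infoMean_eve hP] at hDI
  obtain ⟨n₀, h⟩ := exists_secure_code Wb hP hD hDI hδ
  obtain ⟨n, hn⟩ := exists_nat_gt (max n₀ 0)
  have hn0 : 0 < n := by exact_mod_cast (le_max_right _ _).trans_lt hn
  have hcard := Schedule.card_bwdUse_oneRound n
  obtain ⟨code, hcode⟩ := h (Schedule.oneRound false n).BwdUse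
    (by rw [hcard]; exact (le_max_left _ _).trans_lt hn)
  rw [hcard] at hcode
  exact ⟨_, code.isOneRoundKeyTransport_backward, hcode.backward hn0⟩

/-- A degraded channel and its obversely degraded part have the same largest `I(X; Y | Z)`, which
is also a value of `I(X; Y) - I(X; Z)`. -/
lemma DMBC.DegradedInto.exists_optimal {X Y Z XO YO ZO XR YR ZR : Type*} [Fintype X] [Fintype XO]
    [Fintype XR] [Fintype Y] [Fintype Z] [Fintype YO] [Fintype ZO] [Fintype YR] [Fintype ZR]
    [Nonempty X] {W : DMBC X Y Z} {WO : DMBC XO YO ZO} {WR : DMBC XR YR ZR}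
    (h : W.DegradedInto WO WR) :
    ∃ c : ℝ, 0 ≤ c ∧
      (∃ P ∈ stdSimplex ℝ X, W.secretInfo P = c ∧
        mutualInfo (W.joint P) (fun a => a.1) (fun a => a.2.1) -
          mutualInfo (W.joint P) (fun a => a.1) (fun a => a.2.2) = c) ∧
      (∀ P ∈ stdSimplex ℝ X, W.secretInfo P ≤ c) ∧
      (∃ P ∈ stdSimplex ℝ XO, WO.secretInfo P = c) ∧
      ∀ P ∈ stdSimplex ℝ XO, WO.secretInfo P ≤ c := by
  have hne : Nonempty XO := by
    obtain ⟨⟨eX, -⟩, -⟩ := h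
    exact ⟨(eX (Classical.arbitrary X)).1⟩
  obtain ⟨PO, hPO, hmax⟩ := WO.exists_isMaxOn_secretInfo
  obtain ⟨P, hP, hle⟩ := h.exists_secretInfo_le_mutualInfo_sub hPO
  have hub : ∀ P ∈ stdSimplex ℝ X, W.secretInfo P ≤ WO.secretInfo PO := fun P hP => by
    obtain ⟨PO', hPO', h'⟩ := h.exists_secretInfo_le hP
    exact h'.trans (hmax _ hPO')
  have h2 := W.mutualInfo_sub_le_secretInfo hP
  have h3 := hub P hP
  -- The sandwich closes: the maximum over the obverse part is at most I(X;Y) - I(X;Z) at `P`, which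
  -- is at most I(X;Y|Z) at `P`, which is at most that maximum.
  exact ⟨_, WO.secretInfo_nonneg hPO, ⟨P, hP, le_antisymm h3 (hle.trans h2),
    le_antisymm (h2.trans h3) hle⟩, hub, ⟨PO, hPO, rfl⟩, hmax⟩

end TwoWaySKE
open TwoWaySKE in
theorem theorem3
    {Xf Yf Zf XfO YfO ZfO XfR YfR ZfR Xb Yb Zb XbO YbO ZbO XbR YbR ZbR : Type*}
    [Fintype Xf] [Fintype Yf] [Fintype Zf] [Fintype XfO] [Fintype YfO] [Fintype ZfO]
    [Fintype XfR] [Fintype YfR] [Fintype ZfR]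
    [Fintype Xb] [Fintype Yb] [Fintype Zb] [Fintype XbO] [Fintype YbO] [Fintype ZbO]
    [Fintype XbR] [Fintype YbR] [Fintype ZbR]
    [Nonempty Xf] [Nonempty Xb]
    (Wf : DMBC Xf Yf Zf) (WfO : DMBC XfO YfO ZfO) (WfR : DMBC XfR YfR ZfR)
    (Wb : DMBC Xb Yb Zb) (WbO : DMBC XbO YbO ZbO) (WbR : DMBC XbR YbR ZbR)
    (hf : Wf.DegradedInto WfO WfR) (hb : Wb.DegradedInto WbO WbR) :
    ∃ C : ℝ,
      -- the secret-key capacity is the single-letter maximum over the obverse subchannels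
      IsSecretKeyCapacity Wf Wb C ∧
      IsGreatest (secretInfoValues WfO WbO) C ∧
      -- the general upper bound and the general lower bound coincide with it
      IsGreatest (secretInfoValues Wf Wb) C ∧
      IsLUB ({0} ∪ (twoRoundValues Wf Wb ∪ twoRoundValues Wb Wf)) C ∧
      -- it is achieved by one-round key transport
      ∀ δ : ℝ, 0 < δ → δ ≤ 1 →
        ∃ prot : Protocol Xf Yf Xb Yb, prot.IsOneRoundKeyTransport ∧ prot.Secure Wf Wb C δ := by
  obtain ⟨cf, hcf, ⟨Pf, hPf, hPf1, hPf2⟩, hf1, ⟨PfO, hPfO, hPfO1⟩, hf2⟩ := hf.exists_optimal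
  obtain ⟨cb, hcb, ⟨Pb, hPb, hPb1, hPb2⟩, hb1, ⟨PbO, hPbO, hPbO1⟩, hb2⟩ := hb.exists_optimal
  have hC : 0 ≤ max cf cb := hcf.trans (le_max_left _ _)
  have hf' : ∀ P ∈ stdSimplex ℝ Xf, Wf.secretInfo P ≤ max cf cb := fun P hP =>
    (hf1 P hP).trans (le_max_left _ _)
  have hb' : ∀ P ∈ stdSimplex ℝ Xb, Wb.secretInfo P ≤ max cf cb := fun P hP =>
    (hb1 P hP).trans (le_max_right _ _)
  have hach : ∀ δ : ℝ, 0 < δ → δ ≤ 1 → ∃ prot : Protocol Xf Yf Xb Yb,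
      prot.IsOneRoundKeyTransport ∧ prot.Secure Wf Wb (max cf cb) δ := by
    intro δ hδ hδ1
    -- Wiretap coding needs a positive rate, so C = 0 is treated apart. Otherwise the sender is the
    -- party at the input of the better channel.
    rcases hC.eq_or_lt with h0 | h0
    · rw [← h0]
      exact exists_oneRoundKeyTransport_zero Wf Wb hδ hδ1
    · rcases max_choice cf cb with h | h <;> rw [h] at h0 ⊢
      · exact exists_oneRoundKeyTransport_forward Wb hPf h0 hPf2.symm hδ
      · exact exists_oneRoundKeyTransport_backward Wf hPb h0 hPb2.symm hδ
  refine ⟨max cf cb, ⟨⟨hC, fun δ hδ hδ1 => ?_⟩, fun R hR => hR.le hf' hb'⟩,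
    ⟨⟨PfO, hPfO, PbO, hPbO, by rw [hPfO1, hPbO1]⟩, ?_⟩,
    ⟨⟨Pf, hPf, Pb, hPb, by rw [hPf1, hPb1]⟩, ?_⟩, ⟨?_, fun B hB => ?_⟩, hach⟩
  · obtain ⟨prot, -, hprot⟩ := hach δ hδ hδ1
    exact ⟨prot, hprot⟩
  · rintro _ ⟨P, hP, Q, hQ, rfl⟩
    exact max_le_max (hf2 P hP) (hb2 Q hQ)
  · rintro _ ⟨P, hP, Q, hQ, rfl⟩
    exact max_le_max (hf1 P hP) (hb1 Q hQ)
  · rintro r (rfl | hr | hr)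
    · exact hC
    · exact le_of_mem_twoRoundValues hC hf' hb' hr
    · exact le_of_mem_twoRoundValues hC hb' hf' hr
  · rcases hC.eq_or_lt with h0 | h0
    · rw [← h0]
      exact hB (Or.inl rfl)
    · rcases max_choice cf cb with h | h <;> rw [h] at h0 ⊢
      -- The two-round scheme without uses in its first round puts its rate on the second channel.
      -- So the forward optimum is a value of the scheme that begins on the backward channel, and
      -- conversely.
      · rw [← hPf2] at h0 ⊢
        exact hB (Or.inr (Or.inr (mutualInfo_sub_mem_twoRoundValues hPf h0)))
      · rw [← hPb2] at h0 ⊢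
        exact hB (Or.inr (Or.inl (mutualInfo_sub_mem_twoRoundValues hPb h0)))
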